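/- Let $n\ge 1$ and let $\mathbb H^n=\mathbb R^n\times\mathbb R^n\times\mathbb R$ be the Heisenberg group with group law $$(x,u,t)(y,v,s)=\bigl(x+y,\;u+v,\;t+s+\tfrac12(u\cdot y-v\cdot x)\bigr),$$ Haar measure $dx\,du\,dt$, and convolution $(f*g)(p)=\int_{\mathbb H^n}f(pq^{-1})g(q)\,dq$ on $L^1(\mathbb H^n)$. For $\lambda\in\mathbb R$, $\lambda\neq0$, let $\pi_\lambda$ be the Schrödinger representation on $V=L^2(\mathbb R^n)$, $$\pi_\lambda(x,u,t)\varphi(\xi)=e^{i\lambda t}e^{i\lambda(x\cdot\xi+\frac12x\cdot u)}\varphi(\xi+u),$$ and put $\pi_\lambda(f)\varphi=\int_{\mathbb H^n}f(p)\,\pi_\lambda(p)\varphi\,dp$ for $f\in L^1(\mathbb H^n)$, $\varphi\in V$. For $f\in L^1(\mathbb H^n)$ let $f^\lambda(x,u)=\int_{\mathbb R}f(x,u,t)e^{i\lambda t}\,dt$, and let $\mathcal F_1f^\lambda$, $\mathcal F_2f^\lambda$ be the Fourier transforms of $f^\lambda$ in the first and in the second variable, $$\mathcal F_1f^\lambda(x,u)=(2\pi)^{-n/2}\int_{\mathbb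 R^n}f^\lambda(y,u)e^{-ix\cdot y}\,dy,\qquad \mathcal F_2f^\lambda(x,u)=(2\pi)^{-n/2}\int_{\mathbb R^n}f^\lambda(x,v)e^{-iu\cdot v}\,dv.$$ For $t>0$ let $\mathcal A_t^\lambda$ be the set of all $f\in L^1(\mathbb H^n)$ for which there is a constant $C$ such that for almost every $(x,u)\in\mathbb R^{2n}$ $$|\mathcal F_1f^\lambda(x,u)|\le C\,e^{-\tanh(t\lambda)\left(\frac1\lambda|x|^2+\frac\lambda4|u|^2\right)},\qquad |\mathcal F_2f^\lambda(x,u)|\le C\,e^{-\tanh(t\lambda)\left(\frac\lambda4|x|^2+\frac1\lambda|u|^2\right)}.$$ Let $H(\lambda)=-\Delta+\lambda^2|x|^2$ be the scaled Hermite operator on $\mathbb R^n$, with orthonormal eigenbasis the scaled Hermite functions $\Phi_\alpha^\lambda$, $\alpha\in\mathbb N^n$, so that $e^{-tH(\lambda)}\varphi=\sum_\alpha e^{-t(2|\alpha|+n)|\lambda|}(\varphi,\Phi_\alpha^\lambda)\Phi_\alpha^\lambda$, and let $E_t^\lambda=e^{-tH(\lambda)}\bigl(L^2(\mathbb R^n)\bigr)$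 be the image of the Hermite semigroup at time $t$ (its elements are the restrictions to $\mathbb R^n$ of the functions in the Hermite–Bergman space on $\mathbb C^n$). For $\mathcal A\subseteq L^1(\mathbb H^n)$ write $\pi_\lambda(\mathcal A)V=\{\pi_\lambda(f)\varphi: f\in\mathcal A,\ \varphi\in V\}$. Then for every $\lambda\ne0$ $$\pi_\lambda\Bigl(\bigcup_{t>0}\mathcal A_t^\lambda\Bigr)V=\bigcup_{t>0}E_t^\lambda,\qquad \pi_\lambda\Bigl(\bigcap_{t>0}\mathcal A_t^\lambda\Bigr)V=\bigcap_{t>0}E_t^\lambda,$$ and both $\bigcup_{t>0}\mathcal A_t^\lambda$ and $\bigcap_{t>0}\mathcal A_t^\lambda$ are algebras under convolution, that is, complex linear subspaces of $L^1(\mathbb H^n)$ closed under $*$. -/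

import Mathlib

open MeasureTheory Complex

noncomputable section

namespace HeisenbergAnalytic

/-- `ℝⁿ` with its Euclidean inner product and Lebesgue measure. -/
abbrev Rn (n : ℕ) : Type := EuclideanSpace ℝ (Fin n)

/-- The Heisenberg group `ℍⁿ = ℝⁿ × ℝⁿ × ℝ`, with points `(x, u, t)`.  Its Haar measure is
Lebesgue measure `dx du dt`, which is `volume` here. -/
abbrev Heis (n : ℕ) : Type := Rn n × Rn n × ℝ

/-- The group law `(x,u,t)(y,v,s) = (x+y, u+v, t+s+½(u·y - v·x))`.  The inverse of `p` is `-p`. -/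
def heisMul {n : ℕ} (p q : Heis n) : Heis n :=
  (p.1 + q.1, p.2.1 + q.2.1,
    p.2.2 + q.2.2 + (1 / 2) * (inner ℝ p.2.1 q.1 - inner ℝ q.2.1 p.1))

/-- `L¹(ℍⁿ)`. -/
abbrev L1Heis (n : ℕ) : Type := Lp ℂ 1 (volume : Measure (Heis n))

/-- The representation space `V = L²(ℝⁿ)`. -/
abbrev L2Rn (n : ℕ) : Type := Lp ℂ 2 (volume : Measure (Rn n))

/-! ### Convolution on `L¹(ℍⁿ)` -/

theorem measurePreserving_heisMul_neg {n : ℕ} (q : Heis n) :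
    MeasurePreserving (fun p : Heis n => heisMul p (-q)) volume volume := by
  have h2 : ∀ x : Rn n, MeasurePreserving
      (fun w : Rn n × ℝ => (w.1 + -q.2.1,
        w.2 + -q.2.2 + (1 / 2) * (inner ℝ w.1 (-q.1) - inner ℝ (-q.2.1) x)))
      volume volume := by
    intro x
    refine MeasurePreserving.skew_product
      (f := fun u : Rn n => u + -q.2.1)
      (g := fun (u : Rn n) (t : ℝ) =>
        t + -q.2.2 + (1 / 2) * (inner ℝ u (-q.1) - inner ℝ (-q.2.1) x))
      (measurePreserving_add_right volume _) (by fun_prop) ?_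
    refine Filter.Eventually.of_forall fun u => ?_
    have := (measurePreserving_add_right (volume : Measure ℝ)
      (-q.2.2 + (1 / 2) * (inner ℝ u (-q.1) - inner ℝ (-q.2.1) x))).map_eq
    simpa [add_assoc] using this
  refine MeasurePreserving.skew_product
    (f := fun x : Rn n => x + -q.1)
    (g := fun (x : Rn n) (w : Rn n × ℝ) => (w.1 + -q.2.1,
      w.2 + -q.2.2 + (1 / 2) * (inner ℝ w.1 (-q.1) - inner ℝ (-q.2.1) x)))
    (measurePreserving_add_right volume _) (by fun_prop) ?_
  exact Filter.Eventually.of_forall fun x => (h2 x).map_eq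

/-- The convolution integral `∫ f(p q⁻¹) g(q) dq`. -/
def convFun {n : ℕ} (f g : Heis n → ℂ) (p : Heis n) : ℂ :=
  ∫ q : Heis n, f (heisMul p (-q)) * g q

theorem integrable_conv_prod {n : ℕ} {f g : Heis n → ℂ}
    (hf : Integrable f) (hg : Integrable g) :
    Integrable (fun z : Heis n × Heis n => f (heisMul z.1 (-z.2)) * g z.2)
      (volume.prod volume) := by
  have h1 : MeasurePreserving
      (fun z : Heis n × Heis n => (z.1, heisMul z.2 (-z.1)))
      (volume.prod volume) (volume.prod volume) := by
    refine MeasurePreserving.skew_product (f := fun q : Heis n => q)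
      (g := fun q p : Heis n => heisMul p (-q)) (MeasurePreserving.id _) ?_ ?_
    · unfold heisMul Function.uncurry
      simp only [Prod.fst_neg, Prod.snd_neg]
      fun_prop
    · exact Filter.Eventually.of_forall fun q => (measurePreserving_heisMul_neg q).map_eq
  have h2 : MeasurePreserving
      (fun z : Heis n × Heis n => (z.2, heisMul z.1 (-z.2)))
      (volume.prod volume) (volume.prod volume) :=
    h1.comp Measure.measurePreserving_swap
  have h3 := h2.integrable_comp_of_integrable (hg.mul_prod hf)
  refine h3.congr (Filter.Eventually.of_forall fun z => ?_)
  simp [mul_comm]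

theorem integrable_convFun {n : ℕ} {f g : Heis n → ℂ}
    (hf : Integrable f) (hg : Integrable g) : Integrable (convFun f g) :=
  (integrable_conv_prod hf hg).integral_prod_left

/-- Convolution `f ∗ g` as an operation on `L¹(ℍⁿ)`. -/
def conv {n : ℕ} (f g : L1Heis n) : L1Heis n :=
  (integrable_convFun (L1.integrable_coeFn f) (L1.integrable_coeFn g)).toL1 (convFun f g)

/-- `S ⊆ L¹(ℍⁿ)` is an algebra under convolution: a complex linear subspace closed under `∗`. -/
structure IsConvAlgebra {n : ℕ} (S : Set (L1Heis n)) : Prop where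
  zero_mem : 0 ∈ S
  add_mem : ∀ f ∈ S, ∀ g ∈ S, f + g ∈ S
  smul_mem : ∀ (c : ℂ), ∀ f ∈ S, c • f ∈ S
  conv_mem : ∀ f ∈ S, ∀ g ∈ S, conv f g ∈ S

/-! ### The Schrödinger representation -/

/-- `(π_λ(x,u,t)φ)(ξ) = e^{iλt} e^{iλ(x·ξ + ½ x·u)} φ(ξ+u)`. -/
def schrodingerFun {n : ℕ} (lam : ℝ) (p : Heis n) (φ : Rn n → ℂ) (ξ : Rn n) : ℂ :=
  cexp (I * ((lam * p.2.2 : ℝ) : ℂ)) *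
    cexp (I * ((lam * (inner ℝ p.1 ξ + (1 / 2) * inner ℝ p.1 p.2.1) : ℝ) : ℂ)) *
      φ (ξ + p.2.1)

theorem memLp_schrodingerFun {n : ℕ} (lam : ℝ) (p : Heis n) (φ : L2Rn n) :
    MemLp (schrodingerFun lam p φ) 2 (volume : Measure (Rn n)) := by
  have h : MemLp (fun ξ : Rn n => φ (ξ + p.2.1)) 2 (volume : Measure (Rn n)) :=
    (Lp.memLp φ).comp_measurePreserving (measurePreserving_add_right volume p.2.1)
  refine h.of_le ?_ (Filter.Eventually.of_forall fun ξ => ?_)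
  · exact AEStronglyMeasurable.mul (Continuous.aestronglyMeasurable (by fun_prop)) h.1
  · simp only [schrodingerFun, norm_mul]
    rw [mul_comm I, mul_comm I, norm_exp_ofReal_mul_I, norm_exp_ofReal_mul_I]
    simp

/-- The operator `π_λ(x,u,t)` on `L²(ℝⁿ)`. -/
def schrodinger {n : ℕ} (lam : ℝ) (p : Heis n) (φ : L2Rn n) : L2Rn n :=
  (memLp_schrodingerFun lam p φ).toLp (schrodingerFun lam p φ)

/-- The integrated representation `π_λ(f)φ = ∫ f(p) π_λ(p)φ dp`, `f ∈ L¹(ℍⁿ)`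
(a Bochner integral in `L²(ℝⁿ)`). -/
def schrodingerInt {n : ℕ} (lam : ℝ) (f : L1Heis n) (φ : L2Rn n) : L2Rn n :=
  ∫ p : Heis n, f p • schrodinger lam p φ

/-! ### The spaces `𝒜_t^λ` -/

/-- `f^λ(x,u) = ∫ f(x,u,t) e^{iλt} dt`. -/
def partialInvFourier {n : ℕ} (lam : ℝ) (f : Heis n → ℂ) (x u : Rn n) : ℂ :=
  ∫ t : ℝ, f (x, u, t) * cexp (I * ((lam * t : ℝ) : ℂ))

/-- `ℱ₁F(x,u) = (2π)^{-n/2} ∫ F(y,u) e^{-i x·y} dy`. -/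
def fourierFst {n : ℕ} (F : Rn n → Rn n → ℂ) (x u : Rn n) : ℂ :=
  (((2 * Real.pi) ^ (-(n : ℝ) / 2) : ℝ) : ℂ) *
    ∫ y : Rn n, F y u * cexp (-(I * ((inner ℝ x y : ℝ) : ℂ)))

/-- `ℱ₂F(x,u) = (2π)^{-n/2} ∫ F(x,v) e^{-i u·v} dv`. -/
def fourierSnd {n : ℕ} (F : Rn n → Rn n → ℂ) (x u : Rn n) : ℂ :=
  (((2 * Real.pi) ^ (-(n : ℝ) / 2) : ℝ) : ℂ) *
    ∫ v : Rn n, F x v * cexp (-(I * ((inner ℝ u v : ℝ) : ℂ)))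

/-- The space `𝒜_t^λ` of all `f ∈ L¹(ℍⁿ)` with the two Gaussian bounds on `ℱ₁f^λ` and `ℱ₂f^λ`.
As `f` is a class of functions, the bounds are for almost every `(x,u)`. -/
def spaceA (n : ℕ) (lam t : ℝ) : Set (L1Heis n) :=
  {f | ∃ C : ℝ, ∀ᵐ z : Rn n × Rn n,
    ‖fourierFst (partialInvFourier lam f) z.1 z.2‖ ≤
        C * Real.exp (-Real.tanh (t * lam) * (1 / lam * ‖z.1‖ ^ 2 + lam / 4 * ‖z.2‖ ^ 2)) ∧
    ‖fourierSnd (partialInvFourier lam f) z.1 z.2‖ ≤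
        C * Real.exp (-Real.tanh (t * lam) * (lam / 4 * ‖z.1‖ ^ 2 + 1 / lam * ‖z.2‖ ^ 2))}

/-! ### Hermite functions and the Hermite semigroup -/

/-- The `L²`-normalised Hermite function
`h_k(x) = (2^k k! √π)^{-1/2} H_k(x) e^{-x²/2}` on `ℝ`.  `Polynomial.hermite` is the
probabilists' polynomial `He_k`, and `H_k(x) = 2^{k/2} He_k(√2 x)`. -/
def hermiteFun (k : ℕ) (x : ℝ) : ℝ :=
  (Real.sqrt (k.factorial * Real.sqrt Real.pi))⁻¹ *
    Polynomial.aeval (Real.sqrt 2 * x) (Polynomial.hermite k) * Real.exp (-x ^ 2 / 2)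

/-- `Φ_α^λ(x) = |λ|^{n/4} ∏_j h_{α_j}(|λ|^{1/2} x_j)`: an eigenfunction of
`H(λ) = -Δ + λ²|x|²` with eigenvalue `(2|α|+n)|λ|`. -/
def hermiteFunN {n : ℕ} (lam : ℝ) (α : Fin n → ℕ) (x : Rn n) : ℂ :=
  ((|lam| ^ ((n : ℝ) / 4) * ∏ j, hermiteFun (α j) (Real.sqrt |lam| * x j) : ℝ) : ℂ)

theorem continuous_hermiteFun (k : ℕ) : Continuous (hermiteFun k) := by
  unfold hermiteFun
  have : Continuous fun x : ℝ => Polynomial.aeval (Real.sqrt 2 * x) (Polynomial.hermite k) :=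
    (Polynomial.continuous_aeval _).comp (by fun_prop)
  fun_prop

theorem integrable_poly_gaussian (P : Polynomial ℝ) :
    Integrable fun x : ℝ => P.eval x * Real.exp (-x ^ 2) := by
  induction P using Polynomial.induction_on' with
  | add p q hp hq =>
    refine (hp.add hq).congr (Filter.Eventually.of_forall fun x => ?_)
    simp [add_mul]
  | monomial m a =>
    have h := (integrable_rpow_mul_exp_neg_mul_sq (b := 1) one_pos
      (s := (m : ℝ)) (by linarith [Nat.cast_nonneg (α := ℝ) m])).const_mul a
    refine h.congr (Filter.Eventually.of_forall fun x => ?_)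
    simp [mul_assoc]

theorem integrable_hermiteFun_sq (k : ℕ) : Integrable fun x : ℝ => hermiteFun k x ^ 2 := by
  let Q : Polynomial ℝ := ((Polynomial.hermite k).map (Int.castRingHom ℝ)).comp
    (Polynomial.C (Real.sqrt 2) * Polynomial.X)
  have h := (integrable_poly_gaussian (Q ^ 2)).const_mul
    ((Real.sqrt (k.factorial * Real.sqrt Real.pi))⁻¹ ^ 2)
  refine h.congr (Filter.Eventually.of_forall fun x => ?_)
  have hQ : Q.eval x = Polynomial.aeval (Real.sqrt 2 * x) (Polynomial.hermite k) := by
    simp [Q, Polynomial.aeval_def, Polynomial.eval_map]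
  have he : Real.exp (-x ^ 2) = Real.exp (-x ^ 2 / 2) ^ 2 := by
    rw [← Real.exp_nat_mul]; congr 1; push_cast; ring
  simp only [hermiteFun, Polynomial.eval_pow, hQ, he]
  ring

theorem memLp_hermiteFunN {n : ℕ} {lam : ℝ} (hlam : lam ≠ 0) (α : Fin n → ℕ) :
    MemLp (hermiteFunN lam α) 2 (volume : Measure (Rn n)) := by
  have hc : Continuous (hermiteFunN (n := n) lam α) := by
    unfold hermiteFunN
    refine continuous_ofReal.comp (continuous_const.mul ?_)
    exact continuous_finsetProd _ fun j _ => (continuous_hermiteFun _).comp (by fun_prop)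
  rw [memLp_two_iff_integrable_sq_norm hc.aestronglyMeasurable]
  have hs : Real.sqrt |lam| ≠ 0 := (Real.sqrt_pos.2 (abs_pos.2 hlam)).ne'
  have h1 : Integrable (fun x : Fin n → ℝ =>
      ∏ j, hermiteFun (α j) (Real.sqrt |lam| * x j) ^ 2) :=
    Integrable.fintype_prod fun j => (integrable_hermiteFun_sq (α j)).comp_mul_left' hs
  have h2 := ((EuclideanSpace.volume_preserving_symm_measurableEquiv_toLp
    (Fin n)).integrable_comp_of_integrable h1).const_mul
      ((|lam| ^ ((n : ℝ) / 4)) ^ 2)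
  refine h2.congr (Filter.Eventually.of_forall fun x => ?_)
  simp only [hermiteFunN, Complex.norm_real, Real.norm_eq_abs, sq_abs, mul_pow,
    ← Finset.prod_pow]
  rfl

/-- `Φ_α^λ` as an element of `L²(ℝⁿ)`. -/
def hermiteL2 {n : ℕ} {lam : ℝ} (hlam : lam ≠ 0) (α : Fin n → ℕ) : L2Rn n :=
  (memLp_hermiteFunN hlam α).toLp (hermiteFunN lam α)

/-- The Hermite semigroup
`e^{-tH(λ)}φ = ∑_α e^{-t(2|α|+n)|λ|} (φ, Φ_α^λ) Φ_α^λ`, the sum being taken in `L²(ℝⁿ)`. -/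
def hermiteSemigroup {n : ℕ} {lam : ℝ} (hlam : lam ≠ 0) (t : ℝ) (φ : L2Rn n) : L2Rn n :=
  ∑' α : Fin n → ℕ,
    ((Real.exp (-t * ((2 * ∑ j, (α j : ℝ) + n) * |lam|)) : ℂ) *
      inner ℂ (hermiteL2 hlam α) φ) • hermiteL2 hlam α

/-- `E_t^λ = e^{-tH(λ)} L²(ℝⁿ)`. -/
def spaceE (n : ℕ) {lam : ℝ} (hlam : lam ≠ 0) (t : ℝ) : Set (L2Rn n) :=
  Set.range (hermiteSemigroup (n := n) hlam t)

end HeisenbergAnalytic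

end

open MeasureTheory Complex

noncomputable section

namespace HeisenbergAnalytic

/-! ### Entire power series -/

/-! Put τ = tanh(t|λ|) and p = tanh(tλ)/λ = τ/|λ|. Up to constants both bounds defining 𝒜_t have the
form exp(-(p|w|² + pλ²|v|²/4)), where w is the transformed variable and v the untouched one
(`mem_spaceA_iff`). This quadratic form suits the parallelogram identity, which is used in three
ways.

Algebras. The map f ↦ f^λ turns convolution into twisted convolution. A partial Fourier transform
turns that into an integral over one variable of a product of partial transforms, and the two
exponents add up to the original exponent plus a square in the integration variable
(`twisted_exponent`). So each 𝒜_t is already an algebra; the family is monotone in t, and the union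
and the intersection inherit this.

From 𝒜 to E. The kernel of π_λ(f) and that of its Fourier conjugate are partial transforms of f^λ.
By the parallelogram identity g = π_λ(f)φ decays like exp(-τ|λ||x|²/2) and its Fourier transform
like exp(-τ|q|²/(2|λ|)). Integrating g against the generating function of the Hermite functions in
one variable gives an entire function of z = x + iy bounded by exp((κx²+y²)/2) and, through the
Fourier side, by exp((x²+κy²)/2), with κ = (1-τ)/(1+τ) = e^{-2t|λ|}. The mean of the exponents gives
exp(δ|z|²/2) with δ = (1+κ)/2 < 1, and Cauchy's estimate then gives geometric decay of the Hermite
coefficients: g lies in some E_s. If f lies in every 𝒜_t, then κ is at will and Phragmén–Lindelöf in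
a sector makes δ arbitrarily small: g lies in every E_s. The carrying lemmas are
`norm_hermite_coeff_le`, `gaussianInterpolation_sector` and `norm_inner_schrodingerInt_le`.

From E to 𝒜. The Hermite expansion of g ∈ E_t gives a continuous representative G with Gaussian
decay in space and frequency (`exists_continuous_of_mem_spaceE`). Choose f so that f^λ is a multiple
of the Fourier–Wigner transform of G and the ground state Φ₀. Then π_λ(f) is of rank one and sends
Φ₀ to g, and its partial transforms are products to which the parallelogram identity applies. Since
Φ₀ decays at every admissible rate, this one f lies in every 𝒜_s when g lies in every E_t
(`exists_schrodingerInt_eq`). -/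

theorem hasFPowerSeriesOnBall_of_hasSum {b : ℕ → ℂ} {f : ℂ → ℂ}
    (h : ∀ z, HasSum (fun k => b k * z ^ k) (f z)) :
    HasFPowerSeriesOnBall f (FormalMultilinearSeries.ofScalars ℂ b) 0 ⊤ := by
  refine ⟨?_, by simp, fun {y} _ => ?_⟩
  · rw [FormalMultilinearSeries.radius_eq_top_of_summable_norm]
    intro r
    have h1 := (h (r : ℝ)).summable.norm
    refine h1.of_nonneg_of_le (fun k => by positivity) fun k => ?_
    rw [norm_mul, norm_pow, FormalMultilinearSeries.ofScalars_norm]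
    simp
  · have h1 := h y
    rw [zero_add]
    refine h1.congr_fun fun k => ?_
    simp [mul_comm]

theorem differentiable_of_hasSum {b : ℕ → ℂ} {f : ℂ → ℂ}
    (h : ∀ z, HasSum (fun k => b k * z ^ k) (f z)) : Differentiable ℂ f := by
  have h1 := (hasFPowerSeriesOnBall_of_hasSum h).differentiableOn
  rw [← differentiableOn_univ]
  refine h1.mono fun z _ => by simp

theorem coeff_eq_of_hasSum {a b : ℕ → ℂ} {f : ℂ → ℂ}
    (ha : ∀ z, HasSum (fun k => a k * z ^ k) (f z))
    (hb : ∀ z, HasSum (fun k => b k * z ^ k) (f z)) (k : ℕ) : a k = b k := by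
  have h := (hasFPowerSeriesOnBall_of_hasSum ha).hasFPowerSeriesAt.eq_formalMultilinearSeries
    (hasFPowerSeriesOnBall_of_hasSum hb).hasFPowerSeriesAt
  have h2 := congrArg (fun p => FormalMultilinearSeries.coeff p k) h
  simpa [FormalMultilinearSeries.coeff_ofScalars] using h2

theorem coeff_eq_iteratedDeriv_of_hasSum {b : ℕ → ℂ} {f : ℂ → ℂ}
    (h : ∀ z, HasSum (fun k => b k * z ^ k) (f z)) (k : ℕ) :
    b k = (k.factorial : ℂ)⁻¹ * iteratedDeriv k f 0 := by
  refine coeff_eq_of_hasSum (b := fun k => (k.factorial : ℂ)⁻¹ * iteratedDeriv k f 0)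
    h (fun z => ?_) k
  have h1 := hasSum_taylorSeries_of_entire (differentiable_of_hasSum h) 0 z
  refine h1.congr_fun fun k => ?_
  simp; ring

/-- The induction step is (1 + 1/(m+1))^(m+2) ≥ e, which follows from log x ≥ 1 - 1/x. The factor k
+ 1 is crude, but polynomial factors cost nothing against the geometric decay used later. -/
theorem factorial_le_stirling (k : ℕ) :
    (k.factorial : ℝ) ≤ Real.exp 1 * (k + 1) * (k : ℝ) ^ k * Real.exp (-k) := by
  have key : ∀ k : ℕ, ((k + 1).factorial : ℝ) ≤
      Real.exp 1 * (k + 1) * ((k + 1 : ℕ) : ℝ) ^ (k + 1) * Real.exp (-((k + 1 : ℕ) : ℝ)) := by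
    intro k
    induction k with
    | zero => simp [← Real.exp_add]
    | succ m ih =>
      have hm : (0 : ℝ) < m + 1 := by positivity
      have h1 : Real.exp 1 * (m + 1 : ℝ) ^ (m + 2) ≤ (m + 2 : ℝ) ^ (m + 2) := by
        have h2 := Real.one_sub_inv_le_log_of_pos (show (0 : ℝ) < (m + 2) / (m + 1) by positivity)
        have h3 : (1 : ℝ) ≤ (m + 2 : ℕ) * Real.log ((m + 2) / (m + 1)) := by
          refine le_trans ?_ (mul_le_mul_of_nonneg_left h2 (by positivity))
          rw [inv_div]; push_cast; field_simp; linarith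
        have h4 := Real.exp_le_exp.2 h3
        rw [Real.exp_nat_mul, Real.exp_log (by positivity), div_pow] at h4
        rwa [le_div_iff₀ (by positivity)] at h4
      rw [Nat.factorial_succ]
      push_cast at ih ⊢
      have h5 : Real.exp (-((m : ℝ) + 1)) = Real.exp (-((m : ℝ) + 1 + 1)) * Real.exp 1 := by
        rw [← Real.exp_add]; congr 1; ring
      calc ((m : ℝ) + 1 + 1) * ((m + 1).factorial : ℝ)
          ≤ ((m : ℝ) + 1 + 1) * (Real.exp 1 * (m + 1) * (m + 1) ^ (m + 1) *
            Real.exp (-((m : ℝ) + 1))) := by gcongr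
        _ = Real.exp 1 * (m + 1 + 1) * (Real.exp 1 * (m + 1 : ℝ) ^ (m + 2)) *
            Real.exp (-((m : ℝ) + 1 + 1)) := by rw [h5]; ring
        _ ≤ Real.exp 1 * (m + 1 + 1) * ((m + 2 : ℝ) ^ (m + 2)) *
            Real.exp (-((m : ℝ) + 1 + 1)) := by gcongr
        _ = _ := by ring_nf
  cases k with
  | zero => simp
  | succ k =>
    refine (key k).trans ?_
    gcongr
    linarith

/-- Cauchy's estimate for entire functions of order two. -/
theorem norm_coeff_mul_sqrt_factorial_le {b : ℕ → ℂ} {f : ℂ → ℂ}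
    (h : ∀ z, HasSum (fun k => b k * z ^ k) (f z)) {C δ : ℝ} (hδ : 0 < δ)
    (hf : ∀ z, ‖f z‖ ≤ C * Real.exp (δ * ‖z‖ ^ 2 / 2)) (k : ℕ) :
    ‖b k‖ * Real.sqrt k.factorial ≤ 2 * C * (k + 1) * Real.sqrt δ ^ k := by
  have hC : 0 ≤ C := by simpa using (norm_nonneg _).trans (hf 0)
  rcases Nat.eq_zero_or_pos k with rfl | hk
  · have h0 := hf 0
    have : f 0 = b 0 := (h 0).unique (by
      simpa using hasSum_single (f := fun k => b k * (0 : ℂ) ^ k) 0 (by intro j hj; simp [hj]))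
    rw [this] at h0
    simp at h0 ⊢
    linarith
  have hk' : (0 : ℝ) < k := by exact_mod_cast hk
  -- This radius minimises exp(δR²/2)/R^k. It vanishes for k = 0, hence the separate case.
  set R := Real.sqrt (k / δ) with hR
  have hRpos : 0 < R := Real.sqrt_pos.2 (by positivity)
  have hR2 : R ^ 2 = k / δ := Real.sq_sqrt (by positivity)
  have h1 := norm_iteratedDeriv_le_of_forall_mem_sphere_norm_le (C := C * Real.exp (k / 2)) k hRpos
    (differentiable_of_hasSum h).diffContOnCl (c := 0) (fun z hz => by
      refine (hf z).trans (le_of_eq ?_)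
      have : ‖z‖ = R := by simpa using hz
      rw [this, hR2]; field_simp)
  rw [coeff_eq_iteratedDeriv_of_hasSum h k, norm_mul, norm_inv]
  have hfac : (0 : ℝ) < k.factorial := by positivity
  have h2 : ‖(k.factorial : ℂ)‖⁻¹ * ‖iteratedDeriv k f 0‖ ≤ C * Real.exp (k / 2) / R ^ k := by
    rw [norm_natCast, inv_mul_le_iff₀ hfac]
    exact h1.trans (le_of_eq (by ring))
  -- Square root of the Stirling bound; its factor e^{-k/2} cancels the e^{k/2} of Cauchy's
  -- estimate.
  have h3 : Real.sqrt k.factorial ≤ 2 * (k + 1) * (Real.sqrt k ^ k * Real.exp (-(k / 2))) := by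
    rw [Real.sqrt_le_iff]
    refine ⟨by positivity, (factorial_le_stirling k).trans ?_⟩
    have e1 : (2 * (k + 1) * (Real.sqrt k ^ k * Real.exp (-(k / 2)))) ^ 2 =
        4 * (k + 1) ^ 2 * (k : ℝ) ^ k * Real.exp (-k) := by
      have : Real.exp (-(k : ℝ)) = Real.exp (-(k / 2)) ^ 2 := by
        rw [← Real.exp_nat_mul]; congr 1; push_cast; ring
      rw [this, mul_pow, mul_pow, mul_pow, ← pow_mul, mul_comm k 2, pow_mul,
        Real.sq_sqrt hk'.le]
      ring
    rw [e1]
    have : Real.exp 1 * ((k : ℝ) + 1) ≤ 4 * (k + 1) ^ 2 := by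
      nlinarith [Real.exp_one_lt_d9]
    gcongr
  calc _ ≤ C * Real.exp (k / 2) / R ^ k *
        (2 * (k + 1) * (Real.sqrt k ^ k * Real.exp (-(k / 2)))) := by gcongr
    _ = 2 * C * (k + 1) * (Real.sqrt k / R) ^ k * (Real.exp (k / 2) * Real.exp (-(k / 2))) := by
        rw [div_pow]; ring
    _ = _ := by
        rw [← Real.exp_add, add_neg_cancel, Real.exp_zero, mul_one, hR, ← Real.sqrt_div hk'.le]
        congr 3
        field_simp

/-! ### The generating function of the Hermite functions -/

/-- Differentiating the product once more is the recursion He_{k+1} = X·He_k - He_k'. At z = 0 this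
yields the Taylor coefficients of the generating function. -/
theorem iteratedDeriv_cexp_hermite (x : ℂ) (k : ℕ) :
    iteratedDeriv k (fun z : ℂ => cexp (x * z - z ^ 2 / 2)) = fun z =>
      Polynomial.aeval (x - z) (Polynomial.hermite k) * cexp (x * z - z ^ 2 / 2) := by
  induction k with
  | zero => simp
  | succ k ih =>
    rw [iteratedDeriv_succ, ih]
    funext z
    have h1 : HasDerivAt (fun z : ℂ => cexp (x * z - z ^ 2 / 2))
        (cexp (x * z - z ^ 2 / 2) * (x - z)) z := by
      have : HasDerivAt (fun z : ℂ => x * z - z ^ 2 / 2) (x - z) z := by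
        have := ((hasDerivAt_id z).const_mul x).sub (((hasDerivAt_id z).pow 2).div_const 2)
        refine this.congr_deriv ?_
        simp
      exact this.cexp
    have h2 : HasDerivAt (fun z : ℂ => Polynomial.aeval (x - z) (Polynomial.hermite k))
        (-(Polynomial.aeval (x - z) (Polynomial.derivative (Polynomial.hermite k)))) z := by
      have h3 := (Polynomial.hermite k).hasDerivAt_aeval (x - z)
      have h4 : HasDerivAt (fun z : ℂ => x - z) (-1) z := (hasDerivAt_id z).const_sub x
      exact (h3.comp z h4).congr_deriv (by simp)
    refine (h2.mul h1).deriv.trans ?_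
    rw [Polynomial.hermite_succ]
    simp
    ring

theorem hasSum_hermite (x z : ℂ) :
    HasSum (fun k => (k.factorial : ℂ)⁻¹ * Polynomial.aeval x (Polynomial.hermite k) * z ^ k)
      (cexp (x * z - z ^ 2 / 2)) := by
  have h := hasSum_taylorSeries_of_entire
    (f := fun z : ℂ => cexp (x * z - z ^ 2 / 2)) (by fun_prop) 0 z
  refine h.congr_fun fun k => ?_
  rw [iteratedDeriv_cexp_hermite]
  simp
  ring

/-- The generating function `∑ zᵏ h_k(x) / √k!` of the Hermite functions. -/
def hermiteGen (z : ℂ) (x : ℝ) : ℂ :=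
  ((Real.sqrt (Real.sqrt Real.pi))⁻¹ : ℝ) *
    cexp (-(x : ℂ) ^ 2 / 2 + Real.sqrt 2 * x * z - z ^ 2 / 2)

theorem continuous_hermiteGen (z : ℂ) : Continuous (hermiteGen z) := by
  unfold hermiteGen; fun_prop

theorem hasSum_hermiteFun (x : ℝ) (z : ℂ) :
    HasSum (fun k => ((Real.sqrt k.factorial)⁻¹ * hermiteFun k x : ℝ) * z ^ k)
      (hermiteGen z x) := by
  have h := (hasSum_hermite ((Real.sqrt 2 * x : ℝ) : ℂ) z).mul_left
    ((((Real.sqrt (Real.sqrt Real.pi))⁻¹ * Real.exp (-x ^ 2 / 2) : ℝ)) : ℂ)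
  have e : hermiteGen z x = ((((Real.sqrt (Real.sqrt Real.pi))⁻¹ * Real.exp (-x ^ 2 / 2) : ℝ)) : ℂ)
      * cexp (((Real.sqrt 2 * x : ℝ) : ℂ) * z - z ^ 2 / 2) := by
    rw [hermiteGen, ofReal_mul, ofReal_exp, mul_assoc _ (cexp _), ← Complex.exp_add]
    congr 2
    push_cast
    ring
  rw [e]
  refine h.congr_fun fun k => ?_
  have e2 : (Polynomial.aeval ((Real.sqrt 2 * x : ℝ) : ℂ) (Polynomial.hermite k)) =
      ((Polynomial.aeval (Real.sqrt 2 * x) (Polynomial.hermite k) : ℝ) : ℂ) := by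
    have := Polynomial.aeval_algebraMap_apply ℂ (Real.sqrt 2 * x) (Polynomial.hermite k)
    simpa using this
  rw [e2, hermiteFun, Real.sqrt_mul (by positivity)]
  have e3 : (k.factorial : ℂ) = (Real.sqrt k.factorial : ℂ) * (Real.sqrt k.factorial : ℂ) := by
    rw [← ofReal_mul, Real.mul_self_sqrt (by positivity)]; simp
  rw [e3]
  push_cast
  have : (Real.sqrt k.factorial : ℂ) ≠ 0 := by
    exact_mod_cast (Real.sqrt_pos.2 (by positivity)).ne'
  field_simp

theorem norm_hermiteGen (z : ℂ) (x : ℝ) : ‖hermiteGen z x‖ =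
    (Real.sqrt (Real.sqrt Real.pi))⁻¹ *
      Real.exp (-x ^ 2 / 2 + Real.sqrt 2 * x * z.re - (z.re ^ 2 - z.im ^ 2) / 2) := by
  rw [hermiteGen, norm_mul, norm_exp, norm_real, Real.norm_of_nonneg (by positivity)]
  congr 2
  simp [pow_two]

theorem inv_sqrt_sqrt_pi_le_one : (Real.sqrt (Real.sqrt Real.pi))⁻¹ ≤ 1 := by
  refine inv_le_one_of_one_le₀ ?_
  rw [Real.one_le_sqrt, Real.one_le_sqrt]
  linarith [Real.pi_gt_three]

/-- Completing the square gives √2·x·Re z ≤ x²/(2(1+ε)) + (1+ε)(Re z)². Part of the Gaussian in x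
survives, and the growth in z rises from rate 1 to 1 + 2ε. -/
theorem norm_hermiteGen_le {ε : ℝ} (hε : 0 < ε) (z : ℂ) (x : ℝ) : ‖hermiteGen z x‖ ≤
    Real.exp (-(ε / (2 * (1 + ε))) * x ^ 2) * Real.exp ((1 + 2 * ε) * ‖z‖ ^ 2 / 2) := by
  rw [norm_hermiteGen, ← Real.exp_add]
  refine (mul_le_of_le_one_left (by positivity) inv_sqrt_sqrt_pi_le_one).trans ?_
  refine Real.exp_le_exp.2 ?_
  have h1 : ‖z‖ ^ 2 = z.re ^ 2 + z.im ^ 2 := by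
    rw [← Complex.normSq_eq_norm_sq, Complex.normSq_apply]; ring
  rw [h1]
  have h2 : Real.sqrt 2 ^ 2 = 2 := Real.sq_sqrt (by norm_num)
  have h3 : ε / (2 * (1 + ε)) = 1 / 2 - 1 / (2 * (1 + ε)) := by field_simp; ring
  have h4 : 0 ≤ 1 / (2 * (1 + ε)) * (x - Real.sqrt 2 * (1 + ε) * z.re) ^ 2 := by positivity
  have h5 : 1 / (2 * (1 + ε)) * (x - Real.sqrt 2 * (1 + ε) * z.re) ^ 2 =
      1 / (2 * (1 + ε)) * x ^ 2 - Real.sqrt 2 * x * z.re + (1 + ε) * z.re ^ 2 := by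
    have : (x - Real.sqrt 2 * (1 + ε) * z.re) ^ 2 = x ^ 2 - 2 * (1 + ε) * (Real.sqrt 2 * x * z.re)
      + Real.sqrt 2 ^ 2 * (1 + ε) ^ 2 * z.re ^ 2 := by ring
    rw [this, h2]
    field_simp
  rw [h3]
  nlinarith [sq_nonneg z.im, mul_nonneg hε.le (sq_nonneg z.im)]

/-- Cauchy's estimate for the generating function with δ = 1 + 2ε, and √(1+2ε) ≤ e^ε. It is the
exchange rate between the two sides of the theorem: Gaussian decay at rate ε/(2(1+ε)) costs a factor
e^{εk}, which the coefficients of an element of E_t can pay for small ε. -/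
theorem abs_hermiteFun_le {ε : ℝ} (hε : 0 < ε) (k : ℕ) (x : ℝ) : |hermiteFun k x| ≤
    2 * (k + 1) * Real.exp (ε * k) * Real.exp (-(ε / (2 * (1 + ε))) * x ^ 2) := by
  have h := norm_coeff_mul_sqrt_factorial_le (hasSum_hermiteFun x) (δ := 1 + 2 * ε)
    (by positivity) (norm_hermiteGen_le hε · x) k
  have hpos : 0 < Real.sqrt k.factorial := Real.sqrt_pos.2 (by positivity)
  have h1 : ‖(((Real.sqrt k.factorial)⁻¹ * hermiteFun k x : ℝ) : ℂ)‖ * Real.sqrt k.factorial =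
      |hermiteFun k x| := by
    rw [norm_real, norm_mul, Real.norm_eq_abs, Real.norm_eq_abs, abs_inv, abs_of_pos hpos]
    field_simp
  rw [h1] at h
  refine h.trans ?_
  have h2 : Real.sqrt (1 + 2 * ε) ≤ Real.exp ε := by
    rw [Real.sqrt_le_iff]
    refine ⟨by positivity, ?_⟩
    rw [← Real.exp_nat_mul]
    have := Real.add_one_le_exp (2 * ε)
    push_cast; linarith
  have h3 : Real.sqrt (1 + 2 * ε) ^ k ≤ Real.exp (ε * k) := by
    rw [mul_comm ε, Real.exp_nat_mul]; gcongr
  calc _ ≤ 2 * Real.exp (-(ε / (2 * (1 + ε))) * x ^ 2) * (k + 1) * Real.exp (ε * k) := by gcongr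
    _ = _ := by ring

theorem abs_hermiteFun_le_quarter (k : ℕ) (x : ℝ) : |hermiteFun k x| ≤
    2 * (k + 1) * Real.exp k * Real.exp (-(1 / 4) * x ^ 2) := by
  have := abs_hermiteFun_le one_pos k x
  norm_num at this ⊢
  exact this

/-- The ratio of consecutive terms is O(1/√(k+1)). This majorant, taken at ε = 1, justifies
integrating the generating series term by term. -/
theorem summable_hermite_majorant (r : ℝ) : Summable fun k : ℕ =>
    (Real.sqrt k.factorial)⁻¹ * (2 * (k + 1) * Real.exp k) * r ^ k := by
  rcases eq_or_ne r 0 with rfl | hr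
  · refine summable_of_ne_finset_zero (s := {0}) fun k hk => ?_
    simp at hk
    simp [hk]
  refine summable_of_ratio_test_tendsto_lt_one (l := 0) one_pos ?_ ?_
  · refine Filter.Eventually.of_forall fun k => ?_
    have : Real.sqrt k.factorial ≠ 0 := (Real.sqrt_pos.2 (by positivity)).ne'
    positivity
  · have h1 : Filter.Tendsto (fun k : ℕ => (2 * Real.exp 1 * |r|) *
        (Real.sqrt ((k : ℝ) + 1))⁻¹) Filter.atTop (nhds ((2 * Real.exp 1 * |r|) * 0)) := by
      refine Filter.Tendsto.const_mul _ (Filter.Tendsto.inv_tendsto_atTop ?_)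
      exact Real.tendsto_sqrt_atTop.comp
        (Filter.tendsto_atTop_add_const_right _ _ tendsto_natCast_atTop_atTop)
    rw [mul_zero] at h1
    refine squeeze_zero (fun k => by positivity) (fun k => ?_) h1
    have hf : 0 < Real.sqrt k.factorial := Real.sqrt_pos.2 (by positivity)
    have hk1 : 0 < Real.sqrt ((k : ℝ) + 1) := Real.sqrt_pos.2 (by positivity)
    have e1 : Real.sqrt ((k + 1).factorial) = Real.sqrt ((k : ℝ) + 1) * Real.sqrt k.factorial := by
      rw [Nat.factorial_succ]; push_cast; rw [Real.sqrt_mul (by positivity)]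
    simp only [norm_mul, norm_inv, norm_pow, Real.norm_eq_abs]
    rw [e1, div_le_iff₀ (by positivity)]
    push_cast
    simp only [abs_mul, abs_of_pos hf, abs_of_pos hk1, Real.abs_exp, mul_inv, Real.exp_add, pow_succ]
    rw [abs_of_pos (show (0 : ℝ) < k + 1 + 1 by positivity),
      abs_of_pos (show (0 : ℝ) < k + 1 by positivity), abs_of_pos (show (0 : ℝ) < 2 by norm_num)]
    have : (k : ℝ) + 1 + 1 ≤ 2 * (k + 1) := by linarith [Nat.cast_nonneg (α := ℝ) k]
    calc _ ≤ (Real.sqrt ((k : ℝ) + 1))⁻¹ * (Real.sqrt k.factorial)⁻¹ *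
          (2 * (2 * (k + 1)) * (Real.exp k * Real.exp 1)) * (|r| ^ k * |r|) := by gcongr
      _ = _ := by ring

/-- Expansion of `∫ w · G_z ∘ y` in Hermite functions. -/
theorem hasSum_integral_hermiteFun {X : Type*} [MeasurableSpace X] {μ : Measure X} {w : X → ℂ}
    {y : X → ℝ} (hw : AEStronglyMeasurable w μ) (hy : Measurable y)
    (hwy : Integrable (fun x => w x * Real.exp (-(1 / 4) * y x ^ 2)) μ) (z : ℂ) :
    HasSum (fun k => ((Real.sqrt k.factorial)⁻¹ * ∫ x, w x * hermiteFun k (y x) ∂μ) * z ^ k)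
      (∫ x, w x * hermiteGen z (y x) ∂μ) := by
  have hm : ∀ k, AEStronglyMeasurable (fun x => w x * (hermiteFun k (y x) : ℂ)) μ := fun k =>
    hw.mul (((continuous_ofReal.comp (continuous_hermiteFun k)).measurable.comp hy).aestronglyMeasurable)
  have hb : ∀ k x, ‖((Real.sqrt k.factorial)⁻¹ : ℂ) * z ^ k * (w x * (hermiteFun k (y x) : ℂ))‖ ≤
      (Real.sqrt k.factorial)⁻¹ * (2 * (k + 1) * Real.exp k) * ‖z‖ ^ k *
        ‖w x * Real.exp (-(1 / 4) * y x ^ 2)‖ := by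
    intro k x
    have hf : 0 < Real.sqrt k.factorial := Real.sqrt_pos.2 (by positivity)
    simp only [norm_mul, norm_inv, norm_pow, norm_real, Real.norm_eq_abs, abs_of_pos hf,
      Real.abs_exp]
    have := abs_hermiteFun_le_quarter k (y x)
    calc _ ≤ (Real.sqrt k.factorial)⁻¹ * ‖z‖ ^ k * (‖w x‖ *
          (2 * (k + 1) * Real.exp k * Real.exp (-(1 / 4) * y x ^ 2))) := by gcongr
      _ = _ := by ring
  have hint : ∀ k, Integrable (fun x => ((Real.sqrt k.factorial)⁻¹ : ℂ) * z ^ k *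
      (w x * (hermiteFun k (y x) : ℂ))) μ := fun k =>
    (hwy.norm.const_mul _).mono' ((hm k).const_mul _) (Filter.Eventually.of_forall (hb k))
  have h := hasSum_integral_of_summable_integral_norm hint (by
    refine ((summable_hermite_majorant ‖z‖).mul_right
      (∫ x, ‖w x * Real.exp (-(1 / 4) * y x ^ 2)‖ ∂μ)).of_nonneg_of_le
      (fun k => integral_nonneg fun x => norm_nonneg _) fun k => ?_
    rw [← integral_const_mul]
    exact integral_mono (hint k).norm (hwy.norm.const_mul _) (hb k))
  have e : ∀ x, ∑' k, ((Real.sqrt k.factorial)⁻¹ : ℂ) * z ^ k * (w x * (hermiteFun k (y x) : ℂ)) =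
      w x * hermiteGen z (y x) := by
    intro x
    refine HasSum.tsum_eq (((hasSum_hermiteFun (y x) z).mul_left (w x)).congr_fun fun k => ?_)
    push_cast
    ring
  simp_rw [e, integral_const_mul] at h
  refine h.congr_fun fun k => ?_
  push_cast
  ring

/-! ### One-dimensional Gaussian integrals and Hermite functions -/

/-- On generating functions the Fourier transform is the rotation z ↦ -iz. Comparing coefficients
gives the eigenvalues (-i)^k; later the same rotation converts frequency decay into a bound with
real and imaginary parts exchanged. -/
theorem integral_hermiteGen_mul_cexp (z : ℂ) (p : ℝ) :
    ∫ x : ℝ, cexp (-(I * ((p * x : ℝ) : ℂ))) * hermiteGen z x =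
      (Real.sqrt (2 * Real.pi) : ℂ) * hermiteGen (-I * z) p := by
  have h := integral_cexp_quadratic (b := -1 / 2) (by norm_num) (Real.sqrt 2 * z - I * p)
    (-z ^ 2 / 2)
  have e1 : ∀ x : ℝ, cexp (-(I * ((p * x : ℝ) : ℂ))) * hermiteGen z x =
      ((Real.sqrt (Real.sqrt Real.pi))⁻¹ : ℝ) *
        cexp (-1 / 2 * (x : ℂ) ^ 2 + (Real.sqrt 2 * z - I * p) * x + -z ^ 2 / 2) := by
    intro x
    rw [hermiteGen, mul_left_comm, ← Complex.exp_add]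
    congr 2
    push_cast; ring
  simp_rw [e1]
  rw [integral_const_mul, h, hermiteGen, mul_left_comm]
  have h2 : ((Real.sqrt 2 : ℝ) : ℂ) ^ 2 = 2 := by
    rw [← ofReal_pow, Real.sq_sqrt (by norm_num)]; norm_num
  congr 1
  · rw [Real.sqrt_eq_rpow, ofReal_cpow (by positivity)]
    push_cast
    congr 1
    field_simp
  · congr 1
    have : (Real.sqrt 2 * z - I * p) ^ 2 = (Real.sqrt 2 : ℂ) ^ 2 * z ^ 2 -
      2 * Real.sqrt 2 * z * I * p + I ^ 2 * p ^ 2 := by ring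
    rw [this, mul_pow, neg_sq, I_sq, h2]
    congr 1
    ring

/-- A Gaussian integral that encodes orthonormality: the coefficients of e^{wz} in z and w are
diagonal. -/
theorem integral_hermiteGen_mul_hermiteGen (z w : ℂ) :
    ∫ x : ℝ, hermiteGen w x * hermiteGen z x = cexp (w * z) := by
  have h := integral_cexp_quadratic (b := -1) (by norm_num) (Real.sqrt 2 * (z + w))
    (-(z ^ 2 + w ^ 2) / 2)
  have e1 : ∀ x : ℝ, hermiteGen w x * hermiteGen z x =
      (((Real.sqrt (Real.sqrt Real.pi))⁻¹ : ℝ) * ((Real.sqrt (Real.sqrt Real.pi))⁻¹ : ℝ) : ℂ) *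
        cexp (-1 * (x : ℂ) ^ 2 + (Real.sqrt 2 * (z + w)) * x + -(z ^ 2 + w ^ 2) / 2) := by
    intro x
    rw [hermiteGen, hermiteGen, mul_mul_mul_comm, ← Complex.exp_add]
    congr 2
    ring
  simp_rw [e1]
  rw [integral_const_mul, h, ← mul_assoc]
  have h2 : ((Real.sqrt 2 : ℝ) : ℂ) ^ 2 = 2 := by
    rw [← ofReal_pow, Real.sq_sqrt (by norm_num)]; norm_num
  have h3 : ((Real.pi : ℂ) / -(-1)) ^ (1 / 2 : ℂ) = (Real.sqrt Real.pi : ℝ) := by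
    rw [Real.sqrt_eq_rpow, ofReal_cpow (by positivity)]
    norm_num
  have h4 : (((Real.sqrt (Real.sqrt Real.pi))⁻¹ : ℝ) * ((Real.sqrt (Real.sqrt Real.pi))⁻¹ : ℝ) : ℂ)
      * (Real.sqrt Real.pi : ℝ) = 1 := by
    rw [← ofReal_mul, ← ofReal_mul, ← mul_inv, Real.mul_self_sqrt (by positivity),
      inv_mul_cancel₀ (by positivity)]
    simp
  rw [h3, h4, one_mul, mul_pow, h2]
  congr 1
  ring

theorem integrable_of_bound_gaussian {w : ℝ → ℂ} (hw : Continuous w) {C : ℝ}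
    (hC : ∀ x, ‖w x‖ ≤ C) :
    Integrable fun x : ℝ => w x * Real.exp (-(1 / 4) * x ^ 2) := by
  refine ((integrable_exp_neg_mul_sq (b := 1 / 4) (by norm_num)).const_mul C).mono'
    (by fun_prop) (Filter.Eventually.of_forall fun x => ?_)
  rw [norm_mul, norm_real, Real.norm_of_nonneg (by positivity)]
  gcongr
  exact hC x

theorem sqrt_factorial_ofReal_ne_zero (k : ℕ) : (((Real.sqrt k.factorial)⁻¹ : ℝ) : ℂ) ≠ 0 := by
  exact_mod_cast (inv_pos.2 (Real.sqrt_pos.2 (show (0 : ℝ) < k.factorial by positivity))).ne'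

/-- The Hermite functions are eigenfunctions of the Fourier transform. -/
theorem integral_hermiteFun_mul_cexp (k : ℕ) (p : ℝ) :
    ∫ x : ℝ, cexp (-(I * ((p * x : ℝ) : ℂ))) * hermiteFun k x =
      (Real.sqrt (2 * Real.pi) : ℂ) * (-I) ^ k * hermiteFun k p := by
  have h1 : ∀ z, HasSum _ _ := hasSum_integral_hermiteFun (μ := volume)
    (w := fun x : ℝ => cexp (-(I * ((p * x : ℝ) : ℂ)))) (y := fun x => x)
    (Continuous.aestronglyMeasurable (by fun_prop)) measurable_id
    (integrable_of_bound_gaussian (C := 1) (by fun_prop) fun x => by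
      rw [← mul_neg, ← ofReal_neg, mul_comm, norm_exp_ofReal_mul_I])
  simp_rw [integral_hermiteGen_mul_cexp] at h1
  have h2 : ∀ z : ℂ, HasSum (fun k => ((Real.sqrt (2 * Real.pi) : ℂ) *
      (((Real.sqrt k.factorial)⁻¹ * hermiteFun k p : ℝ) * (-I) ^ k)) * z ^ k)
      ((Real.sqrt (2 * Real.pi) : ℂ) * hermiteGen (-I * z) p) := by
    intro z
    refine ((hasSum_hermiteFun p (-I * z)).mul_left _).congr_fun fun k => ?_
    rw [mul_pow]; ring
  have h3 := coeff_eq_of_hasSum h1 h2 k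
  refine mul_left_cancel₀ (sqrt_factorial_ofReal_ne_zero k) (h3.trans ?_)
  push_cast; ring

/-- Comparison of the coefficients of z^k in ∫ G_w G_z = e^{wz}. -/
theorem integral_hermiteFun_mul_hermiteGen (k : ℕ) (w : ℂ) :
    ∫ x : ℝ, hermiteGen w x * hermiteFun k x = ((Real.sqrt k.factorial)⁻¹ : ℝ) * w ^ k := by
  have h1 : ∀ z, HasSum _ _ := hasSum_integral_hermiteFun (μ := volume)
    (w := hermiteGen w) (y := fun x => x)
    (continuous_hermiteGen w).aestronglyMeasurable measurable_id
    (integrable_of_bound_gaussian (C := Real.exp ((1 + 2 * 1) * ‖w‖ ^ 2 / 2))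
      (continuous_hermiteGen w) fun x => by
      refine (norm_hermiteGen_le one_pos w x).trans (mul_le_of_le_one_left (by positivity) ?_)
      rw [Real.exp_le_one_iff]
      have := sq_nonneg x
      norm_num
      positivity)
  simp_rw [integral_hermiteGen_mul_hermiteGen] at h1
  have h2 : ∀ z : ℂ, HasSum (fun k => (((Real.sqrt k.factorial)⁻¹ : ℝ) *
      (((Real.sqrt k.factorial)⁻¹ : ℝ) * w ^ k)) * z ^ k) (cexp (w * z)) := by
    intro z
    have := NormedSpace.expSeries_div_hasSum_exp (𝔸 := ℂ) (w * z)
    rw [← Complex.exp_eq_exp_ℂ] at this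
    refine this.congr_fun fun k => ?_
    have e3 : (k.factorial : ℂ) = (Real.sqrt k.factorial : ℂ) * (Real.sqrt k.factorial : ℂ) := by
      rw [← ofReal_mul, Real.mul_self_sqrt (by positivity)]; simp
    rw [e3, mul_pow]
    push_cast
    ring
  exact mul_left_cancel₀ (sqrt_factorial_ofReal_ne_zero k) (coeff_eq_of_hasSum h1 h2 k)

/-- Second comparison of coefficients, now in the remaining parameter. -/
theorem integral_hermiteFun_mul_hermiteFun (j k : ℕ) :
    ∫ x : ℝ, (hermiteFun j x : ℂ) * hermiteFun k x = if j = k then 1 else 0 := by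
  have h1 : ∀ z, HasSum _ _ := hasSum_integral_hermiteFun (μ := volume)
    (w := fun x => (hermiteFun j x : ℂ)) (y := fun x => x)
    (continuous_ofReal.comp (continuous_hermiteFun j)).aestronglyMeasurable measurable_id
    (integrable_of_bound_gaussian (C := 2 * (j + 1) * Real.exp j)
      (continuous_ofReal.comp (continuous_hermiteFun j)) fun x => by
      rw [norm_real, Real.norm_eq_abs]
      refine (abs_hermiteFun_le_quarter j x).trans (mul_le_of_le_one_right (by positivity) ?_)
      rw [Real.exp_le_one_iff]
      have := sq_nonneg x
      linarith)
  simp_rw [fun z x => mul_comm (hermiteFun j x : ℂ) (hermiteGen z x),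
    integral_hermiteFun_mul_hermiteGen] at h1
  have h2 : ∀ z : ℂ, HasSum (fun k => (((Real.sqrt k.factorial)⁻¹ : ℝ) *
      (if j = k then 1 else 0) : ℂ) * z ^ k) (((Real.sqrt j.factorial)⁻¹ : ℝ) * z ^ j) := by
    intro z
    have := hasSum_ite_eq j (((Real.sqrt j.factorial)⁻¹ : ℝ) * z ^ j : ℂ)
    refine this.congr_fun fun k => ?_
    by_cases h : k = j
    · subst h; simp
    · simp [h, Ne.symm h]
  exact mul_left_cancel₀ (sqrt_factorial_ofReal_ne_zero k) (coeff_eq_of_hasSum h1 h2 k)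

/-! ### The Fourier transform on `ℝⁿ` -/

/-- The Fourier transform `∫ g(x) e^{-i p·x} dx`. -/
def ft {n : ℕ} (g : Rn n → ℂ) (p : Rn n) : ℂ :=
  ∫ x : Rn n, g x * cexp (-(I * ((inner ℝ p x : ℝ) : ℂ)))

theorem norm_cexp_neg_I_mul (r : ℝ) : ‖cexp (-(I * (r : ℂ)))‖ = 1 := by
  rw [← mul_neg, ← ofReal_neg, mul_comm, norm_exp_ofReal_mul_I]

theorem norm_cexp_I_mul (r : ℝ) : ‖cexp (I * (r : ℂ))‖ = 1 := by
  rw [mul_comm, norm_exp_ofReal_mul_I]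

open FourierTransform in
theorem ft_eq_fourier {n : ℕ} (g : Rn n → ℂ) (p : Rn n) :
    ft g p = 𝓕 g ((2 * Real.pi)⁻¹ • p) := by
  rw [Real.fourier_eq', ft]
  congr 1
  funext x
  rw [smul_eq_mul, mul_comm, inner_smul_right, real_inner_comm]
  congr 2
  have : (Real.pi : ℂ) ≠ 0 := by exact_mod_cast Real.pi_ne_zero
  push_cast
  field_simp

open FourierTransform in
theorem fourier_eq_ft {n : ℕ} (g : Rn n → ℂ) (p : Rn n) :
    𝓕 g p = ft g ((2 * Real.pi) • p) := by
  rw [ft_eq_fourier, smul_smul, inv_mul_cancel₀ (by positivity), one_smul]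

open FourierTransform in
theorem continuous_ft {n : ℕ} {g : Rn n → ℂ} (hg : Integrable g) : Continuous (ft g) := by
  have h : Continuous (𝓕 g) := VectorFourier.fourierIntegral_continuous
    Real.continuous_fourierChar continuous_inner hg
  have e : ft g = fun p => 𝓕 g ((2 * Real.pi)⁻¹ • p) := funext (ft_eq_fourier g)
  rw [e]
  exact h.comp (by fun_prop)

theorem integrable_mul_cexp_neg {n : ℕ} {g : Rn n → ℂ} (hg : Integrable g) (p : Rn n) :
    Integrable fun x => g x * cexp (-(I * ((inner ℝ p x : ℝ) : ℂ))) :=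
  hg.mul_bdd (c := 1) (Continuous.aestronglyMeasurable (by fun_prop))
    (Filter.Eventually.of_forall fun x => (norm_cexp_neg_I_mul _).le)

theorem integral_ft_mul {n : ℕ} {f g : Rn n → ℂ} (hf : Integrable f) (hg : Integrable g) :
    ∫ p, ft f p * g p = ∫ x, f x * ft g x := by
  have h : Integrable (fun z : Rn n × Rn n => f z.1 * g z.2 *
      cexp (-(I * ((inner ℝ z.2 z.1 : ℝ) : ℂ)))) (volume.prod volume) :=
    (hf.mul_prod hg).mul_bdd (c := 1) (Continuous.aestronglyMeasurable (by fun_prop))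
      (Filter.Eventually.of_forall fun x => (norm_cexp_neg_I_mul _).le)
  simp only [ft]
  simp_rw [← integral_const_mul, ← integral_mul_const]
  rw [← integral_integral_swap]
  · congr 1; funext x; congr 1; funext y; rw [real_inner_comm]; ring
  · refine h.congr (Filter.Eventually.of_forall fun z => ?_)
    simp only [Function.uncurry]; ring

open FourierTransform in
theorem ft_inversion {n : ℕ} {g : Rn n → ℂ} (hc : Continuous g) (hg : Integrable g)
    (hft : Integrable (ft g)) (x : Rn n) :
    ∫ p, ft g p * cexp (I * ((inner ℝ p x : ℝ) : ℂ)) = ((2 * Real.pi) ^ n : ℝ) * g x := by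
  have h1 : Integrable (𝓕 g) := by
    have e : 𝓕 g = fun p => ft g ((2 * Real.pi) • p) := funext (fourier_eq_ft g)
    rw [e]
    exact hft.comp_smul (by positivity)
  have h2 := congrFun (hc.fourierInv_fourier_eq hg h1) x
  rw [Real.fourierInv_eq'] at h2
  rw [← h2]
  have h3 := Measure.integral_comp_smul (volume : Measure (Rn n))
    (fun p => ft g p * cexp (I * ((inner ℝ p x : ℝ) : ℂ))) (2 * Real.pi)
  rw [finrank_euclideanSpace_fin, abs_of_pos (by positivity)] at h3
  have h4 : (∫ p, ft g p * cexp (I * ((inner ℝ p x : ℝ) : ℂ))) = ((2 * Real.pi) ^ n : ℝ) *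
      ∫ (x_1 : Rn n), (fun p ↦ ft g p * cexp (I * ↑(inner ℝ p x))) ((2 * Real.pi) • x_1) := by
    rw [h3, real_smul, ← mul_assoc, ← ofReal_mul, mul_inv_cancel₀ (by positivity)]
    simp
  rw [h4]
  congr 2
  funext p
  rw [fourier_eq_ft, smul_eq_mul, mul_comm (cexp _)]
  simp only [inner_smul_left, conj_trivial]
  congr 2
  push_cast
  ring

open FourierTransform in
-- Every test function is the Fourier transform of a Schwartz function, so by the multiplication
-- formula ∫ φg is an integral against the vanishing transform of g.
theorem ae_eq_zero_of_ft_eq_zero {n : ℕ} {g : Rn n → ℂ} (hg : Integrable g)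
    (h : ∀ p, ft g p = 0) : ∀ᵐ x, g x = 0 := by
  refine ae_eq_zero_of_integral_contDiff_smul_eq_zero hg.locallyIntegrable ?_
  intro φ φ_smooth φ_cpt
  have hφ₁ : HasCompactSupport (Complex.ofRealCLM ∘ φ) := φ_cpt.comp_left rfl
  have hφ₂ : ContDiff ℝ ((⊤ : ℕ∞) : WithTop ℕ∞) (Complex.ofRealCLM ∘ φ) := by fun_prop
  let ψ : SchwartzMap (Rn n) ℂ := 𝓕⁻ (hφ₁.toSchwartzMap hφ₂)
  have h1 : ∀ x, (φ x : ℂ) = 𝓕 (ψ : Rn n → ℂ) x := by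
    intro x
    rw [← SchwartzMap.fourier_coe]
    simp [ψ, FourierTransform.fourier_fourierInv_eq]
  have h2 := integral_ft_mul hg (ψ.integrable.comp_smul (R := (2 * Real.pi)⁻¹) (by positivity))
  simp_rw [h, zero_mul, integral_zero] at h2
  have h3 : ∀ x, ft (fun x => ψ ((2 * Real.pi)⁻¹ • x)) x = ((2 * Real.pi) ^ n : ℝ) * φ x := by
    intro x
    rw [h1, fourier_eq_ft, ft, ft]
    have h4 := Measure.integral_comp_smul (volume : Measure (Rn n))
      (fun v => ψ v * cexp (-(I * ((inner ℝ ((2 * Real.pi) • x) v : ℝ) : ℂ)))) (2 * Real.pi)⁻¹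
    rw [finrank_euclideanSpace_fin, inv_pow, inv_inv, abs_of_pos (by positivity), real_smul] at h4
    rw [← h4]
    congr 1; funext v
    rw [inner_smul_left, inner_smul_right]
    have : (Real.pi : ℂ) ≠ 0 := by exact_mod_cast Real.pi_ne_zero
    congr 4
    simp
    field_simp
  simp_rw [h3] at h2
  have h5 : ∫ x, (((2 * Real.pi) ^ n : ℝ) : ℂ) * (φ x • g x) = 0 := by
    rw [h2]; congr 1; funext x; rw [real_smul]; ring
  rw [integral_const_mul] at h5
  refine (mul_eq_zero.1 h5).resolve_left ?_
  exact_mod_cast (show (2 * Real.pi) ^ n ≠ 0 by positivity)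

/-! ### Products of one-dimensional functions -/

theorem integral_prod_coord {n : ℕ} (f : Fin n → ℝ → ℂ) :
    ∫ x : Rn n, ∏ j, f j (x j) = ∏ j, ∫ t, f j t := by
  rw [← integral_fintype_prod_volume_eq_prod]
  exact (EuclideanSpace.volume_preserving_symm_measurableEquiv_toLp (Fin n)).integral_comp
    (MeasurableEquiv.measurableEmbedding _) (fun x : Fin n → ℝ => ∏ j, f j (x j))

theorem integrable_prod_coord {n : ℕ} {f : Fin n → ℝ → ℂ} (hf : ∀ j, Integrable (f j)) :
    Integrable fun x : Rn n => ∏ j, f j (x j) :=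
  (EuclideanSpace.volume_preserving_symm_measurableEquiv_toLp (Fin n)).integrable_comp_of_integrable
    (Integrable.fintype_prod hf)

theorem prod_exp_neg_mul_sq {n : ℕ} (a : ℝ) (x : Rn n) :
    ∏ j, Real.exp (-a * x j ^ 2) = Real.exp (-a * ‖x‖ ^ 2) := by
  rw [← Real.exp_sum, EuclideanSpace.norm_sq_eq, Finset.mul_sum]
  simp

theorem integrable_gaussian {n : ℕ} {a : ℝ} (ha : 0 < a) :
    Integrable fun x : Rn n => Real.exp (-a * ‖x‖ ^ 2) := by
  have h := integrable_prod_coord (n := n) (f := fun _ t => (Real.exp (-a * t ^ 2) : ℂ))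
    fun _ => (integrable_exp_neg_mul_sq ha).ofReal
  refine h.norm.congr (Filter.Eventually.of_forall fun x => ?_)
  simp only [← ofReal_prod, norm_real, prod_exp_neg_mul_sq, Real.norm_eq_abs, Real.abs_exp]

theorem memLp_two_gaussian {n : ℕ} {a : ℝ} (ha : 0 < a) :
    MemLp (fun x : Rn n => Real.exp (-a * ‖x‖ ^ 2)) 2 := by
  rw [memLp_two_iff_integrable_sq (by fun_prop)]
  refine (integrable_gaussian (n := n) (a := 2 * a) (by positivity)).congr
    (Filter.Eventually.of_forall fun x => ?_)
  simp only [← Real.exp_nat_mul]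
  congr 1; push_cast; ring

theorem ft_prod_coord {n : ℕ} (f : Fin n → ℝ → ℂ) (p : Rn n) :
    ft (fun x => ∏ j, f j (x j)) p = ∏ j, ∫ t, cexp (-(I * ((p j * t : ℝ) : ℂ))) * f j t := by
  rw [← integral_prod_coord, ft]
  congr 1; funext x
  rw [Finset.prod_mul_distrib, mul_comm, ← Complex.exp_sum]
  congr 2
  simp only [PiLp.inner_apply, RCLike.inner_apply, conj_trivial]
  push_cast
  rw [Finset.mul_sum, Finset.sum_neg_distrib]
  simp [mul_comm]

/-! ### Hermite functions on `ℝⁿ` -/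

theorem hermiteFunN_eq {n : ℕ} (lam : ℝ) (α : Fin n → ℕ) (x : Rn n) :
    hermiteFunN lam α x = (|lam| ^ ((n : ℝ) / 4) : ℝ) *
      ∏ j, (hermiteFun (α j) (Real.sqrt |lam| * x j) : ℂ) := by
  simp [hermiteFunN]

theorem continuous_hermiteFunN {n : ℕ} (lam : ℝ) (α : Fin n → ℕ) :
    Continuous (hermiteFunN (n := n) lam α) := by
  unfold hermiteFunN
  refine continuous_ofReal.comp (continuous_const.mul ?_)
  exact continuous_finsetProd _ fun j _ => (continuous_hermiteFun _).comp (by fun_prop)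

theorem inner_hermiteL2 {n : ℕ} {lam : ℝ} (hlam : lam ≠ 0) (α : Fin n → ℕ) (g : L2Rn n) :
    inner ℂ (hermiteL2 hlam α) g = ∫ x, g x * hermiteFunN lam α x := by
  rw [L2.inner_def]
  refine integral_congr_ae ?_
  filter_upwards [(memLp_hermiteFunN hlam α).coeFn_toLp] with x hx
  rw [hermiteL2, hx, RCLike.inner_apply, hermiteFunN, conj_ofReal]

theorem abs_rpow_quarter_mul_self {n : ℕ} {lam : ℝ} (hlam : lam ≠ 0) :
    |lam| ^ ((n : ℝ) / 4) * |lam| ^ ((n : ℝ) / 4) = Real.sqrt |lam| ^ n := by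
  have : 0 < |lam| := abs_pos.2 hlam
  rw [← Real.rpow_add this, Real.sqrt_eq_rpow, ← Real.rpow_natCast, ← Real.rpow_mul this.le]
  congr 1; ring

theorem orthonormal_hermiteL2 {n : ℕ} {lam : ℝ} (hlam : lam ≠ 0) :
    Orthonormal ℂ (hermiteL2 (n := n) hlam) := by
  classical
  rw [orthonormal_iff_ite]
  intro α β
  rw [inner_hermiteL2]
  have h0 : 0 < Real.sqrt |lam| := Real.sqrt_pos.2 (abs_pos.2 hlam)
  have h1 : ∫ x, (hermiteL2 hlam β) x * hermiteFunN lam α x =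
      ∫ x : Rn n, ((Real.sqrt |lam| ^ n : ℝ) : ℂ) * ∏ j, ((hermiteFun (β j) (Real.sqrt |lam| * x j) : ℂ) *
        hermiteFun (α j) (Real.sqrt |lam| * x j)) := by
    refine integral_congr_ae ?_
    filter_upwards [(memLp_hermiteFunN hlam β).coeFn_toLp] with x hx
    rw [hermiteL2, hx, hermiteFunN_eq, hermiteFunN_eq, mul_mul_mul_comm, ← ofReal_mul,
      abs_rpow_quarter_mul_self hlam, Finset.prod_mul_distrib]
  rw [h1, integral_const_mul, integral_prod_coord (fun j t =>
    ((hermiteFun (β j) (Real.sqrt |lam| * t) : ℂ) * hermiteFun (α j) (Real.sqrt |lam| * t)))]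
  have h2 : ∀ j, ∫ t, ((hermiteFun (β j) (Real.sqrt |lam| * t) : ℂ) *
      hermiteFun (α j) (Real.sqrt |lam| * t)) =
      ((Real.sqrt |lam|)⁻¹ : ℝ) * (if β j = α j then 1 else 0) := by
    intro j
    have := Measure.integral_comp_mul_left
      (fun t => (hermiteFun (β j) t : ℂ) * hermiteFun (α j) t) (Real.sqrt |lam|)
    rw [this, integral_hermiteFun_mul_hermiteFun, abs_of_pos (by positivity), real_smul]
  simp_rw [h2]
  rw [Finset.prod_mul_distrib, Finset.prod_const, Finset.card_univ, Fintype.card_fin, ← mul_assoc,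
    ← ofReal_pow, ← ofReal_mul, inv_pow, mul_inv_cancel₀ (by positivity), ofReal_one, one_mul]
  split_ifs with h
  · subst h; simp
  · obtain ⟨j, hj⟩ := Function.ne_iff.1 h
    exact Finset.prod_eq_zero (Finset.mem_univ j) (by simp [Ne.symm hj])

/-! ### Completeness of the Hermite functions -/

/-- A family of factors each of which is `h_k` or the generating function. -/
theorem norm_factor_le (S : Prop) [Decidable S] (z : ℂ) (k : ℕ) (t : ℝ) :
    ‖(if S then hermiteGen z t else (hermiteFun k t : ℂ))‖ ≤
      (Real.exp ((1 + 2 * 1) * ‖z‖ ^ 2 / 2) + 2 * (k + 1) * Real.exp k) *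
        Real.exp (-(1 / 4) * t ^ 2) := by
  have h1 := norm_hermiteGen_le one_pos z t
  have h2 := abs_hermiteFun_le_quarter k t
  have e : (1 : ℝ) / (2 * (1 + 1)) = 1 / 4 := by norm_num
  rw [e] at h1
  split_ifs
  · refine h1.trans ?_
    rw [mul_comm]
    gcongr
    have : (0 : ℝ) ≤ 2 * (k + 1) * Real.exp k := by positivity
    linarith
  · rw [norm_real, Real.norm_eq_abs]
    refine h2.trans ?_
    gcongr
    have := Real.exp_pos ((1 + 2 * 1) * ‖z‖ ^ 2 / 2)
    linarith

/-- Induction over the coordinates, replacing one Hermite function at a time by the generating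
function: the integral is then a power series in `z i` whose coefficients vanish by the previous
stage. -/
theorem integral_mul_prod_eq_zero {n : ℕ} {g : Rn n → ℂ} {s : ℝ}
    (hg : AEStronglyMeasurable g volume)
    (hgi : Integrable fun x => g x * Real.exp (-(1 / 4) * s ^ 2 * ‖x‖ ^ 2))
    (h : ∀ α : Fin n → ℕ, ∫ x, g x * ∏ j, (hermiteFun (α j) (s * x j) : ℂ) = 0)
    (z : Fin n → ℂ) (S : Finset (Fin n)) (α : Fin n → ℕ) :
    ∫ x, g x * ∏ j, (if j ∈ S then hermiteGen (z j) (s * x j) else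
      (hermiteFun (α j) (s * x j) : ℂ)) = 0 := by
  classical
  induction S using Finset.induction_on generalizing α with
  | empty => simpa using h α
  | insert i S hi ih =>
    set w : Rn n → ℂ := fun x => g x * ∏ j ∈ Finset.univ.erase i,
      (if j ∈ S then hermiteGen (z j) (s * x j) else (hermiteFun (α j) (s * x j) : ℂ)) with hw
    have hpc : Continuous fun x : Rn n => ∏ j ∈ Finset.univ.erase i,
        (if j ∈ S then hermiteGen (z j) (s * x j) else (hermiteFun (α j) (s * x j) : ℂ)) := by
      refine continuous_finsetProd _ fun j _ => ?_
      split_ifs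
      · exact (continuous_hermiteGen _).comp (by fun_prop)
      · exact continuous_ofReal.comp ((continuous_hermiteFun _).comp (by fun_prop))
    have hwm : AEStronglyMeasurable w volume := hg.mul hpc.aestronglyMeasurable
    set K : ℝ := ∏ j ∈ Finset.univ.erase i,
      (Real.exp ((1 + 2 * 1) * ‖z j‖ ^ 2 / 2) + 2 * (α j + 1) * Real.exp (α j)) with hK
    have hint : Integrable (fun x => w x * Real.exp (-(1 / 4) * (s * x i) ^ 2)) := by
      refine (hgi.norm.const_mul K).mono' (hwm.mul (Continuous.aestronglyMeasurable (by fun_prop)))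
        (Filter.Eventually.of_forall fun x => ?_)
      have e1 : Real.exp (-(1 / 4) * s ^ 2 * ‖x‖ ^ 2) =
          (∏ j ∈ Finset.univ.erase i, Real.exp (-(1 / 4) * (s * x j) ^ 2)) *
            Real.exp (-(1 / 4) * (s * x i) ^ 2) := by
        rw [mul_comm (∏ j ∈ _, _), Finset.mul_prod_erase Finset.univ
          (fun j => Real.exp (-(1 / 4) * (s * x j) ^ 2)) (Finset.mem_univ i), neg_mul,
          ← prod_exp_neg_mul_sq]
        refine Finset.prod_congr rfl fun j _ => ?_
        congr 1; ring
      have e2 : ‖∏ j ∈ Finset.univ.erase i,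
          (if j ∈ S then hermiteGen (z j) (s * x j) else (hermiteFun (α j) (s * x j) : ℂ))‖ ≤
          K * ∏ j ∈ Finset.univ.erase i, Real.exp (-(1 / 4) * (s * x j) ^ 2) := by
        rw [hK, ← Finset.prod_mul_distrib, norm_prod]
        exact Finset.prod_le_prod (fun j _ => norm_nonneg _) fun j _ => norm_factor_le _ _ _ _
      simp only [hw, norm_mul, norm_real, Real.norm_eq_abs, Real.abs_exp]
      rw [e1]
      calc _ ≤ ‖g x‖ * (K * ∏ j ∈ Finset.univ.erase i, Real.exp (-(1 / 4) * (s * x j) ^ 2)) *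
            Real.exp (-(1 / 4) * (s * x i) ^ 2) := by gcongr
        _ = _ := by ring
    have hs := hasSum_integral_hermiteFun hwm (y := fun x : Rn n => s * x i) (by fun_prop) hint
      (z i)
    -- The induction hypothesis holds for all multi-indices, so the entry at `i` may be set to `k`.
    have h0 : ∀ k : ℕ, ∫ x, w x * (hermiteFun k (s * x i) : ℂ) = 0 := by
      intro k
      rw [← ih (Function.update α i k)]
      congr 1; funext x
      rw [hw, mul_assoc, ← Finset.mul_prod_erase Finset.univ _ (Finset.mem_univ i), if_neg hi,
        Function.update_self, mul_comm (hermiteFun k (s * x i) : ℂ)]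
      congr 2
      refine Finset.prod_congr rfl fun j hj => ?_
      rw [Function.update_of_ne (Finset.ne_of_mem_erase hj)]
    simp_rw [h0, mul_zero, zero_mul] at hs
    rw [← hs.unique hasSum_zero]
    congr 1; funext x
    rw [hw, mul_assoc, ← Finset.mul_prod_erase Finset.univ _ (Finset.mem_univ i),
      if_pos (Finset.mem_insert_self i S), mul_comm (hermiteGen (z i) _)]
    congr 2
    refine Finset.prod_congr rfl fun j hj => ?_
    simp [Finset.ne_of_mem_erase hj]

/-- At purely imaginary parameters the generating function is a Gaussian times a character.
Orthogonality to all Hermite functions therefore kills the Fourier transform of g times a Gaussian.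
-/
theorem ae_eq_zero_of_hermite_orthogonal {n : ℕ} {g : Rn n → ℂ} {s : ℝ} (hs : 0 < s)
    (hg : AEStronglyMeasurable g volume)
    (hgi : Integrable fun x => g x * Real.exp (-(1 / 4) * s ^ 2 * ‖x‖ ^ 2))
    (h : ∀ α : Fin n → ℕ, ∫ x, g x * ∏ j, (hermiteFun (α j) (s * x j) : ℂ) = 0) :
    ∀ᵐ x, g x = 0 := by
  have hi : Integrable fun x => g x * Real.exp (-(1 / 2) * s ^ 2 * ‖x‖ ^ 2) := by
    refine hgi.norm.mono' (hg.mul (Continuous.aestronglyMeasurable (by fun_prop)))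
      (Filter.Eventually.of_forall fun x => ?_)
    simp only [norm_mul, norm_real, Real.norm_eq_abs, Real.abs_exp]
    gcongr
    norm_num
  have h1 : ∀ p, ft (fun x => g x * Real.exp (-(1 / 2) * s ^ 2 * ‖x‖ ^ 2)) p = 0 := by
    intro p
    -- The parameter z_j is chosen so that √2·(s x_j)·z_j = -i p_j x_j.
    have h2 := integral_mul_prod_eq_zero hg hgi h
      (fun j => -I * ((p j / (Real.sqrt 2 * s) : ℝ) : ℂ)) Finset.univ 0
    simp only [Finset.mem_univ, if_true] at h2
    have h3 : ∀ x : Rn n, ∏ j, hermiteGen (-I * ((p j / (Real.sqrt 2 * s) : ℝ) : ℂ)) (s * x j) =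
        (∏ j, (((Real.sqrt (Real.sqrt Real.pi))⁻¹ : ℝ) : ℂ) *
          cexp (-(-I * ((p j / (Real.sqrt 2 * s) : ℝ) : ℂ)) ^ 2 / 2)) *
        (Real.exp (-(1 / 2) * s ^ 2 * ‖x‖ ^ 2) * cexp (-(I * ((inner ℝ p x : ℝ) : ℂ)))) := by
      intro x
      have e1 : cexp (-(I * ((inner ℝ p x : ℝ) : ℂ))) =
          ∏ j, cexp (-(I * ((p j * x j : ℝ) : ℂ))) := by
        rw [← Complex.exp_sum]
        congr 1
        simp only [PiLp.inner_apply, RCLike.inner_apply, conj_trivial]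
        push_cast
        rw [Finset.mul_sum, Finset.sum_neg_distrib]
        simp [mul_comm]
      have e2 : (Real.exp (-(1 / 2) * s ^ 2 * ‖x‖ ^ 2) : ℂ) =
          ∏ j, ((Real.exp (-(1 / 2 * s ^ 2) * x j ^ 2) : ℝ) : ℂ) := by
        rw [← ofReal_prod, prod_exp_neg_mul_sq]
        congr 2; ring
      rw [e1, e2, ← Finset.prod_mul_distrib, ← Finset.prod_mul_distrib]
      refine Finset.prod_congr rfl fun j _ => ?_
      rw [hermiteGen, mul_assoc (((Real.sqrt (Real.sqrt Real.pi))⁻¹ : ℝ) : ℂ), ofReal_exp,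
        ← Complex.exp_add, ← Complex.exp_add]
      congr 2
      have : (Real.sqrt 2 : ℂ) ≠ 0 := by exact_mod_cast (Real.sqrt_pos.2 two_pos).ne'
      have : (s : ℂ) ≠ 0 := by exact_mod_cast hs.ne'
      push_cast
      field_simp
      ring
    simp_rw [h3, mul_left_comm (g _), integral_const_mul] at h2
    rw [ft]
    have h4 := (mul_eq_zero.1 h2).resolve_left (Finset.prod_ne_zero_iff.2 fun j _ => by
      refine mul_ne_zero ?_ (Complex.exp_ne_zero _)
      exact_mod_cast (inv_pos.2 (Real.sqrt_pos.2 (Real.sqrt_pos.2 Real.pi_pos))).ne')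
    rw [← h4]
    congr 1; funext x; ring
  filter_upwards [ae_eq_zero_of_ft_eq_zero hi h1] with x hx
  exact (mul_eq_zero.1 hx).resolve_right (by exact_mod_cast (Real.exp_pos _).ne')

theorem integrable_mul_gaussian {n : ℕ} {g : Rn n → ℂ} (hg : MemLp g 2) {a : ℝ} (ha : 0 < a) :
    Integrable fun x => g x * Real.exp (-a * ‖x‖ ^ 2) := by
  have h : MemLp (fun x : Rn n => (Real.exp (-a * ‖x‖ ^ 2) : ℂ)) 2 := (memLp_two_gaussian ha).ofReal
  exact hg.integrable_mul h

theorem eq_zero_of_inner_hermiteL2 {n : ℕ} {lam : ℝ} (hlam : lam ≠ 0) {g : L2Rn n}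
    (h : ∀ α, inner ℂ (hermiteL2 hlam α) g = 0) : g = 0 := by
  rw [Lp.eq_zero_iff_ae_eq_zero]
  have hs : 0 < Real.sqrt |lam| := Real.sqrt_pos.2 (abs_pos.2 hlam)
  refine ae_eq_zero_of_hermite_orthogonal hs (Lp.aestronglyMeasurable g) ?_ fun α => ?_
  · have := integrable_mul_gaussian (Lp.memLp g) (a := 1 / 4 * Real.sqrt |lam| ^ 2) (by positivity)
    simpa only [neg_mul] using this
  · have h1 := h α
    rw [inner_hermiteL2] at h1
    simp_rw [hermiteFunN_eq, mul_left_comm (g _), integral_const_mul] at h1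
    refine (mul_eq_zero.1 h1).resolve_left ?_
    exact_mod_cast (Real.rpow_pos_of_pos (abs_pos.2 hlam) _).ne'

/-- The difference of the two sides is orthogonal to every Hermite function. Summability is assumed
because the expansions needed here have absolutely summable coefficients. -/
theorem hasSum_hermiteL2 {n : ℕ} {lam : ℝ} (hlam : lam ≠ 0) {g : L2Rn n}
    (hs : Summable fun α => inner ℂ (hermiteL2 hlam α) g • hermiteL2 hlam α) :
    ∑' α, inner ℂ (hermiteL2 hlam α) g • hermiteL2 hlam α = g := by
  classical
  rw [← sub_eq_zero]
  refine eq_zero_of_inner_hermiteL2 hlam fun β => ?_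
  rw [inner_sub_right, sub_eq_zero]
  have h1 := (hs.hasSum.mapL (innerSL ℂ (hermiteL2 hlam β))).tsum_eq
  simp only [innerSL_apply_apply, inner_smul_right,
    orthonormal_iff_ite.1 (orthonormal_hermiteL2 hlam)] at h1
  rw [← h1]
  simp

/-! ### Entire functions bounded by two Gaussians -/

/-- Every entire function bounded by both `C e^{(κx²+y²)/2}` and `C e^{(x²+κy²)/2}` is bounded by
`C e^{δ|z|²/2}`. -/
def GaussianInterpolation (κ δ : ℝ) : Prop :=
  ∀ (B : ℂ → ℂ) (C : ℝ), Differentiable ℂ B →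
    (∀ z, ‖B z‖ ≤ C * Real.exp ((κ * z.re ^ 2 + z.im ^ 2) / 2)) →
    (∀ z, ‖B z‖ ≤ C * Real.exp ((z.re ^ 2 + κ * z.im ^ 2) / 2)) →
    ∀ z, ‖B z‖ ≤ C * Real.exp (δ * ‖z‖ ^ 2 / 2)

theorem norm_sq_eq_re_im (z : ℂ) : ‖z‖ ^ 2 = z.re ^ 2 + z.im ^ 2 := by
  rw [← Complex.normSq_eq_norm_sq, Complex.normSq_apply]; ring

/-- The smaller of the two exponents is at most their mean. For κ < 1 this already gives δ < 1,
which is all that the union over t requires. -/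
theorem gaussianInterpolation_mean (κ : ℝ) : GaussianInterpolation κ ((1 + κ) / 2) := by
  intro B C _ h1 h2 z
  have hC : 0 ≤ C := by simpa using (norm_nonneg _).trans (h1 0)
  rw [norm_sq_eq_re_im]
  rcases le_total (κ * z.re ^ 2 + z.im ^ 2) (z.re ^ 2 + κ * z.im ^ 2) with h | h
  · refine (h1 z).trans ?_
    gcongr
    linarith
  · refine (h2 z).trans ?_
    gcongr
    linarith

/-- Phragmén–Lindelöf in the sector ε ≤ arg z ≤ π/2 - ε, written in ζ = log z. Near the real ray the
first bound is good and near the imaginary ray the second; multiplying by exp(iMz²), of modulus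
exp(-M|z|² sin(2 arg z)), makes B bounded on both edges. Order two is critical for a full quadrant,
hence the need for ε > 0. -/
theorem norm_le_of_sector {κ ε C : ℝ} {B : ℂ → ℂ} (hκ : 0 ≤ κ) (hκ1 : κ ≤ 1) (hε : 0 < ε)
    (hε' : ε < Real.pi / 4) (hB : Differentiable ℂ B)
    (h1 : ∀ z, ‖B z‖ ≤ C * Real.exp ((κ * z.re ^ 2 + z.im ^ 2) / 2))
    (h2 : ∀ z, ‖B z‖ ≤ C * Real.exp ((z.re ^ 2 + κ * z.im ^ 2) / 2))
    {ζ : ℂ} (hζ : ε ≤ ζ.im) (hζ' : ζ.im ≤ Real.pi / 2 - ε) :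
    ‖B (cexp ζ)‖ ≤ C * Real.exp ((κ + Real.sin ε ^ 2) / Real.sin (2 * ε) * ‖cexp ζ‖ ^ 2 / 2) := by
  have hC : 0 ≤ C := by simpa using (norm_nonneg _).trans (h1 0)
  have hsin : 0 < Real.sin (2 * ε) := Real.sin_pos_of_pos_of_lt_pi (by linarith) (by linarith)
  -- Chosen so that M·sin 2ε = (κ + sin²ε)/2, which dominates the exponent (κ cos²ε + sin²ε)/2 on
  -- either edge.
  set M := (κ + Real.sin ε ^ 2) / Real.sin (2 * ε) / 2 with hM
  have hM0 : 0 ≤ M := by positivity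
  set F : ℂ → ℂ := fun ζ => B (cexp ζ) * cexp (I * M * cexp (2 * ζ)) with hF
  have hre : ∀ ζ : ℂ, (cexp ζ).re = Real.exp ζ.re * Real.cos ζ.im := Complex.exp_re
  have him : ∀ ζ : ℂ, (cexp ζ).im = Real.exp ζ.re * Real.sin ζ.im := Complex.exp_im
  have hn : ∀ ζ : ℂ, ‖cexp (I * M * cexp (2 * ζ))‖ =
      Real.exp (-(M * Real.exp ζ.re ^ 2 * Real.sin (2 * ζ.im))) := by
    intro ζ
    rw [norm_exp]
    congr 1
    have : (2 * ζ).im = 2 * ζ.im := by simp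
    have h3 : (2 * ζ).re = 2 * ζ.re := by simp
    rw [mul_assoc, I_mul_re, im_ofReal_mul, him, this, h3, ← Real.exp_nat_mul]
    push_cast; ring
  have hbd : ∀ ζ : ℂ, 0 ≤ Real.sin (2 * ζ.im) → ‖cexp (I * M * cexp (2 * ζ))‖ ≤ 1 := by
    intro ζ h
    rw [hn, Real.exp_le_one_iff, neg_nonpos]
    positivity
  have hFd : Differentiable ℂ F := by
    refine (hB.comp Complex.differentiable_exp).mul ?_
    fun_prop
  have key : ‖F ζ‖ ≤ C := by
    -- The admissible growth is exp(B·exp(c|Re ζ|)) with c < π/(π/2 - 2ε). Here c = 2 and B = 1/2,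
    -- since the multiplier has modulus at most 1 in the strip.
    refine PhragmenLindelof.horizontal_strip (a := ε) (b := Real.pi / 2 - ε) hFd.diffContOnCl
      ⟨2, ?_, 1 / 2, ?_⟩ ?_ ?_ hζ hζ'
    · rw [lt_div_iff₀ (by linarith)]; linarith
    · refine Asymptotics.IsBigO.of_bound C ?_
      refine Filter.Eventually.filter_mono inf_le_right ?_
      rw [Filter.eventually_principal]
      intro w hw
      simp only [Set.mem_preimage, Set.mem_Ioo] at hw
      have hs : 0 ≤ Real.sin (2 * w.im) :=
        Real.sin_nonneg_of_nonneg_of_le_pi (by linarith) (by linarith)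
      rw [hF, norm_mul, Real.norm_eq_abs, Real.abs_exp]
      refine (mul_le_of_le_one_right (norm_nonneg _) (hbd w hs)).trans ((h1 _).trans ?_)
      gcongr
      have e1 : (cexp w).re ^ 2 + (cexp w).im ^ 2 = Real.exp (2 * w.re) := by
        rw [← norm_sq_eq_re_im, norm_exp, ← Real.exp_nat_mul]; push_cast; rfl
      have e2 : Real.exp (2 * w.re) ≤ Real.exp (2 * |w.re|) := by gcongr; exact le_abs_self _
      have e3 := mul_le_of_le_one_left (sq_nonneg (cexp w).re) hκ1
      linarith
    · intro w hw
      rw [hF, norm_mul, hn, hw]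
      calc _ ≤ C * Real.exp ((κ * (cexp w).re ^ 2 + (cexp w).im ^ 2) / 2) *
            Real.exp (-(M * Real.exp w.re ^ 2 * Real.sin (2 * ε))) := by
              gcongr; exact h1 _
        _ = C * Real.exp ((κ * (cexp w).re ^ 2 + (cexp w).im ^ 2) / 2 -
              M * Real.exp w.re ^ 2 * Real.sin (2 * ε)) := by
              rw [mul_assoc, ← Real.exp_add]; rfl
        _ ≤ C * 1 := by
          gcongr
          rw [Real.exp_le_one_iff, hre, him, hw]
          have e1 : M * Real.exp w.re ^ 2 * Real.sin (2 * ε) =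
            (κ + Real.sin ε ^ 2) / 2 * Real.exp w.re ^ 2 := by rw [hM]; field_simp
          rw [e1]
          have := mul_nonneg (mul_nonneg hκ (sq_nonneg (Real.exp w.re))) (sq_nonneg (Real.sin ε))
          have e2 := Real.cos_sq_add_sin_sq ε
          have e3 : Real.cos ε ^ 2 = 1 - Real.sin ε ^ 2 := by linarith
          rw [mul_pow, mul_pow, e3]
          nlinarith
        _ = C := mul_one C
    · intro w hw
      have hs : Real.sin (2 * (Real.pi / 2 - ε)) = Real.sin (2 * ε) := by
        rw [← Real.sin_pi_sub]; congr 1; ring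
      rw [hF, norm_mul, hn, hw, hs]
      calc _ ≤ C * Real.exp (((cexp w).re ^ 2 + κ * (cexp w).im ^ 2) / 2) *
            Real.exp (-(M * Real.exp w.re ^ 2 * Real.sin (2 * ε))) := by
              gcongr; exact h2 _
        _ = C * Real.exp (((cexp w).re ^ 2 + κ * (cexp w).im ^ 2) / 2 -
              M * Real.exp w.re ^ 2 * Real.sin (2 * ε)) := by
              rw [mul_assoc, ← Real.exp_add]; rfl
        _ ≤ C * 1 := by
          gcongr
          rw [Real.exp_le_one_iff, hre, him, hw, Real.cos_pi_div_two_sub, Real.sin_pi_div_two_sub]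
          have e1 : M * Real.exp w.re ^ 2 * Real.sin (2 * ε) =
            (κ + Real.sin ε ^ 2) / 2 * Real.exp w.re ^ 2 := by rw [hM]; field_simp
          rw [e1]
          have := mul_nonneg (mul_nonneg hκ (sq_nonneg (Real.exp w.re))) (sq_nonneg (Real.sin ε))
          have e2 := Real.cos_sq_add_sin_sq ε
          have e3 : Real.cos ε ^ 2 = 1 - Real.sin ε ^ 2 := by linarith
          rw [mul_pow, mul_pow, e3]
          nlinarith
        _ = C := mul_one C
  rw [hF, norm_mul, hn, Real.exp_neg, ← div_eq_mul_inv, div_le_iff₀ (Real.exp_pos _)] at key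
  refine key.trans ?_
  rw [norm_exp]
  gcongr
  have e1 : (κ + Real.sin ε ^ 2) / Real.sin (2 * ε) * Real.exp ζ.re ^ 2 / 2 =
    M * Real.exp ζ.re ^ 2 := by rw [hM]; ring
  rw [e1]
  exact mul_le_of_le_one_right (by positivity) (Real.sin_le_one _)

/-- In the two thin sectors next to the axes one hypothesis alone gives the exponent (κ +
sin²ε)|z|²/2, and dividing by sin 2ε ≤ 1 only enlarges it. Phragmén–Lindelöf covers the rest. -/
theorem norm_le_of_quadrant {κ ε C : ℝ} {B : ℂ → ℂ} (hκ : 0 ≤ κ) (hκ1 : κ ≤ 1) (hε : 0 < ε)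
    (hε' : ε < Real.pi / 4) (hB : Differentiable ℂ B)
    (h1 : ∀ z, ‖B z‖ ≤ C * Real.exp ((κ * z.re ^ 2 + z.im ^ 2) / 2))
    (h2 : ∀ z, ‖B z‖ ≤ C * Real.exp ((z.re ^ 2 + κ * z.im ^ 2) / 2))
    {z : ℂ} (hre : 0 ≤ z.re) (him : 0 ≤ z.im) :
    ‖B z‖ ≤ C * Real.exp ((κ + Real.sin ε ^ 2) / Real.sin (2 * ε) * ‖z‖ ^ 2 / 2) := by
  have hC : 0 ≤ C := by simpa using (norm_nonneg _).trans (h1 0)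
  have hsin : 0 < Real.sin (2 * ε) := Real.sin_pos_of_pos_of_lt_pi (by linarith) (by linarith)
  have hsε : 0 < Real.sin ε := Real.sin_pos_of_pos_of_lt_pi (by linarith) (by linarith)
  have hδ : κ + Real.sin ε ^ 2 ≤ (κ + Real.sin ε ^ 2) / Real.sin (2 * ε) := by
    rw [le_div_iff₀ hsin]
    exact mul_le_of_le_one_right (by positivity) (Real.sin_le_one _)
  rcases eq_or_ne z 0 with rfl | hz
  · simpa using h1 0
  have ezim : z.im = ‖z‖ * Real.sin z.arg := by rw [Complex.norm_mul_sin_arg]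
  have ezre : z.re = ‖z‖ * Real.cos z.arg := by rw [Complex.norm_mul_cos_arg]
  have ha0 : 0 ≤ z.arg := Complex.arg_nonneg_iff.2 him
  have ha1 : z.arg ≤ Real.pi / 2 := Complex.arg_le_pi_div_two_iff.2 (Or.inl hre)
  rcases le_total z.arg ε with h | h
  · refine (h1 z).trans ?_
    have e1 : z.im ^ 2 ≤ ‖z‖ ^ 2 * Real.sin ε ^ 2 := by
      have : Real.sin z.arg ≤ Real.sin ε :=
        Real.sin_le_sin_of_le_of_le_pi_div_two (by linarith) (by linarith) h
      have h0 : 0 ≤ Real.sin z.arg := Real.sin_nonneg_of_nonneg_of_le_pi ha0 (by linarith)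
      rw [ezim, mul_pow]; gcongr
    have e2 : z.re ^ 2 ≤ ‖z‖ ^ 2 := by rw [norm_sq_eq_re_im]; nlinarith
    gcongr
    nlinarith [mul_le_mul_of_nonneg_left e2 hκ,
      mul_le_mul_of_nonneg_right hδ (sq_nonneg ‖z‖)]
  rcases le_total (Real.pi / 2 - ε) z.arg with h' | h'
  · refine (h2 z).trans ?_
    have e1 : z.re ^ 2 ≤ ‖z‖ ^ 2 * Real.sin ε ^ 2 := by
      have : Real.cos z.arg ≤ Real.sin ε := by
        rw [← Real.cos_pi_div_two_sub]
        exact Real.cos_le_cos_of_nonneg_of_le_pi (by linarith) (by linarith) h'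
      have h0 : 0 ≤ Real.cos z.arg := Real.cos_nonneg_of_mem_Icc ⟨by linarith, ha1⟩
      rw [ezre, mul_pow]; gcongr
    have e2 : z.im ^ 2 ≤ ‖z‖ ^ 2 := by rw [norm_sq_eq_re_im]; nlinarith
    gcongr
    nlinarith [mul_le_mul_of_nonneg_left e2 hκ,
      mul_le_mul_of_nonneg_right hδ (sq_nonneg ‖z‖)]
  · have := norm_le_of_sector hκ hκ1 hε hε' hB h1 h2 (ζ := Complex.log z)
      (by rwa [Complex.log_im]) (by rwa [Complex.log_im])
    rwa [Complex.exp_log hz] at this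

/-- The other quadrants are rotated to the first; multiplication by ±i exchanges the two hypotheses.
With κ = sin²ε the resulting rate is tan ε, which can be made arbitrarily small. -/
theorem gaussianInterpolation_sector {κ ε : ℝ} (hκ : 0 ≤ κ) (hκ1 : κ ≤ 1) (hε : 0 < ε)
    (hε' : ε < Real.pi / 4) :
    GaussianInterpolation κ ((κ + Real.sin ε ^ 2) / Real.sin (2 * ε)) := by
  intro B C hB h1 h2 z
  rcases le_total 0 z.re with hr | hr <;> rcases le_total 0 z.im with hi | hi
  · exact norm_le_of_quadrant hκ hκ1 hε hε' hB h1 h2 hr hi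
  · have := norm_le_of_quadrant (B := fun w => B (-I * w)) (z := I * z) hκ hκ1 hε hε'
      (hB.comp (by fun_prop)) (fun w => by simpa [add_comm] using h2 (-I * w))
      (fun w => by simpa [add_comm] using h1 (-I * w)) (by simpa using hi) (by simpa using hr)
    simpa [← mul_assoc] using this
  · have := norm_le_of_quadrant (B := fun w => B (I * w)) (z := -I * z) hκ hκ1 hε hε'
      (hB.comp (by fun_prop)) (fun w => by simpa [add_comm] using h2 (I * w))
      (fun w => by simpa [add_comm] using h1 (I * w)) (by simpa using hi) (by simpa using hr)
    simpa [← mul_assoc] using this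
  · have := norm_le_of_quadrant (B := fun w => B (-w)) (z := -z) hκ hκ1 hε hε'
      (hB.comp (by fun_prop)) (fun w => by simpa using h1 (-w))
      (fun w => by simpa using h2 (-w)) (by simpa using hr) (by simpa using hi)
    simpa using this

/-! ### Hermite coefficients of functions with Gaussian decay in space and frequency -/

/-- The radial Gaussian is a product over the coordinates, so everything reduces to one-dimensional
integrals. -/
theorem norm_integral_mul_prod_le {n : ℕ} {g : Rn n → ℂ} {C a : ℝ}
    (hg : ∀ᵐ x, ‖g x‖ ≤ C * Real.exp (-a * ‖x‖ ^ 2)) {f : Fin n → ℝ → ℂ}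
    (hf : ∀ j, Integrable fun t => Real.exp (-a * t ^ 2) * ‖f j t‖) :
    ‖∫ x, g x * ∏ j, f j (x j)‖ ≤ C * ∏ j, ∫ t, Real.exp (-a * t ^ 2) * ‖f j t‖ := by
  have h1 := integrable_prod_coord (f := fun j t => ((Real.exp (-a * t ^ 2) * ‖f j t‖ : ℝ) : ℂ))
    fun j => (hf j).ofReal
  have h2 := integral_prod_coord (fun j t => ((Real.exp (-a * t ^ 2) * ‖f j t‖ : ℝ) : ℂ))
  simp_rw [← ofReal_prod, integral_complex_ofReal, ← ofReal_prod] at h2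
  have h3 : Integrable fun x : Rn n => ∏ j, (Real.exp (-a * x j ^ 2) * ‖f j (x j)‖) := by
    refine h1.norm.congr (Filter.Eventually.of_forall fun x => ?_)
    simp only [← ofReal_prod, norm_real]
    exact Real.norm_of_nonneg (Finset.prod_nonneg fun j _ => by positivity)
  rw [← ofReal_injective h2, ← integral_const_mul]
  refine norm_integral_le_of_norm_le (h3.const_mul C) ?_
  filter_upwards [hg] with x hx
  rw [norm_mul, norm_prod, Finset.prod_mul_distrib, prod_exp_neg_mul_sq, ← mul_assoc]
  gcongr

/-- Completing the square in t leaves (Re z)²(1/(1+2a) - 1/2), which is the source of κ =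
(1-2a)/(1+2a). The growth improves in the real direction only. -/
theorem exp_mul_norm_hermiteGen_le {a : ℝ} (ha : 0 < a) (z : ℂ) (t : ℝ) :
    Real.exp (-a * t ^ 2) * ‖hermiteGen z t‖ ≤
      Real.exp (((1 - 2 * a) / (1 + 2 * a) * z.re ^ 2 + z.im ^ 2) / 2) *
      Real.exp (-(a + 1 / 2) * (t - Real.sqrt 2 * z.re / (2 * a + 1)) ^ 2) := by
  rw [norm_hermiteGen, mul_left_comm]
  refine (mul_le_of_le_one_left (by positivity) inv_sqrt_sqrt_pi_le_one).trans (le_of_eq ?_)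
  rw [← Real.exp_add, ← Real.exp_add]
  congr 1
  have h2 : Real.sqrt 2 ^ 2 = 2 := Real.sq_sqrt (by norm_num)
  have : (t - Real.sqrt 2 * z.re / (2 * a + 1)) ^ 2 = t ^ 2 - 2 * (Real.sqrt 2 * t * z.re) /
      (2 * a + 1) + Real.sqrt 2 ^ 2 * z.re ^ 2 / (2 * a + 1) ^ 2 := by
    rw [sub_sq, div_pow, mul_pow]; ring
  rw [this, h2]
  have h3 : 1 + 2 * a ≠ 0 := by positivity
  have h4 : 2 * a + 1 ≠ 0 := by positivity
  field_simp
  ring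

theorem integrable_exp_mul_norm_hermiteGen {a : ℝ} (ha : 0 < a) (z : ℂ) :
    Integrable fun t => Real.exp (-a * t ^ 2) * ‖hermiteGen z t‖ := by
  refine (((integrable_exp_neg_mul_sq (b := a + 1 / 2) (by positivity)).comp_sub_right
    (Real.sqrt 2 * z.re / (2 * a + 1))).const_mul
    (Real.exp (((1 - 2 * a) / (1 + 2 * a) * z.re ^ 2 + z.im ^ 2) / 2))).mono' ?_
    (Filter.Eventually.of_forall fun t => ?_)
  · exact (Continuous.mul (by fun_prop) (continuous_hermiteGen z).norm).aestronglyMeasurable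
  · rw [Real.norm_of_nonneg (by positivity)]
    exact exp_mul_norm_hermiteGen_le ha z t

theorem integral_exp_mul_norm_hermiteGen_le {a : ℝ} (ha : 0 < a) (z : ℂ) :
    ∫ t, Real.exp (-a * t ^ 2) * ‖hermiteGen z t‖ ≤
      (∫ t : ℝ, Real.exp (-(a + 1 / 2) * t ^ 2)) *
      Real.exp (((1 - 2 * a) / (1 + 2 * a) * z.re ^ 2 + z.im ^ 2) / 2) := by
  have h := integral_mono (integrable_exp_mul_norm_hermiteGen ha z)
    (((integrable_exp_neg_mul_sq (b := a + 1 / 2) (by positivity)).comp_sub_right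
    (Real.sqrt 2 * z.re / (2 * a + 1))).const_mul _) (exp_mul_norm_hermiteGen_le ha z)
  refine h.trans (le_of_eq ?_)
  rw [integral_const_mul, integral_sub_right_eq_self
    (fun t : ℝ => Real.exp (-(a + 1 / 2) * t ^ 2)), mul_comm]

theorem integrable_exp_mul_abs_hermiteFun {a : ℝ} (ha : 0 < a) (k : ℕ) :
    Integrable fun t => Real.exp (-a * t ^ 2) * ‖(hermiteFun k t : ℂ)‖ := by
  refine ((integrable_exp_neg_mul_sq ha).mul_const (2 * (k + 1) * Real.exp k)).mono' ?_
    (Filter.Eventually.of_forall fun t => ?_)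
  · exact (Continuous.mul (by fun_prop)
      (continuous_ofReal.comp (continuous_hermiteFun k)).norm).aestronglyMeasurable
  · rw [Real.norm_of_nonneg (by positivity), norm_real, Real.norm_eq_abs]
    gcongr
    refine (abs_hermiteFun_le_quarter k t).trans (mul_le_of_le_one_right (by positivity) ?_)
    rw [Real.exp_le_one_iff]
    nlinarith [sq_nonneg t]

/-- From 2xy ≤ x² + y² and the normalisation of the Hermite functions; the point is a bound uniform
in k. -/
theorem integral_exp_mul_abs_hermiteFun_le {a : ℝ} (ha : 0 < a) (k : ℕ) :
    ∫ t, Real.exp (-a * t ^ 2) * ‖(hermiteFun k t : ℂ)‖ ≤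
      (∫ t : ℝ, Real.exp (-(2 * a) * t ^ 2)) + 1 := by
  have h1 : ∫ t, hermiteFun k t ^ 2 = 1 := by
    have := integral_hermiteFun_mul_hermiteFun k k
    simp_rw [← ofReal_mul, integral_complex_ofReal, ← pow_two] at this
    simpa using this
  have h2 : Integrable fun t : ℝ => Real.exp (-(2 * a) * t ^ 2) :=
    integrable_exp_neg_mul_sq (by positivity)
  rw [← h1, ← integral_add h2 (integrable_hermiteFun_sq k)]
  refine integral_mono (integrable_exp_mul_abs_hermiteFun ha k)
    (h2.add (integrable_hermiteFun_sq k)) fun t => ?_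
  have e : Real.exp (-(2 * a) * t ^ 2) = Real.exp (-a * t ^ 2) ^ 2 := by
    rw [← Real.exp_nat_mul]; congr 1; push_cast; ring
  simp only [norm_real, Real.norm_eq_abs]
  rw [e, ← sq_abs (hermiteFun k t)]
  nlinarith [sq_nonneg (Real.exp (-a * t ^ 2) - |hermiteFun k t|),
    mul_nonneg (Real.exp_pos (-a * t ^ 2)).le (abs_nonneg (hermiteFun k t))]

theorem integrable_hermiteFun (k : ℕ) : Integrable (fun t => (hermiteFun k t : ℂ)) := by
  refine ((integrable_exp_neg_mul_sq (b := 1 / 4) (by norm_num)).const_mul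
    (2 * (k + 1) * Real.exp k)).mono'
    (continuous_ofReal.comp (continuous_hermiteFun k)).aestronglyMeasurable
    (Filter.Eventually.of_forall fun t => ?_)
  rw [norm_real, Real.norm_eq_abs]
  exact abs_hermiteFun_le_quarter k t

theorem integrable_hermiteGen (z : ℂ) : Integrable (hermiteGen z) := by
  refine ((integrable_exp_neg_mul_sq (b := 1 / 4) (by norm_num)).mul_const
    (Real.exp ((1 + 2 * 1) * ‖z‖ ^ 2 / 2))).mono'
    (continuous_hermiteGen z).aestronglyMeasurable
    (Filter.Eventually.of_forall fun t => ?_)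
  have h1 := norm_hermiteGen_le one_pos z t
  have e : (1 : ℝ) / (2 * (1 + 1)) = 1 / 4 := by norm_num
  rwa [e] at h1

/-- The product of the `h_{α_i}`, `i ≠ j`, with the generating function in the variable `j`. -/
def mixedFactor {n : ℕ} (j : Fin n) (α : Fin n → ℕ) (z : ℂ) (i : Fin n) (t : ℝ) : ℂ :=
  if i = j then hermiteGen z t else (hermiteFun (α i) t : ℂ)

theorem integrable_mixedFactor {n : ℕ} (j : Fin n) (α : Fin n → ℕ) (z : ℂ) (i : Fin n) :
    Integrable (mixedFactor j α z i) := by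
  unfold mixedFactor
  split_ifs
  · exact integrable_hermiteGen z
  · exact integrable_hermiteFun _

theorem integrable_of_gaussian_bound {n : ℕ} {g : Rn n → ℂ} {C a : ℝ} (ha : 0 < a)
    (hgm : AEStronglyMeasurable g volume)
    (hg : ∀ᵐ x, ‖g x‖ ≤ C * Real.exp (-a * ‖x‖ ^ 2)) : Integrable g :=
  ((integrable_gaussian ha).const_mul C).mono' hgm hg

/-- The constant in the estimate of `∫ g · ∏ mixedFactor`. -/
def coeffConst (n : ℕ) (a : ℝ) : ℝ :=
  ((∫ t : ℝ, Real.exp (-(2 * a) * t ^ 2)) + 1 + ∫ t : ℝ, Real.exp (-(a + 1 / 2) * t ^ 2)) ^ n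

theorem coeffConst_nonneg (n : ℕ) (a : ℝ) : 0 ≤ coeffConst n a := by
  have h1 : 0 ≤ ∫ t : ℝ, Real.exp (-(2 * a) * t ^ 2) := integral_nonneg fun t => by positivity
  have h2 : 0 ≤ ∫ t : ℝ, Real.exp (-(a + 1 / 2) * t ^ 2) := integral_nonneg fun t => by positivity
  unfold coeffConst
  positivity

/-- Only coordinate `j` depends on z; every other coordinate contributes a constant independent of
α. -/
theorem norm_integral_mul_mixedFactor_le {n : ℕ} {g : Rn n → ℂ} {C a : ℝ} (ha : 0 < a)
    (hC : 0 ≤ C) (hg : ∀ᵐ x, ‖g x‖ ≤ C * Real.exp (-a * ‖x‖ ^ 2)) (j : Fin n) (α : Fin n → ℕ)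
    (z : ℂ) :
    ‖∫ x, g x * ∏ i, mixedFactor j α z i (x i)‖ ≤ C * coeffConst n a *
      Real.exp (((1 - 2 * a) / (1 + 2 * a) * z.re ^ 2 + z.im ^ 2) / 2) := by
  refine (norm_integral_mul_prod_le hg fun i => ?_).trans ?_
  · unfold mixedFactor
    split_ifs
    · exact integrable_exp_mul_norm_hermiteGen ha z
    · exact integrable_exp_mul_abs_hermiteFun ha _
  have h1 : 0 ≤ ∫ t : ℝ, Real.exp (-(2 * a) * t ^ 2) := integral_nonneg fun t => by positivity
  have h2 : 0 ≤ ∫ t : ℝ, Real.exp (-(a + 1 / 2) * t ^ 2) := integral_nonneg fun t => by positivity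
  have h3 : ∏ i, ∫ t, Real.exp (-a * t ^ 2) * ‖mixedFactor j α z i t‖ ≤
      ∏ i : Fin n, (((∫ t : ℝ, Real.exp (-(2 * a) * t ^ 2)) + 1 +
        ∫ t : ℝ, Real.exp (-(a + 1 / 2) * t ^ 2)) *
        if i = j then Real.exp (((1 - 2 * a) / (1 + 2 * a) * z.re ^ 2 + z.im ^ 2) / 2) else 1) := by
    refine Finset.prod_le_prod (fun i _ => integral_nonneg fun t => by positivity) fun i _ => ?_
    unfold mixedFactor
    split_ifs with h
    · refine (integral_exp_mul_norm_hermiteGen_le ha z).trans ?_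
      gcongr
      linarith
    · rw [mul_one]
      exact (integral_exp_mul_abs_hermiteFun_le ha _).trans (by linarith)
  rw [Finset.prod_mul_distrib, Finset.prod_const, Finset.card_univ, Fintype.card_fin,
    Finset.prod_ite_eq' Finset.univ j, if_pos (Finset.mem_univ j)] at h3
  rw [mul_assoc]
  exact mul_le_mul_of_nonneg_left h3 hC

theorem ft_mixedFactor {n : ℕ} (j : Fin n) (α : Fin n → ℕ) (z : ℂ) (p : Rn n) :
    ft (fun x => ∏ i, mixedFactor j α z i (x i)) p =
      (∏ i, (Real.sqrt (2 * Real.pi) : ℂ) * (if i = j then 1 else (-I) ^ α i)) *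
        ∏ i, mixedFactor j α (-I * z) i (p i) := by
  rw [ft_prod_coord, ← Finset.prod_mul_distrib]
  refine Finset.prod_congr rfl fun i _ => ?_
  unfold mixedFactor
  split_ifs
  · rw [integral_hermiteGen_mul_cexp, mul_one]
  · rw [integral_hermiteFun_mul_cexp]

/-- B is the Bargmann transform of g in the variable `j`, the other variables being paired with
fixed Hermite functions. Its Taylor coefficients are the Hermite coefficients divided by √(α_j)!.
Space decay and frequency decay supply the two hypotheses of the interpolation, and Cauchy's
estimate concludes. -/
theorem norm_hermite_coeff_le {n : ℕ} {g : Rn n → ℂ} {C a δ : ℝ} (ha : 0 < a)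
    (hδ : 0 < δ) (hint : GaussianInterpolation ((1 - 2 * a) / (1 + 2 * a)) δ) (hC : 0 ≤ C)
    (hgm : AEStronglyMeasurable g volume)
    (hg : ∀ᵐ x, ‖g x‖ ≤ C * Real.exp (-a * ‖x‖ ^ 2))
    (hg' : ∀ᵐ p, ‖ft g p‖ ≤ C * Real.exp (-a * ‖p‖ ^ 2)) (α : Fin n → ℕ) (j : Fin n) :
    ‖∫ x, g x * ∏ i, (hermiteFun (α i) (x i) : ℂ)‖ ≤
      2 * (C * coeffConst n a) * (α j + 1) * Real.sqrt δ ^ α j := by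
  classical
  have hgi := integrable_of_gaussian_bound ha hgm hg
  set B : ℂ → ℂ := fun z => ∫ x, g x * ∏ i, mixedFactor j α z i (x i) with hB
  have hprod : ∀ (z : ℂ) (x : Rn n), ∏ i, mixedFactor j α z i (x i) =
      (∏ i ∈ Finset.univ.erase j, (hermiteFun (α i) (x i) : ℂ)) * hermiteGen z (x j) := by
    intro z x
    rw [← Finset.mul_prod_erase Finset.univ _ (Finset.mem_univ j), mixedFactor, if_pos rfl, mul_comm]
    congr 1
    refine Finset.prod_congr rfl fun i hi => ?_
    rw [mixedFactor, if_neg (Finset.ne_of_mem_erase hi)]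
  set w : Rn n → ℂ := fun x => g x * ∏ i ∈ Finset.univ.erase j, (hermiteFun (α i) (x i) : ℂ) with hw
  have hpc : Continuous fun x : Rn n => ∏ i ∈ Finset.univ.erase j, (hermiteFun (α i) (x i) : ℂ) :=
    continuous_finsetProd _ fun i _ =>
      continuous_ofReal.comp ((continuous_hermiteFun _).comp (by fun_prop))
  have hwi : Integrable w := by
    refine hgi.mul_bdd (c := ∏ i ∈ Finset.univ.erase j, (2 * (α i + 1) * Real.exp (α i)))
      hpc.aestronglyMeasurable (Filter.Eventually.of_forall fun x => ?_)
    rw [norm_prod]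
    refine Finset.prod_le_prod (fun _ _ => norm_nonneg _) fun i _ => ?_
    rw [norm_real, Real.norm_eq_abs]
    refine (abs_hermiteFun_le_quarter _ _).trans (mul_le_of_le_one_right (by positivity) ?_)
    rw [Real.exp_le_one_iff]
    nlinarith [sq_nonneg (x i)]
  have hs : ∀ z, HasSum _ _ := hasSum_integral_hermiteFun hwi.aestronglyMeasurable
    (y := fun x : Rn n => x j) (by fun_prop)
    (hwi.mul_bdd (c := 1) (Continuous.aestronglyMeasurable (by fun_prop))
      (Filter.Eventually.of_forall fun x => by
        rw [norm_real, Real.norm_of_nonneg (by positivity), Real.exp_le_one_iff]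
        nlinarith [sq_nonneg (x j)]))
  have hBeq : ∀ z, ∫ x, w x * hermiteGen z (x j) = B z := by
    intro z
    rw [hB]
    simp_rw [hprod, hw, mul_assoc]
  simp_rw [hBeq] at hs
  have hb1 := norm_integral_mul_mixedFactor_le ha hC hg j α
  have hb2 : ∀ z, ‖B z‖ ≤ C * coeffConst n a *
      Real.exp ((z.re ^ 2 + (1 - 2 * a) / (1 + 2 * a) * z.im ^ 2) / 2) := by
    intro z
    -- The bound for the transform of g, at the parameter iz. The multiplication formula moves the
    -- transform to the Hermite side, where it rotates iz back to z; thus Re and Im change places.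
    have h1 := norm_integral_mul_mixedFactor_le ha hC hg' j α (I * z)
    rw [integral_ft_mul hgi (integrable_prod_coord (integrable_mixedFactor j α (I * z)))] at h1
    simp_rw [ft_mixedFactor, mul_left_comm (g _), integral_const_mul] at h1
    rw [← mul_assoc, norm_mul, norm_prod] at h1
    have e1 : -I * I * z = z := by simp
    -- The Fourier eigenvalues have modulus √(2π) ≥ 1 and can be dropped from the left-hand side.
    have e2 : (1 : ℝ) ≤ ∏ i, ‖(Real.sqrt (2 * Real.pi) : ℂ) * (if i = j then 1 else (-I) ^ α i)‖ := by
      have : ∀ i, ‖(Real.sqrt (2 * Real.pi) : ℂ) * (if i = j then 1 else (-I) ^ α i)‖ =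
          Real.sqrt (2 * Real.pi) := by
        intro i
        rw [norm_mul, norm_real, Real.norm_of_nonneg (by positivity)]
        split_ifs <;> simp
      simp_rw [this, Finset.prod_const]
      refine one_le_pow₀ ?_
      rw [Real.one_le_sqrt]
      linarith [Real.pi_gt_three]
    rw [e1] at h1
    have h2 := (le_mul_of_one_le_left (norm_nonneg _) e2).trans h1
    simpa [add_comm] using h2
  have hb3 := hint B _ (differentiable_of_hasSum hs) hb1 hb2
  have h4 := norm_coeff_mul_sqrt_factorial_le hs hδ hb3 (α j)
  have hpos : 0 < Real.sqrt (α j).factorial := Real.sqrt_pos.2 (by positivity)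
  have e3 : ∫ x, w x * (hermiteFun (α j) (x j) : ℂ) =
      ∫ x, g x * ∏ i, (hermiteFun (α i) (x i) : ℂ) := by
    congr 1; funext x
    rw [hw, mul_assoc, ← Finset.mul_prod_erase Finset.univ
      (fun i => (hermiteFun (α i) (x i) : ℂ)) (Finset.mem_univ j), mul_comm (hermiteFun _ _ : ℂ)]
  rw [e3, norm_mul, norm_real, norm_inv, Real.norm_of_nonneg hpos.le] at h4
  refine le_trans (le_of_eq ?_) h4
  field_simp

/-! ### Summability over multi-indices -/

/-- A finite set of multi-indices lies in a box, over which the sum factorises. -/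
theorem summable_prod_multiIndex {n : ℕ} {f : Fin n → ℕ → ℝ} (h0 : ∀ j k, 0 ≤ f j k)
    (hf : ∀ j, Summable (f j)) : Summable fun α : Fin n → ℕ => ∏ j, f j (α j) := by
  classical
  refine summable_of_sum_le (c := ∏ j, ∑' k, f j k)
    (fun α => Finset.prod_nonneg fun j _ => h0 j _) fun u => ?_
  set N : Fin n → Finset ℕ := fun j => u.image fun α => α j with hN
  calc ∑ α ∈ u, ∏ j, f j (α j) ≤ ∑ α ∈ Fintype.piFinset N, ∏ j, f j (α j) := by
        refine Finset.sum_le_sum_of_subset_of_nonneg (fun α hα => ?_)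
          fun α _ _ => Finset.prod_nonneg fun j _ => h0 j _
        rw [Fintype.mem_piFinset]
        exact fun j => Finset.mem_image_of_mem _ hα
    _ = ∏ j, ∑ k ∈ N j, f j k := (Finset.prod_univ_sum N f).symm
    _ ≤ _ := Finset.prod_le_prod (fun j _ => Finset.sum_nonneg fun k _ => h0 j k)
        fun j _ => (hf j).sum_le_tsum _ fun k _ => h0 j k

theorem summable_succ_mul_geometric {r : ℝ} (h0 : 0 ≤ r) (h1 : r < 1) :
    Summable fun k : ℕ => ((k : ℝ) + 1) * r ^ k := by
  have h := summable_pow_mul_geometric_of_norm_lt_one 1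
    (show ‖r‖ < 1 by rwa [Real.norm_of_nonneg h0])
  refine (h.add (summable_geometric_of_lt_one h0 h1)).congr fun k => ?_
  simp; ring

theorem summable_multiIndex_geometric (n : ℕ) {r : ℝ} (h0 : 0 ≤ r) (h1 : r < 1) :
    Summable fun α : Fin n → ℕ => ∏ j, (((α j : ℝ) + 1) * r ^ α j) :=
  summable_prod_multiIndex (f := fun _ k => ((k : ℝ) + 1) * r ^ k) (fun _ _ => by positivity)
    fun _ => summable_succ_mul_geometric h0 h1

/-! ### The spaces `E_t` -/

theorem norm_hermiteL2 {n : ℕ} {lam : ℝ} (hlam : lam ≠ 0) (α : Fin n → ℕ) :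
    ‖hermiteL2 hlam α‖ = 1 := (orthonormal_hermiteL2 hlam).1 α

theorem summable_smul_hermiteL2 {n : ℕ} {lam : ℝ} (hlam : lam ≠ 0) {d : (Fin n → ℕ) → ℂ}
    (hd : Summable fun α => ‖d α‖) : Summable fun α => d α • hermiteL2 hlam α :=
  Summable.of_norm (by simpa [norm_smul, norm_hermiteL2] using hd)

theorem inner_tsum_hermiteL2 {n : ℕ} {lam : ℝ} (hlam : lam ≠ 0) {d : (Fin n → ℕ) → ℂ}
    (hd : Summable fun α => ‖d α‖) (β : Fin n → ℕ) :
    inner ℂ (hermiteL2 hlam β) (∑' α, d α • hermiteL2 hlam α) = d β := by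
  classical
  have h1 := ((summable_smul_hermiteL2 hlam hd).hasSum.mapL
    (innerSL ℂ (hermiteL2 hlam β))).tsum_eq
  simp only [innerSL_apply_apply, inner_smul_right,
    orthonormal_iff_ite.1 (orthonormal_hermiteL2 hlam)] at h1
  rw [← h1]
  simp

/-- The preimage is e^{tH(λ)}g, defined by its Hermite coefficients, which the hypothesis makes
summable. -/
theorem mem_spaceE_of_summable {n : ℕ} {lam t : ℝ} (hlam : lam ≠ 0) (ht : 0 < t) {g : L2Rn n}
    (h : Summable fun α : Fin n → ℕ => Real.exp (t * ((2 * ∑ j, (α j : ℝ) + n) * |lam|)) *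
      ‖inner ℂ (hermiteL2 hlam α) g‖) : g ∈ spaceE n hlam t := by
  set d : (Fin n → ℕ) → ℂ := fun α =>
    (Real.exp (t * ((2 * ∑ j, (α j : ℝ) + n) * |lam|)) : ℂ) * inner ℂ (hermiteL2 hlam α) g with hd
  have hds : Summable fun α => ‖d α‖ := by
    refine h.congr fun α => ?_
    rw [hd, norm_mul, norm_real, Real.norm_of_nonneg (by positivity)]
  refine ⟨∑' α, d α • hermiteL2 hlam α, ?_⟩
  rw [hermiteSemigroup]
  have e : ∀ α : Fin n → ℕ, (Real.exp (-t * ((2 * ∑ j, (α j : ℝ) + n) * |lam|)) : ℂ) *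
      inner ℂ (hermiteL2 hlam α) (∑' α, d α • hermiteL2 hlam α) =
      inner ℂ (hermiteL2 hlam α) g := by
    intro α
    rw [inner_tsum_hermiteL2 hlam hds, hd, ← mul_assoc, ← ofReal_mul, ← Real.exp_add]
    simp
  simp_rw [e]
  refine hasSum_hermiteL2 hlam (summable_smul_hermiteL2 hlam ?_)
  refine h.of_nonneg_of_le (fun α => norm_nonneg _) fun α => ?_
  refine le_mul_of_one_le_left (norm_nonneg _) ?_
  rw [Real.one_le_exp_iff]
  positivity

/-- The coefficient bound sees one coordinate at a time. Used for the largest entry, n·α_j ≥ |α|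
turns (r^n)^{α_j} into at most r^{|α|}; this loss is why the base is written as r^n. -/
theorem mem_spaceE_of_bound {n : ℕ} {lam t r D : ℝ} (hlam : lam ≠ 0) (ht : 0 < t) (hr : 0 ≤ r)
    (hrt : r * Real.exp (2 * t * |lam|) < 1) (hD : 0 ≤ D) {g : L2Rn n}
    (h : ∀ (α : Fin n → ℕ) (j : Fin n),
      ‖inner ℂ (hermiteL2 hlam α) g‖ ≤ D * (α j + 1) * (r ^ n) ^ α j) :
    g ∈ spaceE n hlam t := by
  have hr1 : r ≤ 1 := by
    have : (1 : ℝ) ≤ Real.exp (2 * t * |lam|) := by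
      rw [Real.one_le_exp_iff]; positivity
    nlinarith
  have h1 : ∀ α : Fin n → ℕ, ‖inner ℂ (hermiteL2 hlam α) g‖ ≤
      (D + ‖g‖) * ∏ j, (((α j : ℝ) + 1) * r ^ α j) := by
    intro α
    -- For n = 0 there is no `j` and the hypothesis is empty; the summand ‖g‖ of the constant covers
    -- this case.
    rcases Nat.eq_zero_or_pos n with rfl | hn
    · have := norm_inner_le_norm (𝕜 := ℂ) (hermiteL2 hlam α) g
      rw [norm_hermiteL2, one_mul] at this
      simp
      linarith
    · have : Nonempty (Fin n) := ⟨⟨0, hn⟩⟩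
      obtain ⟨j, hj⟩ := Finite.exists_max α
      have e1 : (r ^ n) ^ α j ≤ ∏ i, r ^ α i := by
        rw [Finset.prod_pow_eq_pow_sum, ← pow_mul]
        refine pow_le_pow_of_le_one hr hr1 ?_
        calc ∑ i, α i ≤ ∑ _i : Fin n, α j := Finset.sum_le_sum fun i _ => hj i
          _ = n * α j := by simp
      have e2 : (α j : ℝ) + 1 ≤ ∏ i, ((α i : ℝ) + 1) := by
        rw [← Finset.mul_prod_erase Finset.univ _ (Finset.mem_univ j)]
        refine le_mul_of_one_le_right (by positivity) ?_
        exact Finset.one_le_prod (fun i => by simp)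
      rw [Finset.prod_mul_distrib]
      calc _ ≤ _ := h α j
        _ ≤ D * (∏ i, ((α i : ℝ) + 1)) * ∏ i, r ^ α i := by gcongr
        _ ≤ (D + ‖g‖) * (∏ i, ((α i : ℝ) + 1)) * ∏ i, r ^ α i := by
          gcongr
          linarith [norm_nonneg g]
        _ = _ := by ring
  refine mem_spaceE_of_summable hlam ht ?_
  have h2 := (summable_multiIndex_geometric n (r := r * Real.exp (2 * t * |lam|))
    (by positivity) hrt).mul_left (Real.exp (t * (n * |lam|)) * (D + ‖g‖))
  refine h2.of_nonneg_of_le (fun α => by positivity) fun α => ?_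
  have e3 : Real.exp (t * ((2 * ∑ j, (α j : ℝ) + n) * |lam|)) =
      Real.exp (t * (n * |lam|)) * ∏ j, Real.exp (2 * t * |lam|) ^ α j := by
    simp_rw [← Real.exp_nat_mul, ← Real.exp_sum, ← Real.exp_add, ← Finset.sum_mul]
    congr 1; ring
  rw [e3]
  calc _ ≤ Real.exp (t * (n * |lam|)) * (∏ j, Real.exp (2 * t * |lam|) ^ α j) *
        ((D + ‖g‖) * ∏ j, (((α j : ℝ) + 1) * r ^ α j)) := by gcongr; exact h1 α
    _ = _ := by
      rw [mul_mul_mul_comm, ← Finset.prod_mul_distrib]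
      congr 2
      funext j
      rw [mul_pow]; ring

/-- Hermite coefficients of a function with Gaussian decay in space and frequency. -/
theorem norm_scaled_hermite_coeff_le (n : ℕ) {lam a : ℝ} (hlam : lam ≠ 0) (ha : 0 < a) :
    ∃ D : ℝ, 0 ≤ D ∧ ∀ (δ : ℝ), 0 < δ → GaussianInterpolation ((1 - 2 * a) / (1 + 2 * a)) δ →
      ∀ (g : Rn n → ℂ) (C : ℝ), 0 ≤ C → AEStronglyMeasurable g volume →
      (∀ᵐ x, ‖g x‖ ≤ C * Real.exp (-(a * |lam|) * ‖x‖ ^ 2)) →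
      (∀ᵐ p, ‖ft g p‖ ≤ C * Real.exp (-(a / |lam|) * ‖p‖ ^ 2)) → ∀ (α : Fin n → ℕ) (j : Fin n),
      ‖∫ x, g x * hermiteFunN lam α x‖ ≤ C * D * (α j + 1) * Real.sqrt δ ^ α j := by
  have hl : 0 < |lam| := abs_pos.2 hlam
  set s := Real.sqrt |lam| with hs
  have hs0 : 0 < s := Real.sqrt_pos.2 hl
  have hs2 : s ^ 2 = |lam| := Real.sq_sqrt hl.le
  -- The constant precedes g, C and δ, so that it is uniform in the vector to which π_λ(f) is
  -- applied.
  refine ⟨|lam| ^ ((n : ℝ) / 4) * (s ^ n)⁻¹ * 2 * (1 + s ^ n) * coeffConst n a, ?_, ?_⟩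
  · have := coeffConst_nonneg n a
    positivity
  intro δ hδ hint g C hC hgm hg hg' α j
  have hqm : Measure.QuasiMeasurePreserving (fun x : Rn n => s⁻¹ • x) volume volume :=
    ⟨by fun_prop, by
      rw [Measure.map_addHaar_smul _ (by positivity)]
      exact Measure.smul_absolutelyContinuous⟩
  have hqm' : Measure.QuasiMeasurePreserving (fun x : Rn n => s • x) volume volume :=
    ⟨by fun_prop, by
      rw [Measure.map_addHaar_smul _ (by positivity)]
      exact Measure.smul_absolutelyContinuous⟩
  have hft : ∀ p, ft (fun x => g (s⁻¹ • x)) p = ((s ^ n : ℝ) : ℂ) * ft g (s • p) := by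
    intro p
    have h4 := Measure.integral_comp_smul (volume : Measure (Rn n))
      (fun v => g v * cexp (-(I * ((inner ℝ (s • p) v : ℝ) : ℂ)))) s⁻¹
    rw [finrank_euclideanSpace_fin, inv_pow, inv_inv, abs_of_pos (by positivity), real_smul] at h4
    rw [ft, ft, ← h4]
    congr 1; funext v
    rw [inner_smul_left, inner_smul_right]
    congr 4
    have : (s : ℂ) ≠ 0 := by exact_mod_cast hs0.ne'
    simp
    field_simp
  -- Dilation by √|λ| reduces to λ = 1. The transform of the dilate gains the factor s^n; 1 + s^n
  -- serves both bounds.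
  have h1 := norm_hermite_coeff_le (g := fun x => g (s⁻¹ • x)) (C := C * (1 + s ^ n)) ha hδ hint
    (by positivity) (hgm.comp_quasiMeasurePreserving hqm) (by
      filter_upwards [hqm.ae hg] with x hx
      refine hx.trans ?_
      rw [norm_smul, Real.norm_of_nonneg (by positivity), mul_pow, inv_pow, hs2]
      have e : -(a * |lam|) * (|lam|⁻¹ * ‖x‖ ^ 2) = -a * ‖x‖ ^ 2 := by field_simp
      rw [e]
      gcongr
      refine le_mul_of_one_le_right hC ?_
      have : 0 < s ^ n := by positivity
      linarith) (by
      filter_upwards [hqm'.ae hg'] with p hp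
      rw [hft, norm_mul, norm_real, Real.norm_of_nonneg (by positivity)]
      rw [norm_smul, Real.norm_of_nonneg (by positivity), mul_pow, hs2] at hp
      have e : -(a / |lam|) * (|lam| * ‖p‖ ^ 2) = -a * ‖p‖ ^ 2 := by field_simp
      rw [e] at hp
      calc _ ≤ s ^ n * (C * Real.exp (-a * ‖p‖ ^ 2)) := by gcongr
        _ = C * s ^ n * Real.exp (-a * ‖p‖ ^ 2) := by ring
        _ ≤ _ := by gcongr; linarith) α j
  have h5 := Measure.integral_comp_smul (volume : Measure (Rn n))
    (fun v => g (s⁻¹ • v) * ∏ i, (hermiteFun (α i) (v i) : ℂ)) s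
  rw [finrank_euclideanSpace_fin, abs_of_pos (by positivity), real_smul] at h5
  have h6 : ∫ x, g x * hermiteFunN lam α x = ((|lam| ^ ((n : ℝ) / 4) : ℝ) : ℂ) *
      ((((s ^ n)⁻¹ : ℝ) : ℂ) * ∫ v, g (s⁻¹ • v) * ∏ i, (hermiteFun (α i) (v i) : ℂ)) := by
    rw [← h5, ← integral_const_mul]
    congr 1; funext x
    rw [hermiteFunN_eq, smul_smul, inv_mul_cancel₀ hs0.ne', one_smul, mul_left_comm]
    simp [hs]
  rw [h6, norm_mul, norm_mul, norm_real, norm_real, Real.norm_of_nonneg (by positivity),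
    Real.norm_of_nonneg (by positivity)]
  calc _ ≤ |lam| ^ ((n : ℝ) / 4) * ((s ^ n)⁻¹ *
        (2 * (C * (1 + s ^ n) * coeffConst n a) * (α j + 1) * Real.sqrt δ ^ α j)) := by gcongr
    _ = _ := by ring

/-! ### Gaussian decay of the elements of `E_t` -/

theorem norm_hermiteFunN_le {n : ℕ} {lam ε : ℝ} (hε : 0 < ε) (α : Fin n → ℕ) (x : Rn n) :
    ‖hermiteFunN lam α x‖ ≤ |lam| ^ ((n : ℝ) / 4) * 2 ^ n *
      (∏ j, (((α j : ℝ) + 1) * Real.exp ε ^ α j)) *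
        Real.exp (-(ε / (2 * (1 + ε)) * |lam|) * ‖x‖ ^ 2) := by
  rw [hermiteFunN_eq, norm_mul, norm_real, Real.norm_of_nonneg (by positivity), norm_prod,
    ← prod_exp_neg_mul_sq]
  have h : ∀ j, ‖(hermiteFun (α j) (Real.sqrt |lam| * x j) : ℂ)‖ ≤
      2 * (((α j : ℝ) + 1) * Real.exp ε ^ α j) *
        Real.exp (-(ε / (2 * (1 + ε)) * |lam|) * x j ^ 2) := by
    intro j
    rw [norm_real, Real.norm_eq_abs]
    refine (abs_hermiteFun_le hε _ _).trans (le_of_eq ?_)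
    rw [mul_pow, Real.sq_sqrt (abs_nonneg _), ← Real.exp_nat_mul, mul_comm ε (α j : ℝ)]
    ring_nf
  calc _ ≤ |lam| ^ ((n : ℝ) / 4) * ∏ j, (2 * (((α j : ℝ) + 1) * Real.exp ε ^ α j) *
        Real.exp (-(ε / (2 * (1 + ε)) * |lam|) * x j ^ 2)) := by
        gcongr with j
        exact h j
    _ = _ := by
      rw [Finset.prod_mul_distrib, Finset.prod_mul_distrib]
      simp only [Finset.prod_const, Finset.card_univ, Fintype.card_fin]
      ring

theorem ft_hermiteFunN {n : ℕ} {lam : ℝ} (hlam : lam ≠ 0) (α : Fin n → ℕ) (p : Rn n) :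
    ft (hermiteFunN lam α) p = (|lam| ^ ((n : ℝ) / 4) : ℝ) *
      ∏ j, ((((Real.sqrt |lam|)⁻¹ * Real.sqrt (2 * Real.pi) : ℝ) : ℂ) * (-I) ^ α j *
        hermiteFun (α j) ((Real.sqrt |lam|)⁻¹ * p j)) := by
  have h0 : 0 < Real.sqrt |lam| := Real.sqrt_pos.2 (abs_pos.2 hlam)
  have e : ft (hermiteFunN lam α) p = (|lam| ^ ((n : ℝ) / 4) : ℝ) *
      ft (fun x => ∏ j, (hermiteFun (α j) (Real.sqrt |lam| * x j) : ℂ)) p := by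
    rw [ft, ft, ← integral_const_mul]
    congr 1; funext x
    rw [hermiteFunN_eq]; ring
  rw [e, ft_prod_coord (fun j t => (hermiteFun (α j) (Real.sqrt |lam| * t) : ℂ))]
  congr 1
  refine Finset.prod_congr rfl fun j _ => ?_
  have h1 := Measure.integral_comp_mul_left (fun t =>
    cexp (-(I * (((Real.sqrt |lam|)⁻¹ * p j * t : ℝ) : ℂ))) * hermiteFun (α j) t) (Real.sqrt |lam|)
  rw [integral_hermiteFun_mul_cexp, abs_of_pos (inv_pos.2 h0), real_smul] at h1
  rw [ofReal_mul, mul_assoc, mul_assoc, ← mul_assoc ((Real.sqrt (2 * Real.pi) : ℝ) : ℂ), ← h1]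
  congr 1; funext t
  congr 5
  field_simp

theorem norm_ft_hermiteFunN_le {n : ℕ} {lam ε : ℝ} (hlam : lam ≠ 0) (hε : 0 < ε)
    (α : Fin n → ℕ) (p : Rn n) :
    ‖ft (hermiteFunN lam α) p‖ ≤ |lam| ^ ((n : ℝ) / 4) *
      (2 * ((Real.sqrt |lam|)⁻¹ * Real.sqrt (2 * Real.pi))) ^ n *
      (∏ j, (((α j : ℝ) + 1) * Real.exp ε ^ α j)) *
        Real.exp (-(ε / (2 * (1 + ε)) / |lam|) * ‖p‖ ^ 2) := by
  rw [ft_hermiteFunN hlam, norm_mul, norm_real, Real.norm_of_nonneg (by positivity), norm_prod,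
    ← prod_exp_neg_mul_sq]
  have h : ∀ j, ‖(((Real.sqrt |lam|)⁻¹ * Real.sqrt (2 * Real.pi) : ℝ) : ℂ) * (-I) ^ α j *
        hermiteFun (α j) ((Real.sqrt |lam|)⁻¹ * p j)‖ ≤
      (2 * ((Real.sqrt |lam|)⁻¹ * Real.sqrt (2 * Real.pi))) * (((α j : ℝ) + 1) * Real.exp ε ^ α j) *
        Real.exp (-(ε / (2 * (1 + ε)) / |lam|) * p j ^ 2) := by
    intro j
    rw [norm_mul, norm_mul, norm_real, norm_real, Real.norm_of_nonneg (by positivity),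
      Real.norm_eq_abs]
    have := abs_hermiteFun_le hε (α j) ((Real.sqrt |lam|)⁻¹ * p j)
    rw [mul_pow, inv_pow, Real.sq_sqrt (abs_nonneg _)] at this
    have e : -(ε / (2 * (1 + ε))) * (|lam|⁻¹ * p j ^ 2) =
      -(ε / (2 * (1 + ε)) / |lam|) * p j ^ 2 := by ring
    rw [e, mul_comm ε, Real.exp_nat_mul] at this
    simp only [norm_pow, norm_neg, norm_I, one_pow, mul_one]
    calc _ ≤ (Real.sqrt |lam|)⁻¹ * Real.sqrt (2 * Real.pi) * _ :=
          mul_le_mul_of_nonneg_left this (by positivity)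
      _ = _ := by ring
  calc _ ≤ |lam| ^ ((n : ℝ) / 4) * ∏ j, ((2 * ((Real.sqrt |lam|)⁻¹ * Real.sqrt (2 * Real.pi))) *
        (((α j : ℝ) + 1) * Real.exp ε ^ α j) *
        Real.exp (-(ε / (2 * (1 + ε)) / |lam|) * p j ^ 2)) := by
        gcongr with j
        exact h j
    _ = _ := by
      rw [Finset.prod_mul_distrib, Finset.prod_mul_distrib, Finset.prod_const, Finset.card_univ,
        Fintype.card_fin]
      ring

/-- The coefficients are at most ‖φ‖·ρ^{|α|} with ρ = e^{-2t|λ|}, while decay of the Hermite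
functions at level ε costs e^{ε|α|}: the series converges with that decay once ε < 2t|λ|. The
Hermite functions are Fourier eigenfunctions up to dilation, so the transform obeys the dual bound.
G does not depend on ε. -/
theorem exists_continuous_of_mem_spaceE {n : ℕ} {lam t : ℝ} (hlam : lam ≠ 0) (ht : 0 < t)
    {g : L2Rn n} (hg : g ∈ spaceE n hlam t) :
    ∃ G : Rn n → ℂ, Continuous G ∧ g =ᵐ[volume] G ∧ ∀ ε, 0 < ε → ε < 2 * t * |lam| →
      ∃ C, 0 ≤ C ∧ (∀ x, ‖G x‖ ≤ C * Real.exp (-(ε / (2 * (1 + ε)) * |lam|) * ‖x‖ ^ 2)) ∧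
        ∀ p, ‖ft G p‖ ≤ C * Real.exp (-(ε / (2 * (1 + ε)) / |lam|) * ‖p‖ ^ 2) := by
  have hl : 0 < |lam| := abs_pos.2 hlam
  obtain ⟨φ, rfl⟩ := hg
  set c : (Fin n → ℕ) → ℂ := fun α =>
    (Real.exp (-t * ((2 * ∑ j, (α j : ℝ) + n) * |lam|)) : ℂ) * inner ℂ (hermiteL2 hlam α) φ with hc
  set ρ := Real.exp (-(2 * t * |lam|)) with hρ
  have hcb : ∀ α, ‖c α‖ ≤ ‖φ‖ * ∏ j, ρ ^ α j := by
    intro α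
    have h1 := norm_inner_le_norm (𝕜 := ℂ) (hermiteL2 hlam α) φ
    rw [norm_hermiteL2, one_mul] at h1
    rw [hc, norm_mul, norm_real, Real.norm_of_nonneg (by positivity), mul_comm]
    have e : Real.exp (-t * ((2 * ∑ j, (α j : ℝ) + n) * |lam|)) ≤ ∏ j, ρ ^ α j := by
      simp_rw [hρ, ← Real.exp_nat_mul, ← Real.exp_sum, ← Finset.sum_mul]
      refine Real.exp_le_exp.2 ?_
      have : 0 ≤ t * (n * |lam|) := by positivity
      linarith
    gcongr
  have hm : ∀ ε, 0 < ε → ε < 2 * t * |lam| → Summable fun α : Fin n → ℕ =>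
      ∏ j, (((α j : ℝ) + 1) * (ρ * Real.exp ε) ^ α j) := by
    intro ε _ h
    refine summable_multiIndex_geometric n (by positivity) ?_
    rw [hρ, ← Real.exp_add, Real.exp_lt_one_iff]
    linarith
  have hmul : ∀ ε α, ‖c α‖ * ∏ j, (((α j : ℝ) + 1) * Real.exp ε ^ α j) ≤
      ‖φ‖ * ∏ j, (((α j : ℝ) + 1) * (ρ * Real.exp ε) ^ α j) := by
    intro ε α
    calc _ ≤ ‖φ‖ * (∏ j, ρ ^ α j) * ∏ j, (((α j : ℝ) + 1) * Real.exp ε ^ α j) := by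
          gcongr; exact hcb α
      _ = _ := by
        rw [mul_assoc, ← Finset.prod_mul_distrib]
        congr 2; funext j; rw [mul_pow]; ring
  set K := |lam| ^ ((n : ℝ) / 4) * 2 ^ n with hK
  have hb : ∀ ε, 0 < ε → ∀ α x, ‖c α * hermiteFunN lam α x‖ ≤
      K * ‖φ‖ * (∏ j, (((α j : ℝ) + 1) * (ρ * Real.exp ε) ^ α j)) *
        Real.exp (-(ε / (2 * (1 + ε)) * |lam|) * ‖x‖ ^ 2) := by
    intro ε hε α x
    rw [norm_mul]
    calc _ ≤ ‖c α‖ * _ := mul_le_mul_of_nonneg_left (norm_hermiteFunN_le hε α x) (norm_nonneg _)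
      _ = K * (‖c α‖ * ∏ j, (((α j : ℝ) + 1) * Real.exp ε ^ α j)) *
        Real.exp (-(ε / (2 * (1 + ε)) * |lam|) * ‖x‖ ^ 2) := by rw [hK]; ring
      _ ≤ K * (‖φ‖ * ∏ j, (((α j : ℝ) + 1) * (ρ * Real.exp ε) ^ α j)) *
        Real.exp (-(ε / (2 * (1 + ε)) * |lam|) * ‖x‖ ^ 2) := by
          exact mul_le_mul_of_nonneg_right
            (mul_le_mul_of_nonneg_left (hmul ε α) (by positivity)) (by positivity)
      _ = _ := by ring
  -- ε = t|λ| is one fixed admissible level, used for continuity, for G ∈ L² and for termwise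
  -- integration.
  have hε0 : 0 < t * |lam| := by positivity
  have hε1 : t * |lam| < 2 * t * |lam| := by linarith
  set G : Rn n → ℂ := fun x => ∑' α, c α * hermiteFunN lam α x with hG
  have hGc : Continuous G := by
    refine continuous_tsum (fun α => continuous_const.mul (continuous_hermiteFunN lam α))
      ((hm _ hε0 hε1).mul_left (K * ‖φ‖)) fun α x => (hb _ hε0 α x).trans ?_
    refine mul_le_of_le_one_right (by positivity) ?_
    rw [Real.exp_le_one_iff]
    have : 0 ≤ t * |lam| / (2 * (1 + t * |lam|)) * |lam| * ‖x‖ ^ 2 := by positivity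
    linarith
  -- Needed twice: with w a Hermite function, to identify G with the given L² class, and with w a
  -- character, to compute the Fourier transform of G.
  have hex : ∀ w : Rn n → ℂ, Continuous w → ∀ M, (∀ x, ‖w x‖ ≤ M) →
      HasSum (fun α => c α * ∫ x, hermiteFunN lam α x * w x) (∫ x, G x * w x) := by
    intro w hw M hM
    have hint : ∀ α, Integrable (fun x => c α * hermiteFunN lam α x * w x) := fun α => by
      refine Integrable.mul_bdd (c := M) ?_ hw.aestronglyMeasurable (Filter.Eventually.of_forall hM)
      exact ((integrable_gaussian (by positivity)).const_mul _).mono'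
        (continuous_const.mul (continuous_hermiteFunN lam α)).aestronglyMeasurable
        (Filter.Eventually.of_forall (hb _ hε0 α))
    have h := hasSum_integral_of_summable_integral_norm hint (by
      refine ((hm _ hε0 hε1).mul_left ((∫ x : Rn n, Real.exp (-(t * |lam| / (2 * (1 + t * |lam|))
        * |lam|) * ‖x‖ ^ 2)) * (M * (K * ‖φ‖)))).of_nonneg_of_le
        (fun k => integral_nonneg fun x => norm_nonneg _) fun α => ?_
      rw [mul_assoc, ← integral_mul_const]
      refine integral_mono (hint α).norm ((integrable_gaussian (by positivity)).mul_const _)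
        fun x => ?_
      simp only
      rw [norm_mul]
      calc _ ≤ _ := mul_le_mul (hb _ hε0 α x) (hM x) (norm_nonneg _) (by positivity)
        _ = _ := by ring)
    simp_rw [tsum_mul_right, mul_assoc, integral_const_mul] at h
    exact h
  refine ⟨G, hGc, ?_, ?_⟩
  · have hGb := fun x => (tsum_of_norm_bounded (((hm _ hε0 hε1).hasSum.mul_left (K * ‖φ‖)).mul_right
        (Real.exp (-(t * |lam| / (2 * (1 + t * |lam|)) * |lam|) * ‖x‖ ^ 2)))
        fun α => hb _ hε0 α x)
    have hG2 : MemLp G 2 := by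
      refine ((memLp_two_gaussian (n := n)
        (a := t * |lam| / (2 * (1 + t * |lam|)) * |lam|) (by positivity)).const_mul
        (K * ‖φ‖ * ∑' α : Fin n → ℕ, ∏ j, (((α j : ℝ) + 1) * (ρ * Real.exp (t * |lam|)) ^ α j))).of_le
        hGc.aestronglyMeasurable (Filter.Eventually.of_forall fun x => ?_)
      exact (hGb x).trans (le_abs_self _)
    have hcs : Summable fun α => ‖c α‖ := by
      refine ((hm _ hε0 hε1).mul_left ‖φ‖).of_nonneg_of_le (fun α => norm_nonneg _) fun α => ?_
      refine le_trans ?_ (hmul _ α)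
      refine le_mul_of_one_le_right (norm_nonneg _) (Finset.one_le_prod fun j _ => ?_)
      have hj : (1 : ℝ) ≤ (α j : ℝ) + 1 := by simp
      refine one_le_mul_of_one_le_of_one_le hj (one_le_pow₀ ?_)
      rw [Real.one_le_exp_iff]; positivity
    have h0 : hermiteSemigroup hlam t φ - hG2.toLp G = 0 := by
      refine eq_zero_of_inner_hermiteL2 hlam fun β => ?_
      rw [inner_sub_right, hermiteSemigroup, inner_tsum_hermiteL2 hlam hcs, sub_eq_zero,
        inner_hermiteL2]
      have e1 : ∫ x, (hG2.toLp G) x * hermiteFunN lam β x = ∫ x, G x * hermiteFunN lam β x := by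
        refine integral_congr_ae ?_
        filter_upwards [hG2.coeFn_toLp] with x hx
        rw [hx]
      have e2 := hex (hermiteFunN lam β) (continuous_hermiteFunN lam β) _
        (fun x => (norm_hermiteFunN_le one_pos β x).trans (mul_le_of_le_one_right (by positivity) (by
          rw [Real.exp_le_one_iff]
          have : (0 : ℝ) ≤ 1 / (2 * (1 + 1)) * |lam| * ‖x‖ ^ 2 := by positivity
          linarith)))
      have e3 : ∀ α, ∫ x, hermiteFunN lam α x * hermiteFunN lam β x =
          inner ℂ (hermiteL2 hlam β) (hermiteL2 hlam α) := by
        intro α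
        rw [inner_hermiteL2]
        refine integral_congr_ae ?_
        filter_upwards [(memLp_hermiteFunN hlam α).coeFn_toLp] with x hx
        rw [hermiteL2, hx]
      classical
      simp_rw [e3, orthonormal_iff_ite.1 (orthonormal_hermiteL2 hlam)] at e2
      rw [e1, ← e2.tsum_eq]
      simp
    rw [sub_eq_zero.1 h0]
    exact hG2.coeFn_toLp
  · intro ε hε hεt
    set S := ∑' α : Fin n → ℕ, ∏ j, (((α j : ℝ) + 1) * (ρ * Real.exp ε) ^ α j) with hS
    have hS0 : 0 ≤ S := tsum_nonneg fun α => by positivity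
    set L := |lam| ^ ((n : ℝ) / 4) *
      (2 * ((Real.sqrt |lam|)⁻¹ * Real.sqrt (2 * Real.pi))) ^ n with hL
    refine ⟨(K + L) * ‖φ‖ * S, by positivity, fun x => ?_, fun p => ?_⟩
    · refine (tsum_of_norm_bounded (((hm ε hε hεt).hasSum.mul_left (K * ‖φ‖)).mul_right
        (Real.exp (-(ε / (2 * (1 + ε)) * |lam|) * ‖x‖ ^ 2))) fun α => hb ε hε α x).trans ?_
      gcongr
      have : 0 ≤ L := by positivity
      linarith
    · have h := hex (fun x => cexp (-(I * ((inner ℝ p x : ℝ) : ℂ)))) (by fun_prop) 1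
        fun x => (norm_cexp_neg_I_mul _).le
      rw [ft, ← h.tsum_eq]
      refine (tsum_of_norm_bounded (((hm ε hε hεt).hasSum.mul_left (L * ‖φ‖)).mul_right
        (Real.exp (-(ε / (2 * (1 + ε)) / |lam|) * ‖p‖ ^ 2))) fun α => ?_).trans ?_
      · rw [norm_mul]
        calc _ ≤ ‖c α‖ * _ :=
              mul_le_mul_of_nonneg_left (norm_ft_hermiteFunN_le hlam hε α p) (norm_nonneg _)
          _ = L * (‖c α‖ * ∏ j, (((α j : ℝ) + 1) * Real.exp ε ^ α j)) *
            Real.exp (-(ε / (2 * (1 + ε)) / |lam|) * ‖p‖ ^ 2) := by rw [hL]; ring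
          _ ≤ L * (‖φ‖ * ∏ j, (((α j : ℝ) + 1) * (ρ * Real.exp ε) ^ α j)) *
            Real.exp (-(ε / (2 * (1 + ε)) / |lam|) * ‖p‖ ^ 2) := by
              exact mul_le_mul_of_nonneg_right
                (mul_le_mul_of_nonneg_left (hmul ε α) (by positivity)) (by positivity)
          _ = _ := by ring
      · gcongr
        have : 0 ≤ K := by positivity
        linarith

/-! ### Almost everywhere statements -/

/-- Preimages of null sets under a linear surjection are null. The bounds in 𝒜_t hold only almost
everywhere, yet they have to be used at linear combinations of the integration variables. -/
theorem ae_comp_of_surjective {E F : Type*} [NormedAddCommGroup E] [NormedSpace ℝ E]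
    [FiniteDimensional ℝ E] [MeasureSpace E] [BorelSpace E] [(volume : Measure E).IsAddHaarMeasure]
    [NormedAddCommGroup F] [NormedSpace ℝ F] [FiniteDimensional ℝ F] [MeasureSpace F] [BorelSpace F]
    [(volume : Measure F).IsAddHaarMeasure] {L : E →ₗ[ℝ] F} (hL : Function.Surjective L)
    {P : F → Prop} (hP : ∀ᵐ y, P y) : ∀ᵐ x, P (L x) := by
  obtain ⟨c, _, hc⟩ := L.exists_map_addHaar_eq_smul_addHaar (volume : Measure E)
    (volume : Measure F) hL
  have hq : Measure.QuasiMeasurePreserving L (volume : Measure E) (volume : Measure F) :=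
    ⟨L.continuous_of_finiteDimensional.measurable, by
      rw [hc]; exact Measure.smul_absolutelyContinuous⟩
  exact hq.ae hP

instance instIsAddHaarMeasureVolumeProd {E F : Type*} [NormedAddCommGroup E] [NormedSpace ℝ E]
    [FiniteDimensional ℝ E] [MeasureSpace E] [BorelSpace E] [(volume : Measure E).IsAddHaarMeasure]
    [NormedAddCommGroup F] [NormedSpace ℝ F] [FiniteDimensional ℝ F] [MeasureSpace F] [BorelSpace F]
    [(volume : Measure F).IsAddHaarMeasure] : (volume : Measure (E × F)).IsAddHaarMeasure := by
  have : ProperSpace E := FiniteDimensional.proper ℝ E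
  have : ProperSpace F := FiniteDimensional.proper ℝ F
  exact Measure.prod.instIsAddHaarMeasure _ _

/-- The reordering `((x,u),t) ↦ (x,u,t)`. -/
theorem measurePreserving_heisAssoc (n : ℕ) : MeasurePreserving
    (fun w : (Rn n × Rn n) × ℝ => ((w.1.1, w.1.2, w.2) : Heis n)) volume volume :=
  volume_preserving_prodAssoc

theorem measurableEmbedding_heisAssoc (n : ℕ) : MeasurableEmbedding
    (fun w : (Rn n × Rn n) × ℝ => ((w.1.1, w.1.2, w.2) : Heis n)) :=
  (MeasurableEquiv.prodAssoc : (Rn n × Rn n) × ℝ ≃ᵐ Rn n × Rn n × ℝ).measurableEmbedding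

theorem integrable_mul_cexp_heis {n : ℕ} {f : Heis n → ℂ} (hf : Integrable f) (lam : ℝ) :
    Integrable fun p : Heis n => f p * cexp (I * ((lam * p.2.2 : ℝ) : ℂ)) :=
  hf.mul_bdd (c := 1) (Continuous.aestronglyMeasurable (by fun_prop))
    (Filter.Eventually.of_forall fun x => (norm_cexp_I_mul _).le)

theorem integrable_partialInvFourier {n : ℕ} {f : Heis n → ℂ} (hf : Integrable f) (lam : ℝ) :
    Integrable fun z : Rn n × Rn n => partialInvFourier lam f z.1 z.2 :=
  ((measurePreserving_heisAssoc n).integrable_comp_of_integrable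
    (integrable_mul_cexp_heis hf lam)).integral_prod_left

theorem partialInvFourier_congr_ae {n : ℕ} {f g : Heis n → ℂ} (h : f =ᵐ[volume] g) (lam : ℝ) :
    ∀ᵐ z : Rn n × Rn n, partialInvFourier lam f z.1 z.2 = partialInvFourier lam g z.1 z.2 := by
  have h1 := (measurePreserving_heisAssoc n).quasiMeasurePreserving.ae h
  filter_upwards [Measure.ae_ae_of_ae_prod h1] with z hz
  refine integral_congr_ae ?_
  filter_upwards [hz] with t ht
  exact congrArg (· * cexp (I * ((lam * t : ℝ) : ℂ))) ht

theorem ae_ft_fst_congr {n : ℕ} {F G : Rn n → Rn n → ℂ}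
    (h : ∀ᵐ z : Rn n × Rn n, F z.1 z.2 = G z.1 z.2) :
    ∀ᵐ u, ∀ x, ft (fun y => F y u) x = ft (fun y => G y u) x := by
  have h1 := (Measure.measurePreserving_swap
    (μ := (volume : Measure (Rn n))) (ν := (volume : Measure (Rn n)))).quasiMeasurePreserving.ae h
  filter_upwards [Measure.ae_ae_of_ae_prod h1] with u hu x
  refine integral_congr_ae ?_
  filter_upwards [hu] with y hy
  simp only [Prod.swap_prod_mk] at hy
  rw [hy]

/-! ### Twisted convolution -/

/-- The twisted convolution on `ℝⁿ × ℝⁿ` corresponding to convolution on the Heisenberg group. -/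
def twistedConv {n : ℕ} (lam : ℝ) (F G : Rn n → Rn n → ℂ) (x u : Rn n) : ℂ :=
  ∫ z : Rn n × Rn n, F (x - z.1) (u - z.2) * G z.1 z.2 *
    cexp (-(I * ((lam / 2 * (inner ℝ z.2 x - inner ℝ u z.1) : ℝ) : ℂ)))

/-- For fixed q, the last coordinate of p q⁻¹ is a translate of t, so integrating in t yields f^λ
times a phase. Part of this phase is the twist and the rest forms g^λ when the last coordinate of q
is integrated. -/
theorem partialInvFourier_convFun {n : ℕ} {f g : Heis n → ℂ} (hf : Integrable f)
    (hg : Integrable g) (lam : ℝ) : ∀ᵐ z : Rn n × Rn n,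
    partialInvFourier lam (convFun f g) z.1 z.2 =
      twistedConv lam (partialInvFourier lam f) (partialInvFourier lam g) z.1 z.2 := by
  set H : Heis n × Heis n → ℂ := fun z => f (heisMul z.1 (-z.2)) * g z.2 *
    cexp (I * ((lam * z.1.2.2 : ℝ) : ℂ)) with hH
  have hHi : Integrable H (volume.prod volume) :=
    (integrable_conv_prod hf hg).mul_bdd (c := 1) (Continuous.aestronglyMeasurable (by fun_prop))
      (Filter.Eventually.of_forall fun x => (norm_cexp_I_mul _).le)
  have hM : MeasurePreserving (fun w : (Rn n × Rn n) × (ℝ × Heis n) =>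
      (((w.1.1, w.1.2, w.2.1), w.2.2) : Heis n × Heis n)) volume (volume.prod volume) :=
    ((measurePreserving_heisAssoc n).prod (MeasurePreserving.id (volume : Measure (Heis n)))).comp
      (volume_preserving_prodAssoc (α₁ := Rn n × Rn n) (β₁ := ℝ) (γ₁ := Heis n)).symm
  filter_upwards [(hM.integrable_comp_of_integrable hHi).prod_right_ae] with z hz
  obtain ⟨x, u⟩ := z
  simp only at hz ⊢
  set R : Heis n → ℂ := fun q => partialInvFourier lam f (x - q.1) (u - q.2.1) *
    cexp (-(I * ((lam / 2 * (inner ℝ q.2.1 x - inner ℝ u q.1) : ℝ) : ℂ))) *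
      (g q * cexp (I * ((lam * q.2.2 : ℝ) : ℂ))) with hR
  have h1 : ∀ q : Heis n, ∫ t : ℝ, H ((x, u, t), q) = R q := by
    intro q
    set c : ℝ := -q.2.2 + (1 / 2) * (inner ℝ q.2.1 x - inner ℝ u q.1) with hc
    have e1 : ∀ t : ℝ, H ((x, u, t), q) = (fun t : ℝ => f (x - q.1, u - q.2.1, t) *
        cexp (I * ((lam * t : ℝ) : ℂ))) (t + c) * (g q * cexp (-(I * ((lam * c : ℝ) : ℂ)))) := by
      intro t
      have e2 : heisMul (x, u, t) (-q) = (x - q.1, u - q.2.1, t + c) := by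
        simp only [heisMul, Prod.fst_neg, Prod.snd_neg, inner_neg_right, inner_neg_left, hc]
        refine Prod.ext (by simp [sub_eq_add_neg]) (Prod.ext (by simp [sub_eq_add_neg]) ?_)
        simp only
        ring
      simp only [hH, e2]
      have e3 : cexp (I * ((lam * t : ℝ) : ℂ)) = cexp (I * ((lam * (t + c) : ℝ) : ℂ)) *
          cexp (-(I * ((lam * c : ℝ) : ℂ))) := by
        rw [← Complex.exp_add]; congr 1; push_cast; ring
      rw [e3]; ring
    simp_rw [e1]
    rw [integral_mul_const, integral_add_right_eq_self
      (fun t : ℝ => f (x - q.1, u - q.2.1, t) * cexp (I * ((lam * t : ℝ) : ℂ))) c]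
    have e4 : cexp (-(I * ((lam * c : ℝ) : ℂ))) =
        cexp (-(I * ((lam / 2 * (inner ℝ q.2.1 x - inner ℝ u q.1) : ℝ) : ℂ))) *
          cexp (I * ((lam * q.2.2 : ℝ) : ℂ)) := by
      rw [← Complex.exp_add]; congr 1; rw [hc]; push_cast; ring
    rw [e4]
    simp only [hR, partialInvFourier]
    ring
  have hRi : Integrable R := hz.integral_prod_right.congr (Filter.Eventually.of_forall h1)
  have h2 : partialInvFourier lam (convFun f g) x u = ∫ q, R q := by
    simp_rw [← h1]
    rw [← integral_integral_swap hz]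
    simp only [partialInvFourier, convFun, ← integral_mul_const, hH]
  rw [h2, ← (measurePreserving_heisAssoc n).integral_comp (measurableEmbedding_heisAssoc n)]
  have h3 := (measurePreserving_heisAssoc n).integrable_comp_of_integrable hRi
  have h4 := integral_prod _ h3
  refine h4.trans ?_
  rw [twistedConv]
  congr 1; funext w
  simp only [hR, Function.comp]
  rw [integral_const_mul, mul_right_comm]
  rfl

/-- Exchanging the two variables reverses the symplectic form, that is, the sign of λ. Hence the
second bound in 𝒜_t follows from the first one for -λ. -/
theorem twistedConv_swap {n : ℕ} (lam : ℝ) (F G : Rn n → Rn n → ℂ) (x u : Rn n) :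
    twistedConv lam F G u x =
      twistedConv (-lam) (fun a b => F b a) (fun a b => G b a) x u := by
  have h := (Measure.measurePreserving_swap (μ := (volume : Measure (Rn n)))
    (ν := (volume : Measure (Rn n)))).integral_comp
    (MeasurableEquiv.prodComm (α := Rn n) (β := Rn n)).measurableEmbedding
    (fun z : Rn n × Rn n => F (u - z.1) (x - z.2) * G z.1 z.2 *
    cexp (-(I * ((lam / 2 * (inner ℝ z.2 u - inner ℝ x z.1) : ℝ) : ℂ))))
  refine (Eq.symm h).trans ?_
  rw [twistedConv]
  congr 1; funext z
  simp only [Prod.fst_swap, Prod.snd_swap]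
  congr 5
  rw [real_inner_comm u z.1, real_inner_comm z.2 x]
  ring

theorem integrable_twistedConv_prod {n : ℕ} {F G : Rn n → Rn n → ℂ}
    (hF : Integrable fun z : Rn n × Rn n => F z.1 z.2)
    (hG : Integrable fun z : Rn n × Rn n => G z.1 z.2) :
    Integrable (fun z : (Rn n × Rn n) × (Rn n × Rn n) =>
      F (z.1.1 - z.2.1) (z.1.2 - z.2.2) * G z.2.1 z.2.2) (volume.prod volume) := by
  have h := (measurePreserving_sub_prod (volume : Measure (Rn n × Rn n)) volume)
  have h2 := h.integrable_comp_of_integrable (hF.mul_prod hG)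
  exact h2

/-- In the first variable the twisted convolution is an ordinary convolution with characters, so its
transform is a product; the twist survives only as shifts of the two frequencies. -/
theorem ft_twistedConv {n : ℕ} {F G : Rn n → Rn n → ℂ}
    (hF : Integrable fun z : Rn n × Rn n => F z.1 z.2)
    (hG : Integrable fun z : Rn n × Rn n => G z.1 z.2) (lam : ℝ) :
    ∀ᵐ u, ∀ w, ft (fun x => twistedConv lam F G x u) w =
      ∫ v, ft (fun x => F x (u - v)) (w + (lam / 2) • v) *
        ft (fun x => G x v) (w - (lam / 2) • (u - v)) := by
  have h0 := integrable_twistedConv_prod hF hG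
  have hM : MeasurePreserving (fun z : Rn n × (Rn n × (Rn n × Rn n)) =>
      (((z.2.1, z.1), z.2.2) : (Rn n × Rn n) × (Rn n × Rn n))) volume (volume.prod volume) :=
    ((Measure.measurePreserving_swap (μ := (volume : Measure (Rn n)))
      (ν := (volume : Measure (Rn n)))).prod
      (MeasurePreserving.id (volume : Measure (Rn n × Rn n)))).comp
      (volume_preserving_prodAssoc (α₁ := Rn n) (β₁ := Rn n) (γ₁ := Rn n × Rn n)).symm
  filter_upwards [(hM.integrable_comp_of_integrable h0).prod_right_ae] with u hu w
  set K : Rn n × (Rn n × Rn n) → ℂ := fun z =>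
    F (z.1 - z.2.1) (u - z.2.2) * G z.2.1 z.2.2 *
      cexp (-(I * ((lam / 2 * (inner ℝ z.2.2 z.1 - inner ℝ u z.2.1) + inner ℝ w z.1 : ℝ) : ℂ))) with hK
  have hKi : Integrable K (volume.prod volume) :=
    hu.mul_bdd (c := 1) (Continuous.aestronglyMeasurable (by fun_prop))
      (Filter.Eventually.of_forall fun x => (norm_cexp_neg_I_mul _).le)
  set R : Rn n × Rn n → ℂ := fun z => ft (fun x => F x (u - z.2)) (w + (lam / 2) • z.2) *
    (G z.1 z.2 * cexp (-(I * ((inner ℝ (w - (lam / 2) • (u - z.2)) z.1 : ℝ) : ℂ)))) with hR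
  have h1 : ∀ z : Rn n × Rn n, ∫ x, K (x, z) = R z := by
    intro z
    have e1 : ∀ x, K (x, z) = (fun x => F x (u - z.2) *
        cexp (-(I * ((inner ℝ (w + (lam / 2) • z.2) x : ℝ) : ℂ)))) (x - z.1) *
        (G z.1 z.2 * cexp (-(I * ((inner ℝ (w - (lam / 2) • (u - z.2)) z.1 : ℝ) : ℂ)))) := by
      intro x
      have e2 : lam / 2 * (inner ℝ z.2 x - inner ℝ u z.1) + inner ℝ w x =
          inner ℝ (w + (lam / 2) • z.2) (x - z.1) + inner ℝ (w - (lam / 2) • (u - z.2)) z.1 := by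
        simp only [inner_add_left, inner_sub_left, inner_sub_right, inner_smul_left, conj_trivial]
        ring
      simp only [hK]
      rw [e2]
      have e3 : ∀ a b : ℝ, cexp (-(I * ((a + b : ℝ) : ℂ))) =
          cexp (-(I * (a : ℂ))) * cexp (-(I * (b : ℂ))) := by
        intro a b; rw [← Complex.exp_add]; congr 1; push_cast; ring
      rw [e3]; ring
    simp_rw [e1]
    rw [integral_mul_const, integral_sub_right_eq_self (fun x => F x (u - z.2) *
        cexp (-(I * ((inner ℝ (w + (lam / 2) • z.2) x : ℝ) : ℂ)))) z.1]
    rfl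
  have hRi : Integrable R := by
    have := hKi.integral_prod_right
    simp_rw [h1] at this
    exact this
  have h2 : ft (fun x => twistedConv lam F G x u) w = ∫ z, R z := by
    simp_rw [← h1]
    rw [← integral_integral_swap hKi]
    simp only [ft, twistedConv, ← integral_mul_const, hK]
    congr 1; funext x; congr 1; funext z
    rw [mul_assoc (F _ _ * G _ _), ← Complex.exp_add]
    congr 2
    push_cast; ring
  rw [h2, Measure.volume_eq_prod, integral_prod_symm _ hRi]
  congr 1; funext v
  simp only [hR]
  rw [integral_const_mul]
  rfl

/-- The reason why 𝒜_t is closed under convolution with no loss in t: the exponents of the factors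
sum to the exponent at (w, u) plus a square centred in v, which integrates to a constant. -/
theorem twisted_exponent {n : ℕ} (p lam : ℝ) (hlam : lam ≠ 0) (w u v : Rn n) :
    (p * ‖w + (lam / 2) • v‖ ^ 2 + p * lam ^ 2 / 4 * ‖u - v‖ ^ 2) +
      (p * ‖w - (lam / 2) • (u - v)‖ ^ 2 + p * lam ^ 2 / 4 * ‖v‖ ^ 2) =
    (p * ‖w‖ ^ 2 + p * lam ^ 2 / 4 * ‖u‖ ^ 2) +
      p * lam ^ 2 * ‖v + (lam⁻¹ • w - (1 / 2 : ℝ) • u)‖ ^ 2 := by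
  have e : lam ^ 2 * ‖v + (lam⁻¹ • w - (1 / 2 : ℝ) • u)‖ ^ 2 =
      ‖w + lam • (v - (1 / 2 : ℝ) • u)‖ ^ 2 := by
    have : w + lam • (v - (1 / 2 : ℝ) • u) = lam • (v + (lam⁻¹ • w - (1 / 2 : ℝ) • u)) := by
      simp only [smul_add, smul_sub, smul_smul, mul_inv_cancel₀ hlam, one_smul]
      abel
    rw [this, norm_smul, mul_pow, Real.norm_eq_abs, sq_abs]
  rw [mul_assoc p, e]
  simp only [← real_inner_self_eq_norm_sq, inner_add_left, inner_add_right, inner_sub_left,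
    inner_sub_right, inner_smul_left, inner_smul_right, conj_trivial]
  rw [real_inner_comm w v, real_inner_comm w u, real_inner_comm u v]
  ring

theorem ft_twistedConv_bound {n : ℕ} {F G : Rn n → Rn n → ℂ} {lam p C₁ C₂ : ℝ} (hlam : lam ≠ 0)
    (hp : 0 < p)
    (hF : Integrable fun z : Rn n × Rn n => F z.1 z.2)
    (hG : Integrable fun z : Rn n × Rn n => G z.1 z.2)
    (hFb : ∀ᵐ z : Rn n × Rn n, ‖ft (fun y => F y z.2) z.1‖ ≤
      C₁ * Real.exp (-(p * ‖z.1‖ ^ 2 + p * lam ^ 2 / 4 * ‖z.2‖ ^ 2)))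
    (hGb : ∀ᵐ z : Rn n × Rn n, ‖ft (fun y => G y z.2) z.1‖ ≤
      C₂ * Real.exp (-(p * ‖z.1‖ ^ 2 + p * lam ^ 2 / 4 * ‖z.2‖ ^ 2))) :
    ∃ C, ∀ᵐ z : Rn n × Rn n, ‖ft (fun y => twistedConv lam F G y z.2) z.1‖ ≤
      C * Real.exp (-(p * ‖z.1‖ ^ 2 + p * lam ^ 2 / 4 * ‖z.2‖ ^ 2)) := by
  have hl2 : 0 < p * lam ^ 2 := by positivity
  refine ⟨C₁ * C₂ * ∫ v : Rn n, Real.exp (-(p * lam ^ 2) * ‖v‖ ^ 2), ?_⟩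
  have h1 : ∀ᵐ z : Rn n × Rn n, ∀ w, ft (fun x => twistedConv lam F G x z.2) w =
      ∫ v, ft (fun x => F x (z.2 - v)) (w + (lam / 2) • v) *
        ft (fun x => G x v) (w - (lam / 2) • (z.2 - v)) :=
    Measure.quasiMeasurePreserving_snd.ae (ft_twistedConv hF hG lam)
  -- The points at which the two factors of `ft_twistedConv` are evaluated, as linear maps of ((w,
  -- u), v).
  let L₁ : ((Rn n × Rn n) × Rn n) →ₗ[ℝ] (Rn n × Rn n) :=
    { toFun := fun z => (z.1.1 + (lam / 2) • z.2, z.1.2 - z.2)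
      map_add' := fun a b => by ext <;> simp <;> ring
      map_smul' := fun c a => by ext <;> simp <;> ring }
  let L₂ : ((Rn n × Rn n) × Rn n) →ₗ[ℝ] (Rn n × Rn n) :=
    { toFun := fun z => (z.1.1 - (lam / 2) • (z.1.2 - z.2), z.2)
      map_add' := fun a b => by ext <;> simp <;> ring
      map_smul' := fun c a => by ext <;> simp <;> ring }
  have hL₁ : Function.Surjective L₁ := fun y => ⟨((y.1, y.2), 0), by simp [L₁]⟩
  have hL₂ : Function.Surjective L₂ := fun y => ⟨((y.1, y.2), y.2), by simp [L₂]⟩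
  have h2 := Measure.ae_ae_of_ae_prod (ae_comp_of_surjective hL₁ hFb)
  have h3 := Measure.ae_ae_of_ae_prod (ae_comp_of_surjective hL₂ hGb)
  filter_upwards [h1, h2, h3] with z hz1 hz2 hz3
  rw [hz1]
  have hgi : Integrable fun v : Rn n => Real.exp (-(p * lam ^ 2) *
      ‖v + (lam⁻¹ • z.1 - (1 / 2 : ℝ) • z.2)‖ ^ 2) :=
    (integrable_gaussian hl2).comp_add_right _
  refine (norm_integral_le_of_norm_le (hgi.const_mul (C₁ * C₂ *
    Real.exp (-(p * ‖z.1‖ ^ 2 + p * lam ^ 2 / 4 * ‖z.2‖ ^ 2)))) ?_).trans (le_of_eq ?_)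
  · filter_upwards [hz2, hz3] with v hv2 hv3
    simp only [L₁, L₂, LinearMap.coe_mk, AddHom.coe_mk] at hv2 hv3
    rw [norm_mul]
    refine (mul_le_mul hv2 hv3 (norm_nonneg _) ((norm_nonneg _).trans hv2)).trans (le_of_eq ?_)
    rw [mul_mul_mul_comm, ← Real.exp_add, ← neg_add, twisted_exponent p lam hlam, mul_assoc (C₁ * C₂),
      ← Real.exp_add]
    congr 2
    ring
  · rw [integral_const_mul, integral_add_right_eq_self
      (fun v : Rn n => Real.exp (-(p * lam ^ 2) * ‖v‖ ^ 2))]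
    ring

/-! ### The algebras `𝒜_t` -/

/-- The two Gaussian bounds defining `𝒜_t`, for the unnormalised Fourier transform; here
`p = tanh(tλ)/λ`. -/
def GaussianPair {n : ℕ} (lam p C : ℝ) (F : Rn n → Rn n → ℂ) : Prop :=
  (∀ᵐ z : Rn n × Rn n, ‖ft (fun y => F y z.2) z.1‖ ≤
      C * Real.exp (-(p * ‖z.1‖ ^ 2 + p * lam ^ 2 / 4 * ‖z.2‖ ^ 2))) ∧
  (∀ᵐ z : Rn n × Rn n, ‖ft (F z.2) z.1‖ ≤
      C * Real.exp (-(p * ‖z.1‖ ^ 2 + p * lam ^ 2 / 4 * ‖z.2‖ ^ 2)))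

theorem GaussianPair.mono {n : ℕ} {lam p p' C C' : ℝ} {F : Rn n → Rn n → ℂ}
    (h : GaussianPair lam p C F) (hp : p' ≤ p) (hC : C ≤ C') (hC0 : 0 ≤ C') :
    GaussianPair lam p' C' F := by
  have key : ∀ z : Rn n × Rn n, C * Real.exp (-(p * ‖z.1‖ ^ 2 + p * lam ^ 2 / 4 * ‖z.2‖ ^ 2)) ≤
      C' * Real.exp (-(p' * ‖z.1‖ ^ 2 + p' * lam ^ 2 / 4 * ‖z.2‖ ^ 2)) := by
    intro z
    gcongr
  exact ⟨h.1.mono fun z hz => hz.trans (key z), h.2.mono fun z hz => hz.trans (key z)⟩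

theorem GaussianPair.congr_ae {n : ℕ} {lam p C : ℝ} {F G : Rn n → Rn n → ℂ}
    (h : GaussianPair lam p C F) (hFG : ∀ᵐ z : Rn n × Rn n, F z.1 z.2 = G z.1 z.2) :
    GaussianPair lam p C G := by
  constructor
  · have h1 : ∀ᵐ z : Rn n × Rn n, ∀ x, ft (fun y => F y z.2) x = ft (fun y => G y z.2) x :=
      Measure.quasiMeasurePreserving_snd.ae (ae_ft_fst_congr hFG)
    filter_upwards [h.1, h1] with z hz h2
    rwa [← h2]
  · have h0 := (Measure.measurePreserving_swap (μ := (volume : Measure (Rn n)))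
      (ν := (volume : Measure (Rn n)))).quasiMeasurePreserving.ae hFG
    have h1 : ∀ᵐ z : Rn n × Rn n, ∀ x, ft (F z.2) x = ft (G z.2) x :=
      Measure.quasiMeasurePreserving_snd.ae
        (ae_ft_fst_congr (F := fun a b => F b a) (G := fun a b => G b a) h0)
    filter_upwards [h.2, h1] with z hz h2
    rwa [← h2]

theorem GaussianPair.add {n : ℕ} {lam p C₁ C₂ : ℝ} {F G : Rn n → Rn n → ℂ}
    (hFi : Integrable fun z : Rn n × Rn n => F z.1 z.2)
    (hGi : Integrable fun z : Rn n × Rn n => G z.1 z.2)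
    (hF : GaussianPair lam p C₁ F) (hG : GaussianPair lam p C₂ G) :
    GaussianPair lam p (C₁ + C₂) (fun x u => F x u + G x u) := by
  have hft : ∀ f g : Rn n → ℂ, Integrable f → Integrable g → ∀ x,
      ft (fun y => f y + g y) x = ft f x + ft g x := by
    intro f g hf hg x
    rw [ft, ft, ft, ← integral_add (integrable_mul_cexp_neg hf x) (integrable_mul_cexp_neg hg x)]
    simp_rw [add_mul]
  constructor
  · have h1 : ∀ᵐ z : Rn n × Rn n, Integrable fun y => F y z.2 :=
      Measure.quasiMeasurePreserving_snd.ae hFi.prod_left_ae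
    have h2 : ∀ᵐ z : Rn n × Rn n, Integrable fun y => G y z.2 :=
      Measure.quasiMeasurePreserving_snd.ae hGi.prod_left_ae
    filter_upwards [hF.1, hG.1, h1, h2] with z a b c d
    rw [hft _ _ c d, add_mul]
    exact (norm_add_le _ _).trans (add_le_add a b)
  · have h1 : ∀ᵐ z : Rn n × Rn n, Integrable fun y => F z.2 y :=
      Measure.quasiMeasurePreserving_snd.ae hFi.prod_right_ae
    have h2 : ∀ᵐ z : Rn n × Rn n, Integrable fun y => G z.2 y :=
      Measure.quasiMeasurePreserving_snd.ae hGi.prod_right_ae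
    filter_upwards [hF.2, hG.2, h1, h2] with z a b c d
    rw [hft _ _ c d, add_mul]
    exact (norm_add_le _ _).trans (add_le_add a b)

theorem GaussianPair.const_mul {n : ℕ} {lam p C : ℝ} {F : Rn n → Rn n → ℂ}
    (hF : GaussianPair lam p C F) (c : ℂ) :
    GaussianPair lam p (‖c‖ * C) (fun x u => c * F x u) := by
  have hft : ∀ f : Rn n → ℂ, ∀ x, ft (fun y => c * f y) x = c * ft f x := by
    intro f x
    rw [ft, ft, ← integral_const_mul]
    simp_rw [mul_assoc]
  constructor
  · filter_upwards [hF.1] with z a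
    rw [hft, norm_mul, mul_assoc]
    gcongr
  · filter_upwards [hF.2] with z a
    rw [hft, norm_mul, mul_assoc]
    gcongr

theorem GaussianPair.twistedConv {n : ℕ} {lam p C₁ C₂ : ℝ} {F G : Rn n → Rn n → ℂ}
    (hlam : lam ≠ 0) (hp : 0 < p)
    (hFi : Integrable fun z : Rn n × Rn n => F z.1 z.2)
    (hGi : Integrable fun z : Rn n × Rn n => G z.1 z.2)
    (hF : GaussianPair lam p C₁ F) (hG : GaussianPair lam p C₂ G) :
    ∃ C, GaussianPair lam p C (HeisenbergAnalytic.twistedConv lam F G) := by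
  obtain ⟨A, hA⟩ := ft_twistedConv_bound hlam hp hFi hGi hF.1 hG.1
  obtain ⟨B, hB⟩ := ft_twistedConv_bound (F := fun a b => F b a) (G := fun a b => G b a)
    (lam := -lam) (p := p) (C₁ := C₁) (C₂ := C₂) (neg_ne_zero.2 hlam) hp hFi.swap hGi.swap
    (by simpa using hF.2) (by simpa using hG.2)
  have hA' : GaussianPair lam p (max A B) (HeisenbergAnalytic.twistedConv lam F G) := by
    refine ⟨?_, ?_⟩
    · filter_upwards [hA] with z hz
      exact hz.trans (by gcongr; exact le_max_left _ _)
    · filter_upwards [hB] with z hz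
      have e : HeisenbergAnalytic.twistedConv lam F G z.2 = fun y =>
          HeisenbergAnalytic.twistedConv (-lam) (fun a b => F b a) (fun a b => G b a) y z.2 := by
        funext y; exact twistedConv_swap lam F G y z.2
      rw [e]
      rw [neg_sq] at hz
      exact hz.trans (by gcongr; exact le_max_right _ _)
  exact ⟨_, hA'⟩

/-! ### The rate tanh(tλ)/λ and membership in 𝒜_t -/

theorem tanh_strictMono : StrictMono Real.tanh := by
  intro x y hxy
  rw [Real.tanh_eq_sinh_div_cosh, Real.tanh_eq_sinh_div_cosh,
    div_lt_div_iff₀ (Real.cosh_pos x) (Real.cosh_pos y)]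
  have h := Real.sinh_pos_iff.2 (sub_pos.2 hxy)
  rw [Real.sinh_sub] at h
  linarith

theorem tanh_div_pos {lam t : ℝ} (hlam : lam ≠ 0) (ht : 0 < t) : 0 < Real.tanh (t * lam) / lam := by
  rcases lt_or_gt_of_ne hlam with h | h
  · exact div_pos_of_neg_of_neg (by
      simpa using tanh_strictMono (mul_neg_of_pos_of_neg ht h)) h
  · exact div_pos (by simpa using tanh_strictMono (mul_pos ht h)) h

/-- With p = tanh(tλ)/λ one has tanh(tλ)(|x|²/λ + λ|u|²/4) = p|x|² + pλ²|u|²/4; p is positive for t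
> 0 whatever the sign of λ. The factor (2π)^{-n/2} is absorbed in C. -/
theorem mem_spaceA_iff {n : ℕ} {lam t : ℝ} (hlam : lam ≠ 0) {f : L1Heis n} :
    f ∈ spaceA n lam t ↔
      ∃ C, GaussianPair lam (Real.tanh (t * lam) / lam) C (partialInvFourier lam f) := by
  have e1 : ∀ z : Rn n × Rn n,
      -Real.tanh (t * lam) * (1 / lam * ‖z.1‖ ^ 2 + lam / 4 * ‖z.2‖ ^ 2) =
      -(Real.tanh (t * lam) / lam * ‖z.1‖ ^ 2 + Real.tanh (t * lam) / lam * lam ^ 2 / 4 * ‖z.2‖ ^ 2) := by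
    intro z; field_simp
  have e2 : ∀ z : Rn n × Rn n,
      -Real.tanh (t * lam) * (lam / 4 * ‖z.1‖ ^ 2 + 1 / lam * ‖z.2‖ ^ 2) =
      -(Real.tanh (t * lam) / lam * ‖z.2‖ ^ 2 + Real.tanh (t * lam) / lam * lam ^ 2 / 4 * ‖z.1‖ ^ 2) := by
    intro z; field_simp; ring
  set F := partialInvFourier lam f
  set c : ℝ := (2 * Real.pi) ^ (-(n : ℝ) / 2) with hc
  have hc0 : 0 < c := by positivity
  have n1 : ∀ x u, ‖fourierFst F x u‖ = c * ‖ft (fun y => F y u) x‖ := by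
    intro x u
    rw [fourierFst, norm_mul, norm_real, Real.norm_of_nonneg hc0.le]
    rfl
  have n2 : ∀ x u, ‖fourierSnd F x u‖ = c * ‖ft (F x) u‖ := by
    intro x u
    rw [fourierSnd, norm_mul, norm_real, Real.norm_of_nonneg hc0.le]
    rfl
  have hsw := (Measure.measurePreserving_swap (μ := (volume : Measure (Rn n)))
      (ν := (volume : Measure (Rn n)))).quasiMeasurePreserving
  simp only [spaceA, Set.mem_ofPred_eq]
  constructor
  · rintro ⟨C, hC⟩
    refine ⟨c⁻¹ * C, ?_, ?_⟩
    · filter_upwards [hC] with z hz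
      have := hz.1
      rw [n1, e1] at this
      rw [mul_assoc, ← div_eq_inv_mul, le_div_iff₀ hc0, mul_comm]
      exact this
    · have hC' := hsw.ae hC
      filter_upwards [hC'] with z hz
      have := hz.2
      rw [n2, e2] at this
      rw [mul_assoc, ← div_eq_inv_mul, le_div_iff₀ hc0, mul_comm]
      exact this
  · rintro ⟨C, h1, h2⟩
    refine ⟨c * C, ?_⟩
    have h2' := hsw.ae h2
    filter_upwards [h1, h2'] with z a b
    rw [n1, n2, e1, e2, mul_assoc, mul_assoc]
    exact ⟨by gcongr, mul_le_mul_of_nonneg_left b hc0.le⟩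

theorem partialInvFourier_add {n : ℕ} {f g : Heis n → ℂ} (hf : Integrable f) (hg : Integrable g)
    (lam : ℝ) : ∀ᵐ z : Rn n × Rn n, partialInvFourier lam f z.1 z.2 +
      partialInvFourier lam g z.1 z.2 = partialInvFourier lam (f + g) z.1 z.2 := by
  have h1 := ((measurePreserving_heisAssoc n).integrable_comp_of_integrable
    (integrable_mul_cexp_heis hf lam)).prod_right_ae
  have h2 := ((measurePreserving_heisAssoc n).integrable_comp_of_integrable
    (integrable_mul_cexp_heis hg lam)).prod_right_ae
  filter_upwards [h1, h2] with z a b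
  simp only [partialInvFourier]
  refine (integral_add a b).symm.trans ?_
  simp only [Pi.add_apply, add_mul, Function.comp]

theorem spaceA_antitone {n : ℕ} {lam s t : ℝ} (hlam : lam ≠ 0) (hst : s ≤ t) :
    spaceA n lam t ⊆ spaceA n lam s := by
  intro f hf
  rw [mem_spaceA_iff hlam] at hf ⊢
  obtain ⟨C, hC⟩ := hf
  refine ⟨max C 0, hC.mono ?_ (le_max_left _ _) (le_max_right _ _)⟩
  rcases lt_or_gt_of_ne hlam with h | h
  · exact div_le_div_of_nonpos_of_le h.le
      (tanh_strictMono.monotone (mul_le_mul_of_nonpos_right hst h.le))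
  · exact div_le_div_of_nonneg_right
      (tanh_strictMono.monotone (mul_le_mul_of_nonneg_right hst h.le)) h.le

/-- Holds for each single t; the union then needs only that the family is directed, and the
intersection needs nothing more. -/
theorem isConvAlgebra_spaceA {n : ℕ} {lam t : ℝ} (hlam : lam ≠ 0) (ht : 0 < t) :
    IsConvAlgebra (spaceA n lam t) := by
  have hp := tanh_div_pos hlam ht
  constructor
  · rw [mem_spaceA_iff hlam]
    refine ⟨0, GaussianPair.congr_ae (F := fun _ _ => 0) ⟨?_, ?_⟩ ?_⟩
    · exact Filter.Eventually.of_forall fun z => by simp [ft]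
    · exact Filter.Eventually.of_forall fun z => by simp [ft]
    · filter_upwards [partialInvFourier_congr_ae (Lp.coeFn_zero ℂ 1 (volume : Measure (Heis n))) lam]
        with z hz
      rw [hz]
      simp [partialInvFourier]
  · intro f hf g hg
    rw [mem_spaceA_iff hlam] at hf hg ⊢
    obtain ⟨C₁, h1⟩ := hf
    obtain ⟨C₂, h2⟩ := hg
    have hfi := L1.integrable_coeFn f
    have hgi := L1.integrable_coeFn g
    refine ⟨_, (h1.add (integrable_partialInvFourier hfi lam) (integrable_partialInvFourier hgi lam)
      h2).congr_ae ?_⟩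
    filter_upwards [partialInvFourier_congr_ae (Lp.coeFn_add f g) lam,
      partialInvFourier_add hfi hgi lam] with z a b
    rw [a, ← b]
  · intro c f hf
    rw [mem_spaceA_iff hlam] at hf ⊢
    obtain ⟨C, h⟩ := hf
    refine ⟨_, (h.const_mul c).congr_ae ?_⟩
    filter_upwards [partialInvFourier_congr_ae (Lp.coeFn_smul c f) lam] with z a
    rw [a]
    simp only [partialInvFourier, Pi.smul_apply, smul_eq_mul, mul_assoc, integral_const_mul]
  · intro f hf g hg
    rw [mem_spaceA_iff hlam] at hf hg ⊢
    obtain ⟨C₁, h1⟩ := hf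
    obtain ⟨C₂, h2⟩ := hg
    have hfi := L1.integrable_coeFn f
    have hgi := L1.integrable_coeFn g
    obtain ⟨C, hC⟩ := h1.twistedConv hlam hp (integrable_partialInvFourier hfi lam)
      (integrable_partialInvFourier hgi lam) h2
    refine ⟨C, hC.congr_ae ?_⟩
    have e := (integrable_convFun hfi hgi).coeFn_toL1
    filter_upwards [partialInvFourier_congr_ae e lam, partialInvFourier_convFun hfi hgi lam]
      with z a b
    rw [conv, a, b]

theorem isConvAlgebra_iUnion_spaceA {n : ℕ} {lam : ℝ} (hlam : lam ≠ 0) :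
    IsConvAlgebra (⋃ t ∈ Set.Ioi (0 : ℝ), spaceA n lam t) := by
  have key : ∀ f ∈ (⋃ t ∈ Set.Ioi (0 : ℝ), spaceA n lam t),
      ∀ g ∈ (⋃ t ∈ Set.Ioi (0 : ℝ), spaceA n lam t), ∃ t, 0 < t ∧ f ∈ spaceA n lam t ∧
        g ∈ spaceA n lam t := by
    intro f hf g hg
    simp only [Set.mem_iUnion, Set.mem_Ioi] at hf hg
    obtain ⟨s, hs, hf⟩ := hf
    obtain ⟨t, ht, hg⟩ := hg
    exact ⟨min s t, lt_min hs ht, spaceA_antitone hlam (min_le_left _ _) hf,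
      spaceA_antitone hlam (min_le_right _ _) hg⟩
  have hmem : ∀ {t f}, 0 < t → f ∈ spaceA n lam t →
      f ∈ (⋃ t ∈ Set.Ioi (0 : ℝ), spaceA n lam t) :=
    fun ht hf => Set.mem_biUnion (Set.mem_Ioi.2 ht) hf
  refine ⟨hmem one_pos (isConvAlgebra_spaceA hlam one_pos).zero_mem, ?_, ?_, ?_⟩
  · intro f hf g hg
    obtain ⟨t, ht, h1, h2⟩ := key f hf g hg
    exact hmem ht ((isConvAlgebra_spaceA hlam ht).add_mem f h1 g h2)
  · intro c f hf
    obtain ⟨t, ht, h1, _⟩ := key f hf f hf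
    exact hmem ht ((isConvAlgebra_spaceA hlam ht).smul_mem c f h1)
  · intro f hf g hg
    obtain ⟨t, ht, h1, h2⟩ := key f hf g hg
    exact hmem ht ((isConvAlgebra_spaceA hlam ht).conv_mem f h1 g h2)

theorem isConvAlgebra_iInter_spaceA {n : ℕ} {lam : ℝ} (hlam : lam ≠ 0) :
    IsConvAlgebra (⋂ t ∈ Set.Ioi (0 : ℝ), spaceA n lam t) := by
  simp only [Set.mem_Ioi]
  constructor
  · exact Set.mem_iInter₂.2 fun t ht => (isConvAlgebra_spaceA hlam ht).zero_mem
  · exact fun f hf g hg => Set.mem_iInter₂.2 fun t ht => (isConvAlgebra_spaceA hlam ht).add_mem f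
      (Set.mem_iInter₂.1 hf t ht) g (Set.mem_iInter₂.1 hg t ht)
  · exact fun c f hf => Set.mem_iInter₂.2 fun t ht => (isConvAlgebra_spaceA hlam ht).smul_mem c f
      (Set.mem_iInter₂.1 hf t ht)
  · exact fun f hf g hg => Set.mem_iInter₂.2 fun t ht => (isConvAlgebra_spaceA hlam ht).conv_mem f
      (Set.mem_iInter₂.1 hf t ht) g (Set.mem_iInter₂.1 hg t ht)

/-! ### The integrated Schrödinger representation -/

/-- In a separable space open sets are countable unions of balls. It gives the measurability of p ↦
π_λ(p)φ, where distances in L² are parametric integrals, without proving strong continuity. -/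
theorem measurable_of_measurable_dist {X Y : Type*} [MeasurableSpace X] [PseudoMetricSpace Y]
    [SecondCountableTopology Y] [MeasurableSpace Y] [BorelSpace Y] {f : X → Y}
    (h : ∀ y, Measurable fun x => dist (f x) y) : Measurable f := by
  refine measurable_of_isOpen fun s hs => ?_
  choose! ε hε using Metric.isOpen_iff.1 hs
  obtain ⟨T, hT, hTs⟩ := TopologicalSpace.isOpen_iUnion_countable
    (fun y : s => Metric.ball (y : Y) (ε y)) fun _ => Metric.isOpen_ball
  have e : s = ⋃ y : s, Metric.ball (y : Y) (ε y) := by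
    refine Set.Subset.antisymm (fun y hy => ?_) (Set.iUnion_subset fun y => (hε y y.2).2)
    exact Set.mem_iUnion.2 ⟨⟨y, hy⟩, Metric.mem_ball_self (hε y hy).1⟩
  rw [e, ← hTs, Set.preimage_iUnion₂]
  exact MeasurableSet.biUnion hT fun y _ => measurableSet_lt (h y) measurable_const

/-! ### Isometry, measurability and continuity of the representation on L² -/

theorem norm_schrodingerFun {n : ℕ} (lam : ℝ) (p : Heis n) (φ : Rn n → ℂ) (ξ : Rn n) :
    ‖schrodingerFun lam p φ ξ‖ = ‖φ (ξ + p.2.1)‖ := by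
  simp only [schrodingerFun, norm_mul, norm_cexp_I_mul, one_mul]

theorem ae_schrodingerFun_congr {n : ℕ} {φ ψ : Rn n → ℂ} (h : φ =ᵐ[volume] ψ) (lam : ℝ)
    (p : Heis n) : schrodingerFun lam p φ =ᵐ[volume] schrodingerFun lam p ψ := by
  filter_upwards [(measurePreserving_add_right (volume : Measure (Rn n))
    p.2.1).quasiMeasurePreserving.ae h] with ξ hξ
  simp only [schrodingerFun, hξ]

theorem coeFn_schrodinger {n : ℕ} (lam : ℝ) (p : Heis n) (φ : L2Rn n) :
    schrodinger lam p φ =ᵐ[volume] schrodingerFun lam p φ :=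
  MemLp.coeFn_toLp _

theorem norm_schrodinger {n : ℕ} (lam : ℝ) (p : Heis n) (φ : L2Rn n) :
    ‖schrodinger lam p φ‖ = ‖φ‖ := by
  rw [schrodinger, Lp.norm_toLp, Lp.norm_def]
  congr 1
  rw [← eLpNorm_comp_measurePreserving (Lp.aestronglyMeasurable φ)
    (measurePreserving_add_right (volume : Measure (Rn n)) p.2.1)]
  exact eLpNorm_congr_norm_ae (Filter.Eventually.of_forall fun ξ => norm_schrodingerFun lam p φ ξ)

theorem schrodinger_sub {n : ℕ} (lam : ℝ) (p : Heis n) (φ ψ : L2Rn n) :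
    schrodinger lam p (φ - ψ) = schrodinger lam p φ - schrodinger lam p ψ := by
  apply Lp.ext
  filter_upwards [coeFn_schrodinger lam p (φ - ψ), coeFn_schrodinger lam p φ,
    coeFn_schrodinger lam p ψ, Lp.coeFn_sub (schrodinger lam p φ) (schrodinger lam p ψ),
    ae_schrodingerFun_congr (Lp.coeFn_sub φ ψ) lam p] with ξ h1 h2 h3 h4 h5
  rw [h1, h5, h4, Pi.sub_apply, h2, h3]
  simp only [schrodingerFun, Pi.sub_apply]
  ring

theorem measurable_schrodingerFun {n : ℕ} (lam : ℝ) {φ : Rn n → ℂ} (hφ : Measurable φ) :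
    Measurable fun z : Heis n × Rn n => schrodingerFun lam z.1 φ z.2 := by
  unfold schrodingerFun
  refine Measurable.mul (Continuous.measurable (by fun_prop)) (hφ.comp ?_)
  exact Continuous.measurable (by fun_prop)

theorem norm_sq_L2Rn {n : ℕ} (φ : L2Rn n) : ‖φ‖ ^ 2 = ∫ x, ‖φ x‖ ^ 2 := by
  have h : ((‖φ‖ ^ 2 : ℝ) : ℂ) = ((∫ x, ‖φ x‖ ^ 2 : ℝ) : ℂ) := by
    rw [← integral_complex_ofReal, ofReal_pow, ← coe_algebraMap, ← inner_self_eq_norm_sq_to_K,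
      L2.inner_def]
    refine integral_congr_ae (Filter.Eventually.of_forall fun x => ?_)
    simp only [inner_self_eq_norm_sq_to_K]
    push_cast
    rfl
  exact_mod_cast h

theorem stronglyMeasurable_schrodinger {n : ℕ} (lam : ℝ) (φ : L2Rn n) :
    StronglyMeasurable fun p : Heis n => schrodinger lam p φ := by
  have : Fact ((2 : ENNReal) ≠ ⊤) := ⟨ENNReal.ofNat_ne_top⟩
  borelize (L2Rn n)
  have hm : Measurable fun p : Heis n => schrodinger lam p φ := by
    refine measurable_of_measurable_dist fun c => ?_
    have e : ∀ p : Heis n, dist (schrodinger lam p φ) c =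
        Real.sqrt (∫ ξ, ‖schrodingerFun lam p φ ξ - c ξ‖ ^ 2) := by
      intro p
      rw [dist_eq_norm, ← Real.sqrt_sq (norm_nonneg _), norm_sq_L2Rn]
      congr 1
      refine integral_congr_ae ?_
      filter_upwards [Lp.coeFn_sub (schrodinger lam p φ) c, coeFn_schrodinger lam p φ] with ξ h1 h2
      rw [h1, Pi.sub_apply, h2]
    simp_rw [e]
    refine Measurable.sqrt (StronglyMeasurable.measurable ?_)
    refine StronglyMeasurable.integral_prod_right
      (f := fun (p : Heis n) ξ => ‖schrodingerFun lam p φ ξ - c ξ‖ ^ 2) ?_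
    refine Measurable.stronglyMeasurable ?_
    exact ((measurable_schrodingerFun lam (Lp.stronglyMeasurable φ).measurable).sub
      ((Lp.stronglyMeasurable c).measurable.comp measurable_snd)).norm.pow_const 2
  exact hm.stronglyMeasurable

theorem integrable_smul_schrodinger {n : ℕ} (lam : ℝ) {f : Heis n → ℂ} (hf : Integrable f)
    (φ : L2Rn n) : Integrable fun p => f p • schrodinger lam p φ := by
  refine (hf.norm.mul_const ‖φ‖).mono'
    (hf.1.smul (stronglyMeasurable_schrodinger lam φ).aestronglyMeasurable)
    (Filter.Eventually.of_forall fun p => ?_)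
  rw [norm_smul, norm_schrodinger]

/-- Lipschitz with constant ‖f‖₁, because each π_λ(p) is isometric. Allows estimates to be proved on
Schwartz vectors only. -/
theorem continuous_schrodingerInt {n : ℕ} (lam : ℝ) (f : L1Heis n) :
    Continuous (schrodingerInt lam f) := by
  have hf := L1.integrable_coeFn f
  refine (LipschitzWith.of_dist_le_mul (K := Real.toNNReal (∫ p, ‖f p‖)) fun φ ψ => ?_).continuous
  rw [Real.coe_toNNReal _ (by positivity), dist_eq_norm, dist_eq_norm, schrodingerInt,
    schrodingerInt, ← integral_sub (integrable_smul_schrodinger lam hf φ)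
      (integrable_smul_schrodinger lam hf ψ), ← integral_mul_const]
  refine norm_integral_le_of_norm_le (hf.norm.mul_const _)
    (Filter.Eventually.of_forall fun p => ?_)
  rw [← smul_sub, ← schrodinger_sub, norm_smul, norm_schrodinger]

/-! ### Hermite coefficients of π_λ(f)φ -/

theorem integrable_hermiteFunN {n : ℕ} {lam : ℝ} (hlam : lam ≠ 0) (α : Fin n → ℕ) :
    Integrable (hermiteFunN (n := n) lam α) := by
  have h := integrable_gaussian (n := n) (a := (1 / (2 * (1 + 1)) * |lam|))
    (by have := abs_pos.2 hlam; positivity)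
  refine (h.const_mul _).mono' (continuous_hermiteFunN lam α).aestronglyMeasurable
    (Filter.Eventually.of_forall fun x => norm_hermiteFunN_le one_pos α x)

/-- The operator with Weyl symbol data `F`, applied to `ψ`. -/
def weylFun {n : ℕ} (lam : ℝ) (F : Rn n → Rn n → ℂ) (ψ : Rn n → ℂ) (ξ : Rn n) : ℂ :=
  ∫ z : Rn n × Rn n, F z.1 z.2 *
    (cexp (I * ((lam * (inner ℝ z.1 ξ + (1 / 2) * inner ℝ z.1 z.2) : ℝ) : ℂ)) * ψ (ξ + z.2))

theorem integral_mul_schrodingerFun {n : ℕ} (lam : ℝ) {f : Heis n → ℂ} (hf : Integrable f)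
    {ψ : Rn n → ℂ} {M : ℝ} (hψ : Continuous ψ) (hM : ∀ x, ‖ψ x‖ ≤ M) (ξ : Rn n) :
    ∫ p, f p * schrodingerFun lam p ψ ξ = weylFun lam (partialInvFourier lam f) ψ ξ := by
  have hi : Integrable fun p => f p * schrodingerFun lam p ψ ξ := by
    refine hf.mul_bdd (c := M) (Continuous.aestronglyMeasurable ?_)
      (Filter.Eventually.of_forall fun p => (norm_schrodingerFun _ _ _ _).trans_le (hM _))
    unfold schrodingerFun
    fun_prop
  rw [← (measurePreserving_heisAssoc n).integral_comp (measurableEmbedding_heisAssoc n)]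
  refine (integral_prod _
    ((measurePreserving_heisAssoc n).integrable_comp_of_integrable hi)).trans ?_
  refine integral_congr_ae (Filter.Eventually.of_forall fun z => ?_)
  simp only [partialInvFourier, schrodingerFun]
  rw [← integral_mul_const]
  refine integral_congr_ae (Filter.Eventually.of_forall fun t => ?_)
  simp only [Function.comp]
  ring

/-- Fubini after moving the inner product inside the Bochner integral. The vector π_λ(f)φ is
accessed only through its Hermite coefficients, so its pointwise values need not be identified. -/
theorem inner_hermiteL2_schrodingerInt {n : ℕ} {lam : ℝ} (hlam : lam ≠ 0) (f : L1Heis n)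
    (φ : L2Rn n) {ψ : Rn n → ℂ} {M : ℝ} (hψ : Continuous ψ) (hM : ∀ x, ‖ψ x‖ ≤ M)
    (hφψ : φ =ᵐ[volume] ψ) (α : Fin n → ℕ) :
    inner ℂ (hermiteL2 hlam α) (schrodingerInt lam f φ) =
      ∫ ξ, weylFun lam (partialInvFourier lam f) ψ ξ * hermiteFunN lam α ξ := by
  have hf := L1.integrable_coeFn f
  have hcont : Continuous fun z : Heis n × Rn n => schrodingerFun lam z.1 ψ z.2 := by
    unfold schrodingerFun; fun_prop
  have hi : Integrable (fun z : Heis n × Rn n =>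
      f z.1 * hermiteFunN lam α z.2 * schrodingerFun lam z.1 ψ z.2) (volume.prod volume) :=
    (hf.mul_prod (integrable_hermiteFunN hlam α)).mul_bdd (c := M) hcont.aestronglyMeasurable
      (Filter.Eventually.of_forall fun z => (norm_schrodingerFun _ _ _ _).trans_le (hM _))
  rw [schrodingerInt, ← integral_inner (integrable_smul_schrodinger lam hf φ)]
  have e1 : ∀ p : Heis n, inner ℂ (hermiteL2 hlam α) (f p • schrodinger lam p φ) =
      ∫ ξ, f p * hermiteFunN lam α ξ * schrodingerFun lam p ψ ξ := by
    intro p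
    rw [inner_smul_right, inner_hermiteL2, ← integral_const_mul]
    refine integral_congr_ae ?_
    filter_upwards [coeFn_schrodinger lam p φ, ae_schrodingerFun_congr hφψ lam p] with ξ h1 h2
    rw [h1, h2]; ring
  simp_rw [e1]
  rw [integral_integral_swap hi]
  refine integral_congr_ae (Filter.Eventually.of_forall fun ξ => ?_)
  simp only
  rw [← integral_mul_schrodingerFun lam hf hψ hM ξ, ← integral_mul_const]
  refine integral_congr_ae (Filter.Eventually.of_forall fun p => ?_)
  simp only
  ring

/-! ### Gaussian bounds for the image of the representation -/

/-- Integrating in x first exhibits the integral kernel of the operator as the transform of F in its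
first variable. -/
theorem weylFun_eq_integral_ft {n : ℕ} (lam : ℝ) {F : Rn n → Rn n → ℂ}
    (hF : Integrable fun z : Rn n × Rn n => F z.1 z.2) {ψ : Rn n → ℂ} {M : ℝ}
    (hψ : Continuous ψ) (hM : ∀ x, ‖ψ x‖ ≤ M) (ξ : Rn n) :
    weylFun lam F ψ ξ =
      ∫ u, ψ (ξ + u) * ft (fun y => F y u) (-(lam • (ξ + (1 / 2 : ℝ) • u))) := by
  have hi : Integrable (fun z : Rn n × Rn n => F z.1 z.2 *
      (cexp (I * ((lam * (inner ℝ z.1 ξ + (1 / 2) * inner ℝ z.1 z.2) : ℝ) : ℂ)) * ψ (ξ + z.2)))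
      (volume.prod volume) := by
    refine hF.mul_bdd (c := M) (Continuous.aestronglyMeasurable (by fun_prop))
      (Filter.Eventually.of_forall fun z => ?_)
    rw [norm_mul, norm_cexp_I_mul, one_mul]
    exact hM _
  refine (integral_prod_symm _ hi).trans ?_
  refine integral_congr_ae (Filter.Eventually.of_forall fun u => ?_)
  simp only [ft]
  rw [← integral_const_mul]
  refine integral_congr_ae (Filter.Eventually.of_forall fun x => ?_)
  simp only
  have e : I * ((lam * (inner ℝ x ξ + (1 / 2) * inner ℝ x u) : ℝ) : ℂ) =
      -(I * ((inner ℝ (-(lam • (ξ + (1 / 2 : ℝ) • u))) x : ℝ) : ℂ)) := by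
    rw [inner_neg_left, real_inner_smul_left, inner_add_left, real_inner_smul_left,
      real_inner_comm ξ x, real_inner_comm u x]
    push_cast; ring
  rw [e]; ring

theorem integral_mul_cexp_add_right {n : ℕ} (ψ : Rn n → ℂ) (p u : Rn n) :
    ∫ ξ, ψ (ξ + u) * cexp (-(I * ((inner ℝ p ξ : ℝ) : ℂ))) =
      cexp (I * ((inner ℝ p u : ℝ) : ℂ)) * ft ψ p := by
  rw [ft, ← integral_add_right_eq_self (fun ξ => ψ ξ * cexp (-(I * ((inner ℝ p ξ : ℝ) : ℂ)))) u,
    ← integral_const_mul]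
  refine integral_congr_ae (Filter.Eventually.of_forall fun ξ => ?_)
  have e : cexp (-(I * ((inner ℝ p ξ : ℝ) : ℂ))) = cexp (I * ((inner ℝ p u : ℝ) : ℂ)) *
      cexp (-(I * ((inner ℝ p (ξ + u) : ℝ) : ℂ))) := by
    rw [← Complex.exp_add, inner_add_right]; congr 1; push_cast; ring
  simp only [e]; ring

/-- The counterpart on the Fourier side, where the kernel is the transform of F in its second
variable. The two bounds in 𝒜_t thus control space and frequency decay respectively. -/
theorem ft_weylFun {n : ℕ} (lam : ℝ) {F : Rn n → Rn n → ℂ}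
    (hF : Integrable fun z : Rn n × Rn n => F z.1 z.2) {ψ : Rn n → ℂ}
    (hψi : Integrable ψ) (q : Rn n) :
    ft (weylFun lam F ψ) q =
      ∫ x, ft ψ (q - lam • x) * ft (F x) ((lam / 2) • x - q) := by
  set H : Rn n × (Rn n × Rn n) → ℂ := fun w => F w.2.1 w.2.2 *
    (cexp (I * ((lam * (inner ℝ w.2.1 w.1 + (1 / 2) * inner ℝ w.2.1 w.2.2) : ℝ) : ℂ)) *
      ψ (w.1 + w.2.2)) * cexp (-(I * ((inner ℝ q w.1 : ℝ) : ℂ))) with hH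
  have hmp : MeasurePreserving (fun w : (Rn n × Rn n) × Rn n => (w.1, w.2 + w.1.2))
      (volume.prod volume) (volume.prod volume) := by
    refine MeasurePreserving.skew_product (f := fun z : Rn n × Rn n => z)
      (g := fun z ξ => ξ + z.2) (MeasurePreserving.id _) (by fun_prop) ?_
    exact Filter.Eventually.of_forall fun z => (measurePreserving_add_right volume z.2).map_eq
  have hHi : Integrable H (volume.prod volume) := by
    have h0 : Integrable (fun w : Rn n × (Rn n × Rn n) => F w.2.1 w.2.2 * ψ (w.1 + w.2.2))
        (volume.prod volume) :=
      (hmp.integrable_comp_of_integrable (hF.mul_prod hψi)).swap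
    have h1 := h0.mul_bdd (c := 1) (g := fun w : Rn n × (Rn n × Rn n) =>
      cexp (I * ((lam * (inner ℝ w.2.1 w.1 + (1 / 2) * inner ℝ w.2.1 w.2.2) : ℝ) : ℂ)) *
        cexp (-(I * ((inner ℝ q w.1 : ℝ) : ℂ))))
      (Continuous.aestronglyMeasurable (by fun_prop))
      (Filter.Eventually.of_forall fun w => by
        rw [norm_mul, norm_cexp_I_mul, norm_cexp_neg_I_mul, one_mul])
    refine h1.congr (Filter.Eventually.of_forall fun w => ?_)
    simp only [hH]; ring
  have e1 : ft (weylFun lam F ψ) q = ∫ ξ, ∫ z, H (ξ, z) := by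
    simp only [ft, weylFun, hH]
    refine integral_congr_ae (Filter.Eventually.of_forall fun ξ => ?_)
    simp only
    rw [← integral_mul_const]
  have e2 : ∀ z : Rn n × Rn n, ∫ ξ, H (ξ, z) = F z.1 z.2 *
      (ft ψ (q - lam • z.1) * cexp (-(I * ((inner ℝ ((lam / 2) • z.1 - q) z.2 : ℝ) : ℂ)))) := by
    intro z
    have e3 : ∀ ξ, H (ξ, z) = F z.1 z.2 *
        cexp (I * ((lam / 2 * inner ℝ z.1 z.2 : ℝ) : ℂ)) *
          (ψ (ξ + z.2) * cexp (-(I * ((inner ℝ (q - lam • z.1) ξ : ℝ) : ℂ)))) := by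
      intro ξ
      have e4 : cexp (I * ((lam * (inner ℝ z.1 ξ + (1 / 2) * inner ℝ z.1 z.2) : ℝ) : ℂ)) *
          cexp (-(I * ((inner ℝ q ξ : ℝ) : ℂ))) =
          cexp (I * ((lam / 2 * inner ℝ z.1 z.2 : ℝ) : ℂ)) *
            cexp (-(I * ((inner ℝ (q - lam • z.1) ξ : ℝ) : ℂ))) := by
        rw [← Complex.exp_add, ← Complex.exp_add, inner_sub_left, real_inner_smul_left]
        congr 1; push_cast; ring
      simp only [hH]
      linear_combination (F z.1 z.2 * ψ (ξ + z.2)) * e4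
    simp_rw [e3]
    rw [integral_const_mul, integral_mul_cexp_add_right]
    have e5 : cexp (I * ((lam / 2 * inner ℝ z.1 z.2 : ℝ) : ℂ)) *
        cexp (I * ((inner ℝ (q - lam • z.1) z.2 : ℝ) : ℂ)) =
        cexp (-(I * ((inner ℝ ((lam / 2) • z.1 - q) z.2 : ℝ) : ℂ))) := by
      rw [← Complex.exp_add, inner_sub_left, inner_sub_left, real_inner_smul_left,
        real_inner_smul_left]
      congr 1; push_cast; ring
    linear_combination (F z.1 z.2 * ft ψ (q - lam • z.1)) * e5
  rw [e1, integral_integral_swap hHi]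
  have h4 := hHi.integral_prod_right
  simp_rw [e2] at h4 ⊢
  refine (integral_prod _ h4).trans ?_
  refine integral_congr_ae (Filter.Eventually.of_forall fun x => ?_)
  simp only
  rw [ft, ft, ← integral_const_mul]
  refine integral_congr_ae (Filter.Eventually.of_forall fun u => ?_)
  simp only
  ring

/-- By the identity |ξ+u/2|² + |u|²/4 = (|ξ|² + |ξ+u|²)/2 the Gaussian bound on the kernel splits
into a Gaussian in the output point and one in the input point. -/
theorem norm_weylFun_le {n : ℕ} {lam p C : ℝ} (hlam : lam ≠ 0) {F : Rn n → Rn n → ℂ}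
    (hF : Integrable fun z : Rn n × Rn n => F z.1 z.2) (hp : GaussianPair lam p C F)
    {ψ : Rn n → ℂ} (hψ : Continuous ψ) {M : ℝ} (hM : ∀ x, ‖ψ x‖ ≤ M)
    (hψi : Integrable fun x => ‖ψ x‖ * Real.exp (-(p * lam ^ 2 / 2) * ‖x‖ ^ 2)) :
    ∀ᵐ ξ, ‖weylFun lam F ψ ξ‖ ≤
      (C * ∫ x, ‖ψ x‖ * Real.exp (-(p * lam ^ 2 / 2) * ‖x‖ ^ 2)) *
        Real.exp (-(p * lam ^ 2 / 2) * ‖ξ‖ ^ 2) := by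
  set L : Rn n × Rn n →ₗ[ℝ] Rn n × Rn n :=
    ((-lam) • (LinearMap.fst ℝ (Rn n) (Rn n) + (1 / 2 : ℝ) • LinearMap.snd ℝ (Rn n) (Rn n))).prod
      (LinearMap.snd ℝ (Rn n) (Rn n)) with hL
  have hLs : Function.Surjective L := by
    rintro ⟨w, u⟩
    refine ⟨((-lam)⁻¹ • w - (1 / 2 : ℝ) • u, u), ?_⟩
    simp only [hL, LinearMap.prod_apply, Function.prod_apply, LinearMap.smul_apply,
      LinearMap.add_apply, LinearMap.fst_apply, LinearMap.snd_apply, sub_add_cancel]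
    rw [smul_smul, mul_inv_cancel₀ (neg_ne_zero.2 hlam), one_smul]
  filter_upwards [Measure.ae_ae_of_ae_prod (ae_comp_of_surjective hLs hp.1)] with ξ hξ
  rw [weylFun_eq_integral_ft lam hF hψ hM]
  have hs := (hψi.comp_add_left ξ)
  rw [← integral_add_left_eq_self
    (fun x => ‖ψ x‖ * Real.exp (-(p * lam ^ 2 / 2) * ‖x‖ ^ 2)) ξ, mul_right_comm, ← integral_const_mul]
  refine norm_integral_le_of_norm_le (hs.const_mul _) ?_
  filter_upwards [hξ] with u hu
  simp only [hL, LinearMap.prod_apply, Function.prod_apply, LinearMap.smul_apply,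
      LinearMap.add_apply, LinearMap.fst_apply, LinearMap.snd_apply, neg_smul,
      LinearMap.neg_apply] at hu
  rw [norm_mul]
  have hn : ‖ξ + (1 / 2 : ℝ) • u‖ ^ 2 + ‖u‖ ^ 2 / 4 = (‖ξ‖ ^ 2 + ‖ξ + u‖ ^ 2) / 2 := by
    rw [norm_add_sq_real, norm_add_sq_real, norm_smul, real_inner_smul_right, mul_pow]
    norm_num; ring
  have he : Real.exp (-(p * ‖-(lam • (ξ + (1 / 2 : ℝ) • u))‖ ^ 2 + p * lam ^ 2 / 4 * ‖u‖ ^ 2)) =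
      Real.exp (-(p * lam ^ 2 / 2) * ‖ξ‖ ^ 2) * Real.exp (-(p * lam ^ 2 / 2) * ‖ξ + u‖ ^ 2) := by
    rw [← Real.exp_add, norm_neg, norm_smul, mul_pow, Real.norm_eq_abs, sq_abs]
    congr 1
    linear_combination (-(p * lam ^ 2)) * hn
  rw [he] at hu
  calc _ ≤ ‖ψ (ξ + u)‖ * _ := mul_le_mul_of_nonneg_left hu (norm_nonneg _)
    _ = _ := by ring

/-- The same splitting in frequency, from |λx/2 - q|² + λ²|x|²/4 = (|q|² + |q-λx|²)/2. -/
theorem norm_ft_weylFun_le {n : ℕ} {lam p C : ℝ} (hlam : lam ≠ 0) {F : Rn n → Rn n → ℂ}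
    (hF : Integrable fun z : Rn n × Rn n => F z.1 z.2) (hp : GaussianPair lam p C F)
    {ψ : Rn n → ℂ} (hψi : Integrable ψ)
    (hψf : Integrable fun x => ‖ft ψ x‖ * Real.exp (-(p / 2) * ‖x‖ ^ 2)) :
    ∀ᵐ q, ‖ft (weylFun lam F ψ) q‖ ≤
      (C * (|lam| ^ n)⁻¹ * ∫ x, ‖ft ψ x‖ * Real.exp (-(p / 2) * ‖x‖ ^ 2)) *
        Real.exp (-(p / 2) * ‖q‖ ^ 2) := by
  set L : Rn n × Rn n →ₗ[ℝ] Rn n × Rn n :=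
    ((lam / 2) • LinearMap.snd ℝ (Rn n) (Rn n) - LinearMap.fst ℝ (Rn n) (Rn n)).prod
      (LinearMap.snd ℝ (Rn n) (Rn n)) with hL
  have hLs : Function.Surjective L := by
    rintro ⟨w, u⟩
    refine ⟨((lam / 2) • u - w, u), ?_⟩
    simp [hL]
  filter_upwards [Measure.ae_ae_of_ae_prod (ae_comp_of_surjective hLs hp.2)] with q hq
  rw [ft_weylFun lam hF hψi]
  have hs : Integrable fun x : Rn n => ‖ft ψ (q - lam • x)‖ *
      Real.exp (-(p / 2) * ‖q - lam • x‖ ^ 2) :=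
    (hψf.comp_sub_left q).comp_smul hlam
  have e : ∫ x : Rn n, ‖ft ψ (q - lam • x)‖ * Real.exp (-(p / 2) * ‖q - lam • x‖ ^ 2) =
      (|lam| ^ n)⁻¹ * ∫ x, ‖ft ψ x‖ * Real.exp (-(p / 2) * ‖x‖ ^ 2) := by
    have := Measure.integral_comp_smul (volume : Measure (Rn n))
      (fun x => ‖ft ψ (q - x)‖ * Real.exp (-(p / 2) * ‖q - x‖ ^ 2)) lam
    rw [this, integral_sub_left_eq_self
      (fun x => ‖ft ψ x‖ * Real.exp (-(p / 2) * ‖x‖ ^ 2)) volume q, finrank_euclideanSpace_fin]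
    simp [abs_inv, abs_pow]
  rw [mul_assoc C, ← e, mul_right_comm, ← integral_const_mul]
  refine norm_integral_le_of_norm_le (hs.const_mul _) ?_
  filter_upwards [hq] with x hx
  simp only [hL, LinearMap.prod_apply, Function.prod_apply, LinearMap.smul_apply,
      LinearMap.sub_apply, LinearMap.fst_apply, LinearMap.snd_apply] at hx
  rw [norm_mul]
  have hn : ‖(lam / 2) • x - q‖ ^ 2 + lam ^ 2 / 4 * ‖x‖ ^ 2 =
      (‖q‖ ^ 2 + ‖q - lam • x‖ ^ 2) / 2 := by
    rw [norm_sub_sq_real, norm_sub_sq_real, norm_smul, norm_smul, real_inner_smul_left,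
      real_inner_smul_right, mul_pow, mul_pow, Real.norm_eq_abs, Real.norm_eq_abs, sq_abs, sq_abs,
      real_inner_comm]
    ring
  have he : Real.exp (-(p * ‖(lam / 2) • x - q‖ ^ 2 + p * lam ^ 2 / 4 * ‖x‖ ^ 2)) =
      Real.exp (-(p / 2) * ‖q‖ ^ 2) * Real.exp (-(p / 2) * ‖q - lam • x‖ ^ 2) := by
    rw [← Real.exp_add]
    congr 1
    linear_combination (-p) * hn
  rw [he] at hx
  calc _ ≤ ‖ft ψ (q - lam • x)‖ * _ := mul_le_mul_of_nonneg_left hx (norm_nonneg _)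
    _ = _ := by ring

/-! ### From Schwartz vectors to all of L² -/

open scoped SchwartzMap FourierTransform in
-- Cauchy–Schwarz. A bound by the L² norm alone is what passes to limits of Schwartz functions.
theorem exists_integral_schwartz_mul_gaussian_le (n : ℕ) {b : ℝ} (hb : 0 < b) :
    ∃ K, 0 ≤ K ∧ ∀ ψ : 𝓢(Rn n, ℂ),
      ∫ x, ‖ψ x‖ * Real.exp (-b * ‖x‖ ^ 2) ≤ K * ‖ψ.toLp 2‖ := by
  refine ⟨(∫ x : Rn n, Real.exp (-b * ‖x‖ ^ 2) ^ (2 : ℝ)) ^ (1 / 2 : ℝ), by positivity,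
    fun ψ => ?_⟩
  have h2 : ENNReal.ofReal 2 = 2 := by simp
  have h := integral_mul_le_Lp_mul_Lq_of_nonneg (μ := (volume : Measure (Rn n)))
    Real.HolderConjugate.two_two (f := fun x => ‖ψ x‖) (g := fun x => Real.exp (-b * ‖x‖ ^ 2))
    (Filter.Eventually.of_forall fun x => norm_nonneg _)
    (Filter.Eventually.of_forall fun x => (Real.exp_pos _).le)
    (by rw [h2]; exact (ψ.memLp 2 volume).norm) (by rw [h2]; exact memLp_two_gaussian hb)
  rw [SchwartzMap.norm_toLp' (by simp) (by simp), mul_comm]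
  simpa using h

theorem integrable_norm_mul_gaussian {n : ℕ} {g : Rn n → ℂ} (hg : MemLp g 2) {b : ℝ} (hb : 0 < b) :
    Integrable fun x => ‖g x‖ * Real.exp (-b * ‖x‖ ^ 2) := by
  refine (integrable_mul_gaussian hg hb).norm.congr (Filter.Eventually.of_forall fun x => ?_)
  simp only [norm_mul, norm_real, Real.norm_eq_abs, Real.abs_exp]

open scoped SchwartzMap FourierTransform in
-- The previous estimate for the Fourier transform, brought back to ψ by Plancherel.
theorem exists_integral_ft_schwartz_mul_gaussian_le (n : ℕ) {b : ℝ} (hb : 0 < b) :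
    ∃ K, 0 ≤ K ∧ ∀ ψ : 𝓢(Rn n, ℂ),
      Integrable (fun x => ‖ft ψ x‖ * Real.exp (-b * ‖x‖ ^ 2)) ∧
      ∫ x, ‖ft ψ x‖ * Real.exp (-b * ‖x‖ ^ 2) ≤ K * ‖ψ.toLp 2‖ := by
  have hπ : (0 : ℝ) < 2 * Real.pi := by positivity
  have hb' : 0 < b * (2 * Real.pi) ^ 2 := by positivity
  obtain ⟨K, hK, h⟩ := exists_integral_schwartz_mul_gaussian_le n hb'
  refine ⟨|((2 * Real.pi)⁻¹ ^ n)⁻¹| * K, by positivity, fun ψ => ?_⟩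
  have e : (fun x => ‖ft ψ x‖ * Real.exp (-b * ‖x‖ ^ 2)) = fun x : Rn n =>
      (fun y => ‖(𝓕 ψ) y‖ * Real.exp (-(b * (2 * Real.pi) ^ 2) * ‖y‖ ^ 2))
        ((2 * Real.pi)⁻¹ • x) := by
    funext x
    simp only [SchwartzMap.fourier_coe, ft_eq_fourier]
    congr 2
    rw [norm_smul, Real.norm_of_nonneg (by positivity)]
    field_simp
  rw [e]
  refine ⟨(integrable_norm_mul_gaussian ((𝓕 ψ).memLp 2 volume) hb').comp_smul
    (inv_ne_zero hπ.ne'), ?_⟩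
  refine (Measure.integral_comp_smul (volume : Measure (Rn n))
    (fun y => ‖(𝓕 ψ) y‖ * Real.exp (-(b * (2 * Real.pi) ^ 2) * ‖y‖ ^ 2)) _).trans_le ?_
  rw [finrank_euclideanSpace_fin, smul_eq_mul, mul_assoc,
    ← SchwartzMap.norm_fourier_toL2_eq ψ]
  exact mul_le_mul_of_nonneg_left (h _) (abs_nonneg _)

theorem aestronglyMeasurable_weylFun {n : ℕ} (lam : ℝ) {F : Rn n → Rn n → ℂ}
    (hF : AEStronglyMeasurable fun z : Rn n × Rn n => F z.1 z.2) {ψ : Rn n → ℂ}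
    (hψ : Continuous ψ) : AEStronglyMeasurable (weylFun lam F ψ) := by
  unfold weylFun
  refine AEStronglyMeasurable.integral_prod_right' (f := fun w : Rn n × (Rn n × Rn n) =>
    F w.2.1 w.2.2 * (cexp (I * ((lam * (inner ℝ w.2.1 w.1 + (1 / 2) * inner ℝ w.2.1 w.2.2) : ℝ) :
      ℂ)) * ψ (w.1 + w.2.2))) ?_
  exact hF.comp_snd.mul (Continuous.aestronglyMeasurable (by fun_prop))

theorem tanh_mul_div (lam t : ℝ) :
    Real.tanh (t * lam) / lam = Real.tanh (t * |lam|) / |lam| := by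
  rcases abs_choice lam with h | h <;> rw [h]
  rw [mul_neg, Real.tanh_neg, neg_div_neg_eq]

/-- For Schwartz φ the output decays in space and frequency at the scaled rate a = τ/2, which makes
(1-2a)/(1+2a) = (1-τ)/(1+τ). Both sides are continuous in φ, so the estimate extends by density; for
this D must not depend on φ. -/
theorem norm_inner_schrodingerInt_le {n : ℕ} {lam t : ℝ} (hlam : lam ≠ 0) (ht : 0 < t)
    {f : L1Heis n} (hf : f ∈ spaceA n lam t) : ∃ D, 0 ≤ D ∧ ∀ δ, 0 < δ →
      GaussianInterpolation ((1 - Real.tanh (t * |lam|)) / (1 + Real.tanh (t * |lam|))) δ →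
      ∀ φ α j, ‖inner ℂ (hermiteL2 hlam α) (schrodingerInt lam f φ)‖ ≤
        D * ‖φ‖ * (α j + 1) * Real.sqrt δ ^ α j := by
  have hl : 0 < |lam| := abs_pos.2 hlam
  have hp := tanh_div_pos hlam ht
  obtain ⟨C₀, hC₀⟩ := (mem_spaceA_iff hlam).1 hf
  have hC := hC₀.mono le_rfl (le_max_left C₀ 0) (le_max_right C₀ 0)
  set C := max C₀ 0
  have hC0 : 0 ≤ C := le_max_right _ _
  rw [tanh_mul_div] at hC hp
  set τ := Real.tanh (t * |lam|)
  have hτ : 0 < τ := by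
    have := mul_pos hp hl
    rwa [div_mul_cancel₀ _ hl.ne'] at this
  have hFi := integrable_partialInvFourier (L1.integrable_coeFn f) lam
  set F := partialInvFourier lam f
  have e1 : τ / |lam| * lam ^ 2 / 2 = τ / 2 * |lam| := by
    rw [← sq_abs]; field_simp
  have e2 : τ / |lam| / 2 = τ / 2 / |lam| := by ring
  have hb1 : 0 < τ / 2 * |lam| := by positivity
  have hb2 : 0 < τ / 2 / |lam| := by positivity
  obtain ⟨K₁, hK₁, h₁⟩ := exists_integral_schwartz_mul_gaussian_le n hb1
  obtain ⟨K₂, hK₂, h₂⟩ := exists_integral_ft_schwartz_mul_gaussian_le n hb2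
  obtain ⟨D, hD, h⟩ := norm_scaled_hermite_coeff_le n hlam (a := τ / 2) (by positivity)
  set B := C * K₁ + C * (|lam| ^ n)⁻¹ * K₂ with hB
  have hB1 : 0 ≤ C * K₁ := by positivity
  have hB2 : 0 ≤ C * (|lam| ^ n)⁻¹ * K₂ := by positivity
  have hB0 : 0 ≤ B := by positivity
  refine ⟨B * D, by positivity, fun δ hδ hG φ α j => ?_⟩
  have e3 : 2 * (τ / 2) = τ := by ring
  rw [e3] at h
  refine (SchwartzMap.denseRange_toLpCLM (E := Rn n) (F := ℂ) (p := 2) (μ := volume)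
    ENNReal.ofNat_ne_top).induction_on φ ?_ fun ψ => ?_
  · refine isClosed_le ?_ (by fun_prop)
    exact (continuous_const.inner (continuous_schrodingerInt lam f)).norm
  rw [SchwartzMap.toLpCLM_apply]
  obtain ⟨M, hM⟩ : ∃ M, ∀ x, ‖ψ x‖ ≤ M :=
    ⟨_, fun x => SchwartzMap.norm_le_seminorm ℝ ψ x⟩
  rw [inner_hermiteL2_schrodingerInt hlam f _ ψ.continuous hM (ψ.coeFn_toLp 2 volume)]
  have hψn := norm_nonneg (ψ.toLp 2 (volume : Measure (Rn n)))
  have b1 := norm_weylFun_le hlam hFi hC ψ.continuous hM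
    (by rw [e1]; exact integrable_norm_mul_gaussian (ψ.memLp 2 volume) hb1)
  have b2 := norm_ft_weylFun_le hlam hFi hC ψ.integrable (by rw [e2]; exact (h₂ ψ).1)
  rw [e1] at b1
  rw [e2] at b2
  have hfin := h δ hδ hG (weylFun lam F ψ) (B * ‖ψ.toLp 2 (volume : Measure (Rn n))‖)
    (by positivity) (aestronglyMeasurable_weylFun lam hFi.1 ψ.continuous) ?_ ?_ α j
  · calc _ ≤ _ := hfin
      _ = _ := by ring
  · filter_upwards [b1] with x hx
    refine hx.trans (mul_le_mul_of_nonneg_right ?_ (Real.exp_pos _).le)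
    calc _ ≤ C * (K₁ * ‖ψ.toLp 2 (volume : Measure (Rn n))‖) := 
          mul_le_mul_of_nonneg_left (h₁ ψ) hC0
      _ ≤ _ := by rw [hB, add_mul]; nlinarith [mul_nonneg hB2 hψn]
  · filter_upwards [b2] with x hx
    refine hx.trans (mul_le_mul_of_nonneg_right ?_ (Real.exp_pos _).le)
    calc _ ≤ C * (|lam| ^ n)⁻¹ * (K₂ * ‖ψ.toLp 2 (volume : Measure (Rn n))‖) := 
          mul_le_mul_of_nonneg_left (h₂ ψ).2 (by positivity)
      _ ≤ _ := by rw [hB, add_mul]; nlinarith [mul_nonneg hB1 hψn]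

theorem schrodingerInt_mem_iUnion {n : ℕ} {lam t : ℝ} (hlam : lam ≠ 0) (ht : 0 < t)
    {f : L1Heis n} (hf : f ∈ spaceA n lam t) (φ : L2Rn n) :
    ∃ s > 0, schrodingerInt lam f φ ∈ spaceE n hlam s := by
  obtain ⟨D, hD, h⟩ := norm_inner_schrodingerInt_le hlam ht hf
  have hl : 0 < |lam| := abs_pos.2 hlam
  set τ := Real.tanh (t * |lam|)
  have hτ : 0 < τ := by simpa using tanh_strictMono (mul_pos ht hl)
  have hτ1 : τ < 1 := Real.tanh_lt_one _
  set κ := (1 - τ) / (1 + τ) with hκ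
  have hκ0 : 0 < κ := div_pos (by linarith) (by linarith)
  have hκ1 : κ < 1 := by rw [hκ, div_lt_one (by linarith)]; linarith
  have hδ0 : 0 < (1 + κ) / 2 := by linarith
  have hδ1 : Real.sqrt ((1 + κ) / 2) < 1 := by
    rw [Real.sqrt_lt' one_pos]; linarith
  -- r is the n-th root of √δ; for n = 0 no coordinate exists and any r < 1 will do.
  obtain ⟨r, hr0, hr1, hr⟩ : ∃ r : ℝ, 0 ≤ r ∧ r < 1 ∧
      (n ≠ 0 → r ^ n = Real.sqrt ((1 + κ) / 2)) := by
    rcases eq_or_ne n 0 with hn | hn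
    · exact ⟨0, le_rfl, one_pos, fun h => absurd hn h⟩
    · refine ⟨Real.sqrt ((1 + κ) / 2) ^ (n⁻¹ : ℝ), by positivity, ?_, fun _ => ?_⟩
      · exact Real.rpow_lt_one (Real.sqrt_nonneg _) hδ1 (by positivity)
      · exact Real.rpow_inv_natCast_pow (Real.sqrt_nonneg _) hn
  obtain ⟨s, hs, hrs⟩ : ∃ s > 0, r * Real.exp (2 * s * |lam|) < 1 := by
    have hc : Filter.Tendsto (fun s : ℝ => r * Real.exp (2 * s * |lam|)) (nhds 0) (nhds r) := by
      have : Continuous fun s : ℝ => r * Real.exp (2 * s * |lam|) := by fun_prop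
      simpa using this.tendsto 0
    obtain ⟨s, h1, h2⟩ := (((hc.eventually_lt_const hr1).filter_mono
      nhdsWithin_le_nhds).and (self_mem_nhdsWithin (s := Set.Ioi (0 : ℝ)))).exists
    exact ⟨s, h2, h1⟩
  refine ⟨s, hs, mem_spaceE_of_bound hlam hs hr0 hrs (D := D * ‖φ‖) (by positivity)
    fun α j => ?_⟩
  rw [hr (Nat.pos_iff_ne_zero.1 (Fin.pos j))]
  exact h _ hδ0 (gaussianInterpolation_mean κ) φ α j

theorem schrodingerInt_mem_iInter {n : ℕ} {lam : ℝ} (hlam : lam ≠ 0) {f : L1Heis n}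
    (hf : ∀ t > 0, f ∈ spaceA n lam t) (φ : L2Rn n) {s : ℝ} (hs : 0 < s) :
    schrodingerInt lam f φ ∈ spaceE n hlam s := by
  have hl : 0 < |lam| := abs_pos.2 hlam
  -- With s prescribed, the choices run backwards: r makes r·e^{2s|λ|} = 1/2, then x is the target
  -- rate δ, ε is the angle with tan ε = δ, κ = sin²ε, and finally t satisfies (1-τ)/(1+τ) = κ.
  set r : ℝ := Real.exp (-(2 * s * |lam|)) / 2 with hr
  have hr0 : 0 < r := by positivity
  have hrs : r * Real.exp (2 * s * |lam|) < 1 := by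
    rw [hr, div_mul_eq_mul_div, ← Real.exp_add, neg_add_cancel, Real.exp_zero]; norm_num
  -- The first entry gives √δ ≤ r^n, the second forces ε < π/4.
  set x : ℝ := min ((r ^ n) ^ 2) (1 / 2) with hx
  have hx0 : 0 < x := by positivity
  have hx1 : x < 1 := (min_le_right _ _).trans_lt (by norm_num)
  set ε := Real.arctan x with hε
  have hε0 : 0 < ε := Real.arctan_pos.2 hx0
  have hε1 : ε < Real.pi / 4 := by
    rw [← Real.arctan_one]; exact Real.arctan_strictMono hx1
  have hπ := Real.pi_pos
  have hsin : 0 < Real.sin ε := Real.sin_pos_of_pos_of_lt_pi hε0 (by linarith)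
  have hcos : 0 < Real.cos ε := Real.cos_pos_of_mem_Ioo ⟨by linarith, by linarith⟩
  set κ := Real.sin ε ^ 2 with hκ
  have hκ0 : 0 < κ := by positivity
  have hκ1 : κ < 1 := by
    have := Real.sin_sq_add_cos_sq ε
    nlinarith
  set τ := (1 - κ) / (1 + κ) with hτ
  have hτ0 : 0 < τ := div_pos (by linarith) (by linarith)
  have hτ1 : τ < 1 := by rw [hτ, div_lt_one (by linarith)]; linarith
  set t := Real.artanh τ / |lam| with ht
  have ht0 : 0 < t := div_pos (Real.artanh_pos ⟨hτ0, hτ1⟩) hl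
  have htanh : Real.tanh (t * |lam|) = τ := by
    rw [ht, div_mul_cancel₀ _ hl.ne', Real.tanh_artanh ⟨by linarith, hτ1⟩]
  obtain ⟨D, hD, h⟩ := norm_inner_schrodingerInt_le hlam ht0 (hf t ht0)
  have hκτ : (1 - τ) / (1 + τ) = κ := by
    rw [hτ]; field_simp; ring
  rw [htanh, hκτ] at h
  have hG := gaussianInterpolation_sector hκ0.le hκ1.le hε0 hε1
  have hδ : (κ + Real.sin ε ^ 2) / Real.sin (2 * ε) = x := by
    rw [← Real.tan_arctan x, ← hε, Real.tan_eq_sin_div_cos, Real.sin_two_mul, hκ]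
    field_simp; ring
  rw [hδ] at hG
  refine mem_spaceE_of_bound hlam hs hr0.le hrs (D := D * ‖φ‖) (by positivity) fun α j => ?_
  refine (h x hx0 hG φ α j).trans ?_
  gcongr
  rw [Real.sqrt_le_left (by positivity)]
  exact min_le_left _ _

/-! ### Rank one operators -/

/-- Gaussian decay of a function and of its Fourier transform. -/
def GaussianDecay {n : ℕ} (lam p C : ℝ) (G : Rn n → ℂ) : Prop :=
  (∀ x, ‖G x‖ ≤ C * Real.exp (-(p * lam ^ 2 / 2) * ‖x‖ ^ 2)) ∧
    ∀ q, ‖ft G q‖ ≤ C * Real.exp (-(p / 2) * ‖q‖ ^ 2)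

/-- The product `G(m - u/2) Φ(m + u/2)`. -/
def crossProd {n : ℕ} (G Φ : Rn n → ℂ) (u m : Rn n) : ℂ :=
  G (m - (1 / 2 : ℝ) • u) * Φ (m + (1 / 2 : ℝ) • u)

/-- The Fourier–Wigner transform of `G` and `Φ`. -/
def wigner {n : ℕ} (lam : ℝ) (G Φ : Rn n → ℂ) (x u : Rn n) : ℂ :=
  ft (crossProd G Φ u) (lam • x)

theorem continuous_crossProd {n : ℕ} {G Φ : Rn n → ℂ} (hG : Continuous G) (hΦ : Continuous Φ) :
    Continuous fun z : Rn n × Rn n => crossProd G Φ z.1 z.2 := by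
  unfold crossProd
  fun_prop

/-- Parallelogram identity in the form |x-y|² + |x+y|² = 2|x|² + 2|y|². It serves both partial
transforms of the Fourier–Wigner transform. -/
theorem norm_mul_le_gaussian_parallelogram {n : ℕ} {C b : ℝ} {G Φ : Rn n → ℂ} (hC : 0 ≤ C)
    (hG : ∀ x, ‖G x‖ ≤ C * Real.exp (-b * ‖x‖ ^ 2))
    (hΦ : ∀ x, ‖Φ x‖ ≤ C * Real.exp (-b * ‖x‖ ^ 2)) (x y : Rn n) :
    ‖G (x - y)‖ * ‖Φ (x + y)‖ ≤
      C ^ 2 * (Real.exp (-(2 * b) * ‖x‖ ^ 2) * Real.exp (-(2 * b) * ‖y‖ ^ 2)) := by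
  refine (mul_le_mul (hG _) (hΦ _) (norm_nonneg _) (by positivity)).trans (le_of_eq ?_)
  rw [mul_mul_mul_comm, ← sq, ← Real.exp_add, ← Real.exp_add]
  congr 2
  rw [norm_add_sq_real, norm_sub_sq_real]
  ring

theorem norm_crossProd_le {n : ℕ} {C b : ℝ} {G Φ : Rn n → ℂ} (hC : 0 ≤ C)
    (hG : ∀ x, ‖G x‖ ≤ C * Real.exp (-b * ‖x‖ ^ 2))
    (hΦ : ∀ x, ‖Φ x‖ ≤ C * Real.exp (-b * ‖x‖ ^ 2)) (u m : Rn n) :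
    ‖crossProd G Φ u m‖ ≤
      C ^ 2 * (Real.exp (-(2 * b) * ‖m‖ ^ 2) * Real.exp (-(b / 2) * ‖u‖ ^ 2)) := by
  rw [crossProd, norm_mul]
  refine (norm_mul_le_gaussian_parallelogram hC hG hΦ m _).trans (le_of_eq ?_)
  rw [norm_smul, mul_pow]
  norm_num
  left; ring

theorem integrable_crossProd {n : ℕ} {C b : ℝ} (hb : 0 < b) {G Φ : Rn n → ℂ} (hC : 0 ≤ C)
    (hGc : Continuous G) (hΦc : Continuous Φ)
    (hG : ∀ x, ‖G x‖ ≤ C * Real.exp (-b * ‖x‖ ^ 2))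
    (hΦ : ∀ x, ‖Φ x‖ ≤ C * Real.exp (-b * ‖x‖ ^ 2)) (u : Rn n) :
    Integrable (crossProd G Φ u) := by
  refine (((integrable_gaussian (n := n) (a := 2 * b) (by positivity)).mul_const
    (Real.exp (-(b / 2) * ‖u‖ ^ 2))).const_mul (C ^ 2)).mono' ?_
    (Filter.Eventually.of_forall fun m => norm_crossProd_le hC hG hΦ u m)
  exact ((continuous_crossProd hGc hΦc).comp (by fun_prop :
    Continuous fun m => (u, m))).aestronglyMeasurable

theorem norm_wigner_le_snd {n : ℕ} {C b : ℝ} (lam : ℝ) (hb : 0 < b) {G Φ : Rn n → ℂ} (hC : 0 ≤ C)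
    (hG : ∀ x, ‖G x‖ ≤ C * Real.exp (-b * ‖x‖ ^ 2))
    (hΦ : ∀ x, ‖Φ x‖ ≤ C * Real.exp (-b * ‖x‖ ^ 2)) (x u : Rn n) :
    ‖wigner lam G Φ x u‖ ≤ C ^ 2 * (∫ m : Rn n, Real.exp (-(2 * b) * ‖m‖ ^ 2)) *
      Real.exp (-(b / 2) * ‖u‖ ^ 2) := by
  rw [mul_assoc, ← integral_mul_const, ← integral_const_mul]
  refine norm_integral_le_of_norm_le (((integrable_gaussian (n := n) (a := 2 * b)
    (by positivity)).mul_const _).const_mul _) (Filter.Eventually.of_forall fun m => ?_)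
  rw [norm_mul, norm_cexp_neg_I_mul, mul_one]
  exact norm_crossProd_le hC hG hΦ u m

theorem continuous_wigner {n : ℕ} {C b : ℝ} (lam : ℝ) (hb : 0 < b) {G Φ : Rn n → ℂ} (hC : 0 ≤ C)
    (hGc : Continuous G) (hΦc : Continuous Φ)
    (hG : ∀ x, ‖G x‖ ≤ C * Real.exp (-b * ‖x‖ ^ 2))
    (hΦ : ∀ x, ‖Φ x‖ ≤ C * Real.exp (-b * ‖x‖ ^ 2)) :
    Continuous fun z : Rn n × Rn n => wigner lam G Φ z.1 z.2 := by
  unfold wigner ft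
  refine continuous_of_dominated (bound := fun m => C ^ 2 * Real.exp (-(2 * b) * ‖m‖ ^ 2))
    (fun z => ?_) (fun z => Filter.Eventually.of_forall fun m => ?_)
    ((integrable_gaussian (n := n) (a := 2 * b) (by positivity)).const_mul _)
    (Filter.Eventually.of_forall fun m => ?_)
  · unfold crossProd
    exact Continuous.aestronglyMeasurable (by fun_prop)
  · rw [norm_mul, norm_cexp_neg_I_mul, mul_one]
    refine (norm_crossProd_le hC hG hΦ z.2 m).trans ?_
    refine mul_le_mul_of_nonneg_left (mul_le_of_le_one_right (Real.exp_pos _).le ?_) (by positivity)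
    rw [Real.exp_le_one_iff, neg_mul, neg_nonpos]
    positivity
  · unfold crossProd
    fun_prop

/-- In the variables m - u/2 and m + u/2 the double integral separates, and the character splits
accordingly. -/
theorem ft_wigner_snd {n : ℕ} {C b : ℝ} (lam : ℝ) (hb : 0 < b) {G Φ : Rn n → ℂ}
    (hGc : Continuous G) (hΦc : Continuous Φ)
    (hG : ∀ x, ‖G x‖ ≤ C * Real.exp (-b * ‖x‖ ^ 2))
    (hΦ : ∀ x, ‖Φ x‖ ≤ C * Real.exp (-b * ‖x‖ ^ 2)) (x w : Rn n) :
    ft (wigner lam G Φ x) w = ft G ((lam / 2) • x - w) * ft Φ ((lam / 2) • x + w) := by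
  set A : Rn n → ℂ := fun y => G y * cexp (-(I * ((inner ℝ ((lam / 2) • x - w) y : ℝ) : ℂ))) with hA
  set B : Rn n → ℂ := fun y => Φ y * cexp (-(I * ((inner ℝ ((lam / 2) • x + w) y : ℝ) : ℂ))) with hB
  have hAn : ∀ y, ‖A y‖ = ‖G y‖ := fun y => by
    simp only [hA]; rw [norm_mul, norm_cexp_neg_I_mul, mul_one]
  have hBn : ∀ y, ‖B y‖ = ‖Φ y‖ := fun y => by
    simp only [hB]; rw [norm_mul, norm_cexp_neg_I_mul, mul_one]
  have hAc : Continuous A := by fun_prop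
  have hBc : Continuous B := by fun_prop
  have hAi : Integrable A := ((integrable_gaussian (n := n) hb).const_mul C).mono'
    hAc.aestronglyMeasurable (Filter.Eventually.of_forall fun y => (hAn y).trans_le (hG y))
  have hBi : Integrable B := ((integrable_gaussian (n := n) hb).const_mul C).mono'
    hBc.aestronglyMeasurable (Filter.Eventually.of_forall fun y => (hBn y).trans_le (hΦ y))
  have hmp : MeasurePreserving (fun z : Rn n × Rn n => (z.1, z.2 + z.1))
      (volume.prod volume) (volume.prod volume) :=
    MeasurePreserving.skew_product (f := fun z : Rn n => z)
      (g := fun z ξ => ξ + z) (MeasurePreserving.id _) (by fun_prop)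
      (Filter.Eventually.of_forall fun z => (measurePreserving_add_right volume z).map_eq)
  have hi : Integrable (fun z : Rn n × Rn n => A z.2 * B (z.2 + z.1)) (volume.prod volume) := by
    have h := (hmp.integrable_comp_of_integrable (hAi.mul_prod hBi)).swap
    refine h.congr (Filter.Eventually.of_forall fun z => ?_)
    simp only [Function.comp, Prod.swap, add_comm]
  have e1 : ∀ u, wigner lam G Φ x u * cexp (-(I * ((inner ℝ w u : ℝ) : ℂ))) =
      ∫ m, A m * B (m + u) := by
    intro u
    rw [wigner, ft, ← integral_mul_const,
      ← integral_sub_right_eq_self (fun m => A m * B (m + u)) ((1 / 2 : ℝ) • u)]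
    refine integral_congr_ae (Filter.Eventually.of_forall fun m => ?_)
    have e2 : m - (1 / 2 : ℝ) • u + u = m + (1 / 2 : ℝ) • u := by module
    simp only [hA, hB, crossProd, e2]
    have e3 : cexp (-(I * ((inner ℝ (lam • x) m : ℝ) : ℂ))) *
        cexp (-(I * ((inner ℝ w u : ℝ) : ℂ))) =
        cexp (-(I * ((inner ℝ ((lam / 2) • x - w) (m - (1 / 2 : ℝ) • u) : ℝ) : ℂ))) *
        cexp (-(I * ((inner ℝ ((lam / 2) • x + w) (m + (1 / 2 : ℝ) • u) : ℝ) : ℂ))) := by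
      rw [← Complex.exp_add, ← Complex.exp_add]
      congr 1
      simp only [inner_sub_left, inner_sub_right, inner_add_left, inner_add_right,
        real_inner_smul_left, real_inner_smul_right]
      push_cast; ring
    linear_combination (G (m - (1 / 2 : ℝ) • u) * Φ (m + (1 / 2 : ℝ) • u)) * e3
  rw [ft]
  simp_rw [e1]
  rw [integral_integral_swap hi]
  have e4 : ∀ m, ∫ u, A m * B (m + u) = A m * ∫ y, B y := by
    intro m
    rw [integral_const_mul, integral_add_left_eq_self B m]
  simp_rw [e4]
  rw [integral_mul_const]
  rfl

theorem continuous_of_continuous_prod {n : ℕ} {F : Rn n → Rn n → ℂ}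
    (hF : Continuous fun z : Rn n × Rn n => F z.1 z.2) (x : Rn n) : Continuous (F x) :=
  hF.comp (by fun_prop : Continuous fun u : Rn n => (x, u))

theorem norm_ft_wigner_snd_le {n : ℕ} {lam p C : ℝ} (hlam : lam ≠ 0) (hp : 0 < p) (hC : 0 ≤ C)
    {G Φ : Rn n → ℂ} (hGc : Continuous G) (hΦc : Continuous Φ) (hG : GaussianDecay lam p C G)
    (hΦ : GaussianDecay lam p C Φ) (x w : Rn n) :
    ‖ft (wigner lam G Φ x) w‖ ≤
      C ^ 2 * (Real.exp (-p * ‖w‖ ^ 2) * Real.exp (-(p * lam ^ 2 / 4) * ‖x‖ ^ 2)) := by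
  rw [ft_wigner_snd lam (by positivity) hGc hΦc hG.1 hΦ.1, norm_mul]
  refine (norm_mul_le_gaussian_parallelogram hC hG.2 hΦ.2 _ w).trans (le_of_eq ?_)
  rw [norm_smul, mul_pow, Real.norm_eq_abs, sq_abs, mul_comm (Real.exp _)]
  congr 3 <;> ring

/-- Decay in x is not visible from the definition. It comes from the Gaussian bound on the transform
in u, by Fourier inversion. -/
theorem exists_norm_wigner_le_fst {n : ℕ} {lam p C : ℝ} (hlam : lam ≠ 0) (hp : 0 < p) (hC : 0 ≤ C)
    {G Φ : Rn n → ℂ} (hGc : Continuous G) (hΦc : Continuous Φ) (hG : GaussianDecay lam p C G)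
    (hΦ : GaussianDecay lam p C Φ) : ∃ K, 0 ≤ K ∧ ∀ x u : Rn n,
      ‖wigner lam G Φ x u‖ ≤ K * Real.exp (-(p * lam ^ 2 / 4) * ‖x‖ ^ 2) := by
  have hb : 0 < p * lam ^ 2 / 2 := by positivity
  have hgauss := integrable_gaussian (n := n) hp
  have hJ : 0 ≤ ∫ w : Rn n, Real.exp (-p * ‖w‖ ^ 2) := integral_nonneg fun _ => (Real.exp_pos _).le
  have hπ : (0 : ℝ) < (2 * Real.pi) ^ n := by positivity
  refine ⟨((2 * Real.pi) ^ n)⁻¹ * (C ^ 2 * ∫ w : Rn n, Real.exp (-p * ‖w‖ ^ 2)),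
    mul_nonneg (inv_nonneg.2 hπ.le) (mul_nonneg (sq_nonneg C) hJ), fun x u => ?_⟩
  have hcw := continuous_wigner lam hb hC hGc hΦc hG.1 hΦ.1
  have hc : Continuous (wigner lam G Φ x) := continuous_of_continuous_prod hcw x
  have hi : Integrable (wigner lam G Φ x) :=
    ((integrable_gaussian (n := n) (half_pos hb)).const_mul _).mono' hc.aestronglyMeasurable
      (Filter.Eventually.of_forall fun u => norm_wigner_le_snd lam hb hC hG.1 hΦ.1 x u)
  have hbd := norm_ft_wigner_snd_le hlam hp hC hGc hΦc hG hΦ x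
  have hbi := (hgauss.mul_const (Real.exp (-(p * lam ^ 2 / 4) * ‖x‖ ^ 2))).const_mul (C ^ 2)
  have hfi : Integrable (ft (wigner lam G Φ x)) :=
    hbi.mono' (continuous_ft hi).aestronglyMeasurable (Filter.Eventually.of_forall hbd)
  have hinv := ft_inversion hc hi hfi u
  have h1 : (2 * Real.pi) ^ n * ‖wigner lam G Φ x u‖ ≤
      C ^ 2 * ((∫ w : Rn n, Real.exp (-p * ‖w‖ ^ 2)) *
        Real.exp (-(p * lam ^ 2 / 4) * ‖x‖ ^ 2)) := by
    rw [← integral_mul_const, ← integral_const_mul]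
    calc _ = ‖((2 * Real.pi) ^ n : ℝ) * wigner lam G Φ x u‖ := by
          rw [norm_mul, norm_real, Real.norm_of_nonneg hπ.le]
      _ ≤ _ := by
        rw [← hinv]
        refine norm_integral_le_of_norm_le hbi (Filter.Eventually.of_forall fun w => ?_)
        rw [norm_mul, norm_cexp_I_mul, mul_one]
        exact hbd w
  rw [mul_assoc, mul_assoc, ← div_eq_inv_mul, le_div_iff₀ hπ, mul_comm]
  exact h1

/-- One bound decays in x only, the other in u only; their geometric mean decays in both. -/
theorem integrable_wigner {n : ℕ} {lam p C : ℝ} (hlam : lam ≠ 0) (hp : 0 < p) (hC : 0 ≤ C)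
    {G Φ : Rn n → ℂ} (hGc : Continuous G) (hΦc : Continuous Φ) (hG : GaussianDecay lam p C G)
    (hΦ : GaussianDecay lam p C Φ) :
    Integrable fun z : Rn n × Rn n => wigner lam G Φ z.1 z.2 := by
  have hb : 0 < p * lam ^ 2 / 2 := by positivity
  obtain ⟨K, hK, h1⟩ := exists_norm_wigner_le_fst hlam hp hC hGc hΦc hG hΦ
  have h2 := norm_wigner_le_snd lam hb hC hG.1 hΦ.1
  set K' := C ^ 2 * ∫ m : Rn n, Real.exp (-(2 * (p * lam ^ 2 / 2)) * ‖m‖ ^ 2)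
  have hK' : 0 ≤ K' := by positivity
  have ha : 0 < p * lam ^ 2 / 8 := by positivity
  have hg := (((integrable_gaussian (n := n) ha).mul_prod
    (integrable_gaussian (n := n) ha)).const_mul (Real.sqrt (K * K')))
  refine hg.mono' (continuous_wigner lam hb hC hGc hΦc hG.1 hΦ.1).aestronglyMeasurable
    (Filter.Eventually.of_forall fun z => ?_)
  refine (pow_le_pow_iff_left₀ (norm_nonneg _) (by positivity) two_ne_zero).1 ?_
  rw [sq]
  refine (mul_le_mul (h1 z.1 z.2) (h2 z.1 z.2) (norm_nonneg _) (by positivity)).trans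
    (le_of_eq ?_)
  rw [mul_pow, Real.sq_sqrt (by positivity), mul_pow, ← Real.exp_nat_mul, ← Real.exp_nat_mul,
    mul_mul_mul_comm]
  congr 3 <;> push_cast <;> ring

/-- Fourier inversion for the product G(m-u/2)Φ(m+u/2), rescaled by λ. Its hypothesis, integrability
of the transform, is the decay of the Wigner transform in x. -/
theorem ft_wigner_fst {n : ℕ} {lam p C : ℝ} (hlam : lam ≠ 0) (hp : 0 < p) (hC : 0 ≤ C)
    {G Φ : Rn n → ℂ} (hGc : Continuous G) (hΦc : Continuous Φ) (hG : GaussianDecay lam p C G)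
    (hΦ : GaussianDecay lam p C Φ) (u w : Rn n) :
    ft (fun x => wigner lam G Φ x u) w =
      (((2 * Real.pi) ^ n / |lam| ^ n : ℝ) : ℂ) * crossProd G Φ u (-(lam⁻¹ • w)) := by
  have hb : 0 < p * lam ^ 2 / 2 := by positivity
  obtain ⟨K, hK, h1⟩ := exists_norm_wigner_le_fst hlam hp hC hGc hΦc hG hΦ
  have hi := integrable_crossProd hb hC hGc hΦc hG.1 hΦ.1 u
  have hc : Continuous (crossProd G Φ u) :=
    (continuous_crossProd hGc hΦc).comp (by fun_prop : Continuous fun m => (u, m))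
  have hfi : Integrable (ft (crossProd G Φ u)) := by
    refine ((integrable_gaussian (n := n) (a := p / 4) (by positivity)).const_mul K).mono'
      (continuous_ft hi).aestronglyMeasurable (Filter.Eventually.of_forall fun q => ?_)
    have h := h1 (lam⁻¹ • q) u
    rw [wigner, smul_smul, mul_inv_cancel₀ hlam, one_smul] at h
    refine h.trans (le_of_eq ?_)
    rw [norm_smul, mul_pow, Real.norm_eq_abs, sq_abs]
    congr 2
    field_simp
  have hinv := ft_inversion hc hi hfi (-(lam⁻¹ • w))
  have hsm := Measure.integral_comp_smul (volume : Measure (Rn n)) (fun q =>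
    ft (crossProd G Φ u) q * cexp (I * ((inner ℝ q (-(lam⁻¹ • w)) : ℝ) : ℂ))) lam
  rw [hinv, finrank_euclideanSpace_fin] at hsm
  have e : ft (fun x => wigner lam G Φ x u) w = ∫ x, ft (crossProd G Φ u) (lam • x) *
      cexp (I * ((inner ℝ (lam • x) (-(lam⁻¹ • w)) : ℝ) : ℂ)) := by
    rw [ft]
    refine integral_congr_ae (Filter.Eventually.of_forall fun x => ?_)
    simp only [wigner]
    rw [inner_neg_right, real_inner_smul_left, real_inner_smul_right, ← mul_assoc,
      mul_inv_cancel₀ hlam, one_mul, real_inner_comm]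
    push_cast
    rw [mul_neg]
  rw [e]
  refine hsm.trans ?_
  rw [real_smul, ← mul_assoc, ← ofReal_mul, abs_inv, abs_pow]
  congr 2
  field_simp

theorem gaussianPair_wigner {n : ℕ} {lam p C : ℝ} (hlam : lam ≠ 0) (hp : 0 < p) (hC : 0 ≤ C)
    {G Φ : Rn n → ℂ} (hGc : Continuous G) (hΦc : Continuous Φ) (hG : GaussianDecay lam p C G)
    (hΦ : GaussianDecay lam p C Φ) :
    ∃ K, GaussianPair lam p K (wigner lam G Φ) := by
  refine ⟨max ((2 * Real.pi) ^ n / |lam| ^ n * C ^ 2) (C ^ 2),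
    Filter.Eventually.of_forall fun z => ?_, Filter.Eventually.of_forall fun z => ?_⟩
  · rw [ft_wigner_fst hlam hp hC hGc hΦc hG hΦ, norm_mul, norm_real,
      Real.norm_of_nonneg (by positivity)]
    have h := norm_crossProd_le hC hG.1 hΦ.1 z.2 (-(lam⁻¹ • z.1))
    have e : Real.exp (-(2 * (p * lam ^ 2 / 2)) * ‖-(lam⁻¹ • z.1)‖ ^ 2) *
        Real.exp (-(p * lam ^ 2 / 2 / 2) * ‖z.2‖ ^ 2) =
        Real.exp (-(p * ‖z.1‖ ^ 2 + p * lam ^ 2 / 4 * ‖z.2‖ ^ 2)) := by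
      rw [← Real.exp_add, norm_neg, norm_smul, mul_pow, Real.norm_eq_abs, sq_abs]
      congr 1
      field_simp
      ring
    rw [e] at h
    calc _ ≤ (2 * Real.pi) ^ n / |lam| ^ n * _ := mul_le_mul_of_nonneg_left h (by positivity)
      _ = ((2 * Real.pi) ^ n / |lam| ^ n * C ^ 2) * _ := (mul_assoc _ _ _).symm
      _ ≤ _ := mul_le_mul_of_nonneg_right (le_max_left _ _) (Real.exp_pos _).le
  · refine (norm_ft_wigner_snd_le hlam hp hC hGc hΦc hG hΦ z.2 z.1).trans ?_
    rw [← Real.exp_add]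
    have e : -p * ‖z.1‖ ^ 2 + -(p * lam ^ 2 / 4) * ‖z.2‖ ^ 2 =
      -(p * ‖z.1‖ ^ 2 + p * lam ^ 2 / 4 * ‖z.2‖ ^ 2) := by ring
    rw [e]
    exact mul_le_mul_of_nonneg_right (le_max_right _ _) (Real.exp_pos _).le

/-- The kernel at (ξ, ξ+u) is a multiple of G(ξ)Φ(ξ+u), so the operator has rank one. No conjugate
appears: Φ will be the real ground state. -/
theorem weylFun_wigner {n : ℕ} {lam p C : ℝ} (hlam : lam ≠ 0) (hp : 0 < p) (hC : 0 ≤ C)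
    {G Φ : Rn n → ℂ} (hGc : Continuous G) (hΦc : Continuous Φ) (hG : GaussianDecay lam p C G)
    (hΦ : GaussianDecay lam p C Φ) (ξ : Rn n) :
    weylFun lam (wigner lam G Φ) Φ ξ =
      (((2 * Real.pi) ^ n / |lam| ^ n : ℝ) : ℂ) * (G ξ * ∫ y, Φ y * Φ y) := by
  have hM : ∀ x, ‖Φ x‖ ≤ C := fun x => (hΦ.1 x).trans
    (mul_le_of_le_one_right hC (by rw [Real.exp_le_one_iff, neg_mul, neg_nonpos]; positivity))
  rw [weylFun_eq_integral_ft lam (integrable_wigner hlam hp hC hGc hΦc hG hΦ) hΦc hM,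
    ← integral_add_left_eq_self (fun y => Φ y * Φ y) ξ, ← integral_const_mul, ← integral_const_mul]
  refine integral_congr_ae (Filter.Eventually.of_forall fun u => ?_)
  simp only
  rw [ft_wigner_fst hlam hp hC hGc hΦc hG hΦ, smul_neg, neg_neg, smul_smul,
    inv_mul_cancel₀ hlam, one_smul, crossProd]
  have e1 : ξ + (1 / 2 : ℝ) • u - (1 / 2 : ℝ) • u = ξ := by module
  have e2 : ξ + (1 / 2 : ℝ) • u + (1 / 2 : ℝ) • u = ξ + u := by module
  rw [e1, e2]
  ring

/-! ### Realising elements of E_t with the ground state -/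

theorem GaussianDecay.mono {n : ℕ} {lam p C C' : ℝ} {G : Rn n → ℂ} (h : GaussianDecay lam p C G)
    (hC : C ≤ C') : GaussianDecay lam p C' G :=
  ⟨fun x => (h.1 x).trans (mul_le_mul_of_nonneg_right hC (Real.exp_pos _).le),
    fun x => (h.2 x).trans (mul_le_mul_of_nonneg_right hC (Real.exp_pos _).le)⟩

/-- Matches the decay found for elements of E_t with the parameter p = τ/|λ| of 𝒜: level ε
corresponds to τ = ε/(1+ε). -/
theorem gaussianDecay_iff {n : ℕ} {lam ε C : ℝ} (hlam : lam ≠ 0) (G : Rn n → ℂ) :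
    GaussianDecay lam (ε / (1 + ε) / |lam|) C G ↔
      (∀ x, ‖G x‖ ≤ C * Real.exp (-(ε / (2 * (1 + ε)) * |lam|) * ‖x‖ ^ 2)) ∧
        ∀ p, ‖ft G p‖ ≤ C * Real.exp (-(ε / (2 * (1 + ε)) / |lam|) * ‖p‖ ^ 2) := by
  have hl : 0 < |lam| := abs_pos.2 hlam
  have e1 : ε / (1 + ε) / |lam| * lam ^ 2 / 2 = ε / (2 * (1 + ε)) * |lam| := by
    rw [← sq_abs, mul_comm 2, ← div_div]; field_simp
  have e2 : ε / (1 + ε) / |lam| / 2 = ε / (2 * (1 + ε)) / |lam| := by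
    rw [mul_comm 2, ← div_div]; ring
  rw [GaussianDecay, e1, e2]

/-- For α = 0 the growth factor e^{ε|α|} is 1, so the ground state is admissible at every level ε.
-/
theorem exists_gaussianDecay_hermiteFunN_zero (n : ℕ) {lam ε : ℝ} (hlam : lam ≠ 0) (hε : 0 < ε) :
    ∃ C, GaussianDecay lam (ε / (1 + ε) / |lam|) C (hermiteFunN (n := n) lam 0) := by
  refine ⟨max (|lam| ^ ((n : ℝ) / 4) * 2 ^ n) (|lam| ^ ((n : ℝ) / 4) *
    (2 * ((Real.sqrt |lam|)⁻¹ * Real.sqrt (2 * Real.pi))) ^ n),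
    (gaussianDecay_iff hlam _).2 ⟨fun x => ?_, fun p => ?_⟩⟩
  · have h := norm_hermiteFunN_le (lam := lam) hε 0 x
    simp only [Pi.zero_apply, Nat.cast_zero, zero_add, pow_zero, mul_one, Finset.prod_const_one] at h
    exact h.trans (mul_le_mul_of_nonneg_right (le_max_left _ _) (Real.exp_pos _).le)
  · have h := norm_ft_hermiteFunN_le hlam hε 0 p
    simp only [Pi.zero_apply, Nat.cast_zero, zero_add, pow_zero, mul_one, Finset.prod_const_one] at h
    exact h.trans (mul_le_mul_of_nonneg_right (le_max_right _ _) (Real.exp_pos _).le)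

theorem integral_hermiteFunN_sq {n : ℕ} {lam : ℝ} (hlam : lam ≠ 0) (α : Fin n → ℕ) :
    ∫ y, hermiteFunN lam α y * hermiteFunN lam α y = 1 := by
  classical
  have h := inner_hermiteL2 hlam α (hermiteL2 hlam α)
  rw [orthonormal_iff_ite.1 (orthonormal_hermiteL2 hlam), if_pos rfl] at h
  rw [h]
  refine integral_congr_ae ?_
  filter_upwards [(memLp_hermiteFunN hlam α).coeFn_toLp] with y hy
  rw [hermiteL2, hy]

theorem weylFun_congr_ae {n : ℕ} (lam : ℝ) {F F' : Rn n → Rn n → ℂ}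
    (h : ∀ᵐ z : Rn n × Rn n, F z.1 z.2 = F' z.1 z.2) (ψ : Rn n → ℂ) :
    weylFun lam F ψ = weylFun lam F' ψ := by
  funext ξ
  refine integral_congr_ae ?_
  filter_upwards [h] with z hz
  rw [hz]

theorem weylFun_const_mul {n : ℕ} (lam : ℝ) (c : ℂ) (F : Rn n → Rn n → ℂ) (ψ : Rn n → ℂ)
    (ξ : Rn n) : weylFun lam (fun x u => c * F x u) ψ ξ = c * weylFun lam F ψ ξ := by
  simp only [weylFun]
  rw [← integral_const_mul]
  refine integral_congr_ae (Filter.Eventually.of_forall fun z => ?_)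
  simp only
  ring

/-- Every integrable function on `ℝⁿ × ℝⁿ` is `f^λ` for some `f ∈ L¹(ℍⁿ)`. -/
theorem exists_partialInvFourier_eq {n : ℕ} (lam : ℝ) {F : Rn n → Rn n → ℂ}
    (hF : Integrable fun z : Rn n × Rn n => F z.1 z.2) : ∃ f : L1Heis n,
      ∀ᵐ z : Rn n × Rn n, partialInvFourier lam f z.1 z.2 = F z.1 z.2 := by
  -- An integrable profile in t whose integral against e^{iλt} equals 1; f is its tensor product
  -- with F.
  set h : ℝ → ℂ := fun t => (Set.Icc (0 : ℝ) 1).indicator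
    (fun t => cexp (-(I * ((lam * t : ℝ) : ℂ)))) t with hh
  have hhi : Integrable h := by
    refine IntegrableOn.integrable_indicator ?_ measurableSet_Icc
    exact Continuous.integrableOn_Icc (by fun_prop)
  set f : Heis n → ℂ := fun p => F p.1 p.2.1 * h p.2.2 with hf
  have hfi : Integrable f := ((measurePreserving_heisAssoc n).integrable_comp_emb
    (measurableEmbedding_heisAssoc n)).1 (hF.mul_prod hhi)
  have e1 : ∫ t, h t * cexp (I * ((lam * t : ℝ) : ℂ)) = 1 := by
    have e2 : ∀ t, h t * cexp (I * ((lam * t : ℝ) : ℂ)) =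
        (Set.Icc (0 : ℝ) 1).indicator (fun _ => (1 : ℂ)) t := by
      intro t
      by_cases ht : t ∈ Set.Icc (0 : ℝ) 1
      · simp only [hh, Set.indicator_of_mem ht]
        rw [← Complex.exp_add, neg_add_cancel, Complex.exp_zero]
      · simp only [hh, Set.indicator_of_notMem ht, zero_mul]
    simp_rw [e2]
    rw [integral_indicator measurableSet_Icc]
    simp
  refine ⟨hfi.toL1 f, ?_⟩
  filter_upwards [partialInvFourier_congr_ae hfi.coeFn_toL1 lam] with z hz
  rw [hz]
  simp only [partialInvFourier, hf, mul_assoc]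
  rw [integral_const_mul, e1, mul_one]

/-- f^λ is a multiple of the Fourier–Wigner transform of G and the ground state. The level ε₀ serves
only for integrability and to verify π_λ(f)Φ₀ = g; since f does not depend on ε, any further decay
of G passes to the same f. -/
theorem exists_schrodingerInt_eq {n : ℕ} {lam ε₀ : ℝ} (hlam : lam ≠ 0) (hε₀ : 0 < ε₀)
    {g : L2Rn n} {G : Rn n → ℂ} (hGc : Continuous G) (hg : g =ᵐ[volume] G)
    (hG : ∃ C, GaussianDecay lam (ε₀ / (1 + ε₀) / |lam|) C G) :
    ∃ f : L1Heis n, schrodingerInt lam f (hermiteL2 hlam 0) = g ∧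
      ∀ ε, 0 < ε → (∃ C, GaussianDecay lam (ε / (1 + ε) / |lam|) C G) →
        ∃ K, GaussianPair lam (ε / (1 + ε) / |lam|) K (partialInvFourier lam f) := by
  have hl : 0 < |lam| := abs_pos.2 hlam
  set Φ := hermiteFunN (n := n) lam 0 with hΦdef
  have hΦc : Continuous Φ := continuous_hermiteFunN lam 0
  have key : ∀ ε, 0 < ε → (∃ C, GaussianDecay lam (ε / (1 + ε) / |lam|) C G) →
      ∃ C, 0 ≤ C ∧ GaussianDecay lam (ε / (1 + ε) / |lam|) C G ∧
        GaussianDecay lam (ε / (1 + ε) / |lam|) C Φ := by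
    rintro ε hε ⟨C, hC⟩
    obtain ⟨C', hC'⟩ := exists_gaussianDecay_hermiteFunN_zero n hlam hε
    exact ⟨max 0 (max C C'), le_max_left _ _,
      hC.mono ((le_max_left _ _).trans (le_max_right _ _)),
      hC'.mono ((le_max_right _ _).trans (le_max_right _ _))⟩
  obtain ⟨C, hC, h1, h2⟩ := key ε₀ hε₀ hG
  have hp₀ : 0 < ε₀ / (1 + ε₀) / |lam| := by positivity
  set c : ℝ := (2 * Real.pi) ^ n / |lam| ^ n with hc
  have hc0 : (c : ℂ) ≠ 0 := ofReal_ne_zero.2 (by positivity)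
  obtain ⟨f, hf⟩ := exists_partialInvFourier_eq lam (F := fun x u => (c : ℂ)⁻¹ * wigner lam G Φ x u)
    ((integrable_wigner hlam hp₀ hC hGc hΦc h1 h2).const_mul _)
  refine ⟨f, ?_, fun ε hε hGε => ?_⟩
  · refine sub_eq_zero.1 (eq_zero_of_inner_hermiteL2 hlam fun α => ?_)
    rw [inner_sub_right, sub_eq_zero]
    have hM : ∀ x, ‖Φ x‖ ≤ C := fun x => (h2.1 x).trans
      (mul_le_of_le_one_right hC (by rw [Real.exp_le_one_iff, neg_mul, neg_nonpos]; positivity))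
    rw [inner_hermiteL2_schrodingerInt hlam f (hermiteL2 hlam 0) hΦc hM
      (memLp_hermiteFunN hlam 0).coeFn_toLp, weylFun_congr_ae lam
        (F' := fun x u => (c : ℂ)⁻¹ * wigner lam G Φ x u) hf, inner_hermiteL2]
    refine integral_congr_ae ?_
    filter_upwards [hg] with ξ hξ
    rw [weylFun_const_mul, weylFun_wigner hlam hp₀ hC hGc hΦc h1 h2, integral_hermiteFunN_sq hlam,
      hξ, mul_one, inv_mul_cancel_left₀ hc0]
  · obtain ⟨D, hD, d1, d2⟩ := key ε hε hGε
    obtain ⟨K, hK⟩ := gaussianPair_wigner hlam (by positivity) hD hGc hΦc d1 d2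
    refine ⟨_, (hK.const_mul (c : ℂ)⁻¹).congr_ae ?_⟩
    filter_upwards [hf] with z hz
    exact hz.symm

theorem exists_of_mem_spaceE {n : ℕ} {lam t : ℝ} (hlam : lam ≠ 0) (ht : 0 < t) {g : L2Rn n}
    (hg : g ∈ spaceE n hlam t) :
    ∃ s > 0, ∃ f ∈ spaceA n lam s, ∃ φ, schrodingerInt lam f φ = g := by
  have hl : 0 < |lam| := abs_pos.2 hlam
  obtain ⟨G, hGc, hgG, hb⟩ := exists_continuous_of_mem_spaceE hlam ht hg
  have hε : 0 < t * |lam| := by positivity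
  obtain ⟨C, -, hC⟩ := hb (t * |lam|) hε (by linarith)
  have hGd : ∃ C, GaussianDecay lam (t * |lam| / (1 + t * |lam|) / |lam|) C G :=
    ⟨C, (gaussianDecay_iff hlam G).2 hC⟩
  obtain ⟨f, hf, hfA⟩ := exists_schrodingerInt_eq hlam hε hGc hgG hGd
  obtain ⟨K, hK⟩ := hfA _ hε hGd
  set τ := t * |lam| / (1 + t * |lam|) with hτ
  have hτ0 : 0 < τ := by positivity
  have hτ1 : τ < 1 := by rw [hτ, div_lt_one (by positivity)]; linarith
  -- The time s at which tanh(s|λ|) = τ.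
  refine ⟨Real.artanh τ / |lam|, div_pos (Real.artanh_pos ⟨hτ0, hτ1⟩) hl, f, ?_, _, hf⟩
  rw [mem_spaceA_iff hlam, tanh_mul_div, div_mul_cancel₀ _ hl.ne',
    Real.tanh_artanh ⟨by linarith, hτ1⟩]
  exact ⟨K, hK⟩

theorem exists_of_forall_mem_spaceE {n : ℕ} {lam : ℝ} (hlam : lam ≠ 0) {g : L2Rn n}
    (hg : ∀ t > 0, g ∈ spaceE n hlam t) :
    ∃ f : L1Heis n, (∀ s > 0, f ∈ spaceA n lam s) ∧ ∃ φ, schrodingerInt lam f φ = g := by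
  have hl : 0 < |lam| := abs_pos.2 hlam
  obtain ⟨G, hGc, hgG, -⟩ := exists_continuous_of_mem_spaceE hlam one_pos (hg 1 one_pos)
  have hGd : ∀ ε, 0 < ε → ∃ C, GaussianDecay lam (ε / (1 + ε) / |lam|) C G := by
    intro ε hε
    have ht : 0 < ε / |lam| := by positivity
    obtain ⟨G', hGc', hgG', hb⟩ := exists_continuous_of_mem_spaceE hlam ht (hg _ ht)
    -- Continuous representatives of one L² class coincide, so a single G has the decay of every
    -- level.
    have e : G' = G := (hGc'.ae_eq_iff_eq volume hGc).1 (hgG'.symm.trans hgG)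
    obtain ⟨C, -, hC⟩ := hb ε hε (by rw [mul_assoc, div_mul_cancel₀ _ hl.ne']; linarith)
    rw [e] at hC
    exact ⟨C, (gaussianDecay_iff hlam G).2 hC⟩
  obtain ⟨f, hf, hfA⟩ := exists_schrodingerInt_eq hlam one_pos hGc hgG (hGd 1 one_pos)
  refine ⟨f, fun s hs => ?_, _, hf⟩
  rw [mem_spaceA_iff hlam, tanh_mul_div]
  set τ := Real.tanh (s * |lam|)
  have hτ0 : 0 < τ := by simpa using tanh_strictMono (mul_pos hs hl)
  have hτ1 : 0 < 1 - τ := sub_pos.2 (Real.tanh_lt_one _)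
  -- The level ε solving ε/(1+ε) = τ; it exists because tanh < 1.
  have hε : 0 < τ / (1 - τ) := by positivity
  have e : τ / (1 - τ) / (1 + τ / (1 - τ)) = τ := by field_simp; ring
  have h := hfA _ hε (hGd _ hε)
  rwa [e] at h

end HeisenbergAnalytic

end

/-! ### The theorem assembled -/

theorem theorem1p2 (n : ℕ) (lam : ℝ) (hlam : lam ≠ 0) :
    Set.image2 (HeisenbergAnalytic.schrodingerInt lam)
        (⋃ t ∈ Set.Ioi (0 : ℝ), HeisenbergAnalytic.spaceA n lam t) Set.univ =
      (⋃ t ∈ Set.Ioi (0 : ℝ), HeisenbergAnalytic.spaceE n hlam t) ∧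
    Set.image2 (HeisenbergAnalytic.schrodingerInt lam)
        (⋂ t ∈ Set.Ioi (0 : ℝ), HeisenbergAnalytic.spaceA n lam t) Set.univ =
      (⋂ t ∈ Set.Ioi (0 : ℝ), HeisenbergAnalytic.spaceE n hlam t) ∧
    HeisenbergAnalytic.IsConvAlgebra
      (⋃ t ∈ Set.Ioi (0 : ℝ), HeisenbergAnalytic.spaceA n lam t) ∧
    HeisenbergAnalytic.IsConvAlgebra
      (⋂ t ∈ Set.Ioi (0 : ℝ), HeisenbergAnalytic.spaceA n lam t) := by
  refine ⟨Set.Subset.antisymm ?_ fun g hg => ?_, Set.Subset.antisymm ?_ fun g hg => ?_,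
    HeisenbergAnalytic.isConvAlgebra_iUnion_spaceA hlam,
    HeisenbergAnalytic.isConvAlgebra_iInter_spaceA hlam⟩
  · rintro _ ⟨f, hf, φ, -, rfl⟩
    obtain ⟨t, ht, hft⟩ := Set.mem_iUnion₂.1 hf
    obtain ⟨s, hs, h⟩ := HeisenbergAnalytic.schrodingerInt_mem_iUnion hlam ht hft φ
    exact Set.mem_iUnion₂.2 ⟨s, hs, h⟩
  · obtain ⟨t, ht, hgt⟩ := Set.mem_iUnion₂.1 hg
    obtain ⟨s, hs, f, hf, φ, h⟩ := HeisenbergAnalytic.exists_of_mem_spaceE hlam ht hgt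
    exact ⟨f, Set.mem_iUnion₂.2 ⟨s, hs, hf⟩, φ, Set.mem_univ _, h⟩
  · rintro _ ⟨f, hf, φ, -, rfl⟩
    exact Set.mem_iInter₂.2 fun s hs => HeisenbergAnalytic.schrodingerInt_mem_iInter hlam
      (fun t ht => Set.mem_iInter₂.1 hf t ht) φ hs
  · obtain ⟨f, hf, φ, h⟩ := HeisenbergAnalytic.exists_of_forall_mem_spaceE hlam
      fun t ht => Set.mem_iInter₂.1 hg t ht
    exact ⟨f, Set.mem_iInter₂.2 fun s hs => hf s hs, φ, Set.mem_univ _, h⟩
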